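/- Let $(M,J,g)$ be a Hermitian manifold of complex dimension $n$: a (not necessarily compact) complex manifold $M$, with complex structure $J$ on its tangent spaces, and a smooth Riemannian metric $g$ with $g(JX,JY)=g(X,Y)$. Let $A_{\mathbb C}=\bigoplus_k A^k_{\mathbb C}$ be the algebra of smooth complex differential forms on $M$ with the wedge product, and let $d=\partial+\bar\partial$ be the decomposition of the exterior derivative into its components of bidegree $(1,0)$ and $(0,1)$. Let $\omega(X,Y)=g(JX,Y)$ be the fundamental form, let $\star$ be the $\mathbb C$-linear Hodge star of $g$ with respect to the volume form $\omega^n/n!$, and put $\partial^*=-\star\bar\partial\star$. Let $L=\omega\wedge\_$, let $\lambda=\partial\omega\wedge\_$, and let $\Lambda=L^*$ and $\lambda^*$ be the adjoints of $L$ and $\lambda$ for the pointwise Hermitian inner product of forms induced by $g$. Let $\tau=[\Lambda,\lambda]$ be the torsion operator and $\tau^*=[\lambda^*,L]$ its adjoint. Put $$\Delta_0=\bar\partial,\qquad \Delta_1=-i(\partial^*+\tau^*),\qquad \Delta_2=i\lambda^*,\qquad \Delta_k=0\ \text{ for } k\ge 3 .$$ Then the following hold. 1. $(A_{\mathbb C},\wedge,\Delta_0,\Delta_1,\Delta_2)$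 is a commutative $BV_\infty$-algebra. That is: $(A_{\mathbb C},\wedge,\bar\partial)$ is a graded-commutative differential graded algebra; each $\Delta_k$ has degree $1-2k$, and $\sum_{i+j=m}\Delta_i\Delta_j=0$ for all $m\ge 0$ (so that $(A_{\mathbb C},\Delta_0,\Delta_1,\Delta_2)$ is a multicomplex); and $\Delta_k$ is an operator of algebraic order at most $k+1$ for all $k\ge1$. Here a homogeneous operator has order at most $0$ if it commutes, in the graded sense, with left multiplication by every homogeneous element of the algebra, and order at most $r+1$ if its graded commutators with all these left multiplications have order at most $r$. 2. The total differential $\mathbb D=\bar\partial-i(\partial^*+\tau^*)\xi+i\lambda^*\xi^2\in \mathrm{End}(A_{\mathbb C})[[\xi]]$, where $\xi$ is a formal central variable, satisfies $$\mathbb D=e^{\Lambda\xi}\,\bar\partial\,e^{-\Lambda\xi}.$$ 3. The multicomplex $(A_{\mathbb C},\Delta_0,\Delta_1,\Delta_2)$ has the degeneration property: there is $\varphi=\sum_{k\ge1}\varphi_k\xi^k$ with $\varphi_k\in\mathrm{End}(A_{\mathbb C})$ of degree $-2k$ such that $e^{\varphi}\,\Delta_0\,e^{-\varphi}=\Delta_0+\Delta_1\xi+\Delta_2\xi^2$.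 -/

import Mathlib

open scoped Manifold ContDiff Bundle ComplexConjugate

/-! ## Algebra: commutative BV-infinity algebras and the degeneration property -/

section BV

variable {K A : Type*} [Field K] [Ring A] [Algebra K A]

/-- `f` is homogeneous of degree `k` for the grading `𝒜`. -/
def HasDegree (𝒜 : ℤ → Submodule K A) (k : ℤ) (f : Module.End K A) : Prop :=
  ∀ j : ℤ, ∀ a ∈ 𝒜 j, f a ∈ 𝒜 (j + k)

/-- The graded commutator `[f, g] = f g - (-1)^(j k) g f` of operators of degrees `j` and `k`. -/
def gradedComm (j k : ℤ) (f g : Module.End K A) : Module.End K A :=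
  f * g - (j * k).negOnePow • (g * f)

lemma gradedComm_of_even {j k : ℤ} (h : Even (j * k)) (f g : Module.End K A) :
    gradedComm j k f g = f * g - g * f := by
  rw [gradedComm, Int.negOnePow_even _ h, one_smul]

/-- `f` is an operator of degree `k` and algebraic order at most `r` (Grothendieck): in order `0`
it commutes in the graded sense with all left multiplications, and in order at most `r + 1` its
graded commutators with left multiplications have order at most `r`. -/
def HasOrderLE (𝒜 : ℤ → Submodule K A) : ℕ → ℤ → Module.End K A → Prop
  | 0, k, f => HasDegree 𝒜 k f ∧
      ∀ j : ℤ, ∀ a ∈ 𝒜 j, gradedComm j k (LinearMap.mulLeft K a) f = 0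
  | r + 1, k, f => HasDegree 𝒜 k f ∧
      ∀ j : ℤ, ∀ a ∈ 𝒜 j, HasOrderLE 𝒜 r (j + k) (gradedComm j k (LinearMap.mulLeft K a) f)

/-- `(A, 𝒜, d)` is a (unital, `ℤ`-graded) commutative differential graded algebra. -/
structure IsCommDGAlgebra (𝒜 : ℤ → Submodule K A) (d : Module.End K A) : Prop where
  isInternal : DirectSum.IsInternal 𝒜
  gradedMonoid : SetLike.GradedMonoid 𝒜
  graded_comm : ∀ i j : ℤ, ∀ a ∈ 𝒜 i, ∀ b ∈ 𝒜 j, a * b = (i * j).negOnePow • (b * a)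
  degree : HasDegree 𝒜 1 d
  leibniz : ∀ i : ℤ, ∀ a ∈ 𝒜 i, ∀ b : A, d (a * b) = d a * b + i.negOnePow • (a * d b)
  sq_zero : d * d = 0

/-- A multicomplex: operators `Δ i` of degree `1 - 2 i` with `∑_{i + j = n} Δ i Δ j = 0`. -/
structure IsMulticomplex (𝒜 : ℤ → Submodule K A) (Δ : ℕ → Module.End K A) : Prop where
  isInternal : DirectSum.IsInternal 𝒜
  degree : ∀ i : ℕ, HasDegree 𝒜 (1 - 2 * (i : ℤ)) (Δ i)
  relation : ∀ n : ℕ, ∑ ij ∈ Finset.HasAntidiagonal.antidiagonal n, Δ ij.1 * Δ ij.2 = 0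

/-- A commutative BV-infinity algebra `(A, d = Δ 0, Δ 1, Δ 2, …)`. -/
structure IsCommBVInfty (𝒜 : ℤ → Submodule K A) (Δ : ℕ → Module.End K A) : Prop where
  cdga : IsCommDGAlgebra 𝒜 (Δ 0)
  multicomplex : IsMulticomplex 𝒜 Δ
  order : ∀ n : ℕ, 1 ≤ n → HasOrderLE 𝒜 (n + 1) (1 - 2 * (n : ℤ)) (Δ n)

/-- The exponential `e^φ = ∑ φ^k / k!` of a formal power series `φ` in `ξ` with operator
coefficients and without constant term (so that only `k ≤ n` contributes to `ξ^n`). -/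
noncomputable def opExp (φ : PowerSeries (Module.End K A)) : PowerSeries (Module.End K A) :=
  PowerSeries.mk fun n =>
    ∑ k ∈ Finset.range (n + 1), ((k.factorial : K)⁻¹) • PowerSeries.coeff n (φ ^ k)

/-- The degeneration property: the gauge equation `e^φ d e^{-φ} = d + Δ₁ ξ + Δ₂ ξ² + ⋯` has a
solution `φ = φ₁ ξ + φ₂ ξ² + ⋯`, with `φ i` of degree `-2 i`. -/
def HasDegenerationProperty (𝒜 : ℤ → Submodule K A) (Δ : ℕ → Module.End K A) : Prop :=
  ∃ φ : PowerSeries (Module.End K A), PowerSeries.coeff 0 φ = 0 ∧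
    (∀ i : ℕ, HasDegree 𝒜 (-2 * (i : ℤ)) (PowerSeries.coeff i φ)) ∧
    opExp φ * PowerSeries.C (Δ 0) * opExp (-φ) = PowerSeries.mk Δ

end BV

noncomputable section

/-! ## Linear algebra of one tangent space -/

section Fibre

variable (E : Type*) [NormedAddCommGroup E] [NormedSpace ℂ E]

/-- Complex covectors on `E`, i.e. the complexified dual of the real vector space `E`. -/
abbrev CxCovector : Type _ := E →L[ℝ] ℂ

/-- The complexified exterior algebra of the dual of the real vector space `E`. -/
abbrev CxExt : Type _ := ExteriorAlgebra ℂ (CxCovector E)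

instance CxCovector.instFinite [FiniteDimensional ℂ E] : Module.Finite ℂ (CxCovector E) :=
  Module.Finite.of_injective (ContinuousLinearMap.coeLM ℂ : (E →L[ℝ] ℂ) →ₗ[ℂ] (E →ₗ[ℝ] ℂ))
    ContinuousLinearMap.coe_injective

instance CxExt.instFinite [FiniteDimensional ℂ E] : Module.Finite ℂ (CxExt E) :=
  Module.Finite.of_basis (Module.finBasis ℂ (CxCovector E)).ExteriorAlgebra

variable {E}

/-- Pull-back of covectors along a complex linear map. -/
def pullCovector (T : E →L[ℂ] E) : CxCovector E →ₗ[ℂ] CxCovector E where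
  toFun ε := ε.comp (T.restrictScalars ℝ)
  map_add' _ _ := rfl
  map_smul' _ _ := rfl

/-- Pull-back of exterior forms along a complex linear map. -/
def pullExt (T : E →L[ℂ] E) : CxExt E →ₐ[ℂ] CxExt E := ExteriorAlgebra.map (pullCovector T)

/-- Precomposition of a covector with `J`, the multiplication by `i` on `E`. -/
def covectorJ : CxCovector E →ₗ[ℂ] CxCovector E :=
  pullCovector (Complex.I • ContinuousLinearMap.id ℂ E)

/-- The projection of covectors onto type `(1, 0)`: `ε ↦ (ε - i ε ∘ J) / 2`. -/
def covector10 : CxCovector E →ₗ[ℂ] CxCovector E :=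
  (2⁻¹ : ℂ) • (LinearMap.id - Complex.I • covectorJ)

/-- The projection of covectors onto type `(0, 1)`: `ε ↦ (ε + i ε ∘ J) / 2`. -/
def covector01 : CxCovector E →ₗ[ℂ] CxCovector E :=
  (2⁻¹ : ℂ) • (LinearMap.id + Complex.I • covectorJ)

/-- The algebra homomorphism `∧ → ∧[s][t]` with `ε ↦ s ε^{1,0} + t ε^{0,1}`, which multiplies a
form of type `(p, q)` by `s^p t^q`. -/
def typeHom : CxExt E →ₐ[ℂ] Polynomial (Polynomial (CxExt E)) :=
  ExteriorAlgebra.lift ℂ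
    ⟨{ toFun := fun ε => Polynomial.C (Polynomial.monomial 1 (ExteriorAlgebra.ι ℂ (covector10 ε)))
          + Polynomial.monomial 1 (Polynomial.C (ExteriorAlgebra.ι ℂ (covector01 ε)))
       map_add' := fun a b => by simp only [map_add]; abel
       map_smul' := fun c a => by
        simp only [map_smul, RingHom.id_apply, smul_add, ← Polynomial.smul_monomial,
          ← Polynomial.smul_C] }, fun ε => by
      simp only [LinearMap.coe_mk, AddHom.coe_mk, mul_add, add_mul,
        ← Polynomial.monomial_zero_left, Polynomial.monomial_mul_monomial,
        ExteriorAlgebra.ι_sq_zero, map_zero, zero_add, add_zero]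
      rw [← map_add, ← map_add, add_comm (ExteriorAlgebra.ι ℂ (covector01 ε) * _),
        ExteriorAlgebra.ι_add_mul_swap, map_zero, map_zero]⟩

/-- The projection of forms onto type `(p, q)`. -/
def typeProj (p q : ℕ) : CxExt E →ₗ[ℂ] CxExt E where
  toFun a := ((typeHom a).coeff q).coeff p
  map_add' a b := by simp
  map_smul' c a := by simp

/-- Complex conjugation of covectors. -/
def conjCovector (ε : CxCovector E) : CxCovector E :=
  (Complex.conjCLE : ℂ →L[ℝ] ℂ).comp ε

/-- The ring `B` with the complex conjugate `ℂ`-algebra structure. -/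
def ConjAlg (B : Type*) : Type _ := B

instance ConjAlg.instRing (B : Type*) [Ring B] : Ring (ConjAlg B) := inferInstanceAs (Ring B)

instance ConjAlg.instAlgebra (B : Type*) [Ring B] [Algebra ℂ B] : Algebra ℂ (ConjAlg B) :=
  RingHom.toAlgebra' (((algebraMap ℂ B).comp (starRingEnd ℂ) : ℂ →+* B) : ℂ →+* ConjAlg B)
    fun c b => Algebra.commutes (A := B) (starRingEnd ℂ c) b

/-- Complex conjugation of forms: the conjugate-linear ring endomorphism that extends the
conjugation of covectors, written as an algebra homomorphism to the conjugate algebra. -/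
def conjExt : CxExt E →ₐ[ℂ] ConjAlg (CxExt E) :=
  ExteriorAlgebra.lift ℂ
    ⟨{ toFun := fun ε => (ExteriorAlgebra.ι ℂ (conjCovector ε) : CxExt E)
       map_add' := fun a b => by
        have : conjCovector (a + b) = conjCovector a + conjCovector b := by
          ext v; simp [conjCovector]
        rw [this]; exact map_add (ExteriorAlgebra.ι ℂ) _ _
       map_smul' := fun c a => by
        have : conjCovector (c • a) = (starRingEnd ℂ c) • conjCovector a := by
          ext v; simp [conjCovector]
        rw [this, map_smul, Algebra.smul_def]
        exact (Algebra.smul_def (A := ConjAlg (CxExt E)) c _).symm },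
      fun ε => ExteriorAlgebra.ι_sq_zero (conjCovector ε)⟩

/-- Complex conjugation of forms. -/
def conjForm (a : CxExt E) : CxExt E := conjExt a

lemma conjForm_add (a b : CxExt E) : conjForm (a + b) = conjForm a + conjForm b :=
  map_add conjExt a b

lemma conjForm_mul (a b : CxExt E) : conjForm (a * b) = conjForm a * conjForm b :=
  map_mul conjExt a b

lemma conjForm_algebraMap (c : ℂ) :
    conjForm (algebraMap ℂ (CxExt E) c) = algebraMap ℂ (CxExt E) (conj c) :=
  AlgHom.commutes (conjExt (E := E)) c

lemma conjForm_smul (c : ℂ) (a : CxExt E) : conjForm (c • a) = (conj c) • conjForm a := by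
  rw [Algebra.smul_def, conjForm_mul, conjForm_algebraMap, ← Algebra.smul_def]

lemma conjForm_ι (ε : CxCovector E) :
    conjForm (ExteriorAlgebra.ι ℂ ε) = ExteriorAlgebra.ι ℂ (conjCovector ε) :=
  ExteriorAlgebra.lift_ι_apply (R := ℂ) (A := ConjAlg (CxExt E)) _ _ ε

/-- The complex bilinear extension to covectors of the inner product dual to a real inner product
`g` on `E`: `⟨ε, η⟩ = η((Re ε)♯) + i η((Im ε)♯)`, where `♯` is the inverse of `v ↦ g(v, ·)`. -/
def cometric (g : E →L[ℝ] E →L[ℝ] ℝ) : CxCovector E →ₗ[ℂ] Module.Dual ℂ (CxCovector E) :=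
  LinearMap.mk₂ ℂ
    (fun ε η => η (g.inverse (Complex.reCLM.comp ε)) +
      Complex.I * η (g.inverse (Complex.imCLM.comp ε)))
    (fun a b η => by simp only [ContinuousLinearMap.comp_add, map_add]; ring)
    (fun c a η => by
      have h1 : Complex.reCLM.comp (c • a) =
          c.re • Complex.reCLM.comp a - c.im • Complex.imCLM.comp a := by
        ext v; simp
      have h2 : Complex.imCLM.comp (c • a) =
          c.re • Complex.imCLM.comp a + c.im • Complex.reCLM.comp a := by
        ext v; simp
      rw [h1, h2]
      simp only [map_add, map_sub, map_smul, Complex.real_smul, smul_eq_mul]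
      conv_rhs => rw [← Complex.re_add_im c]
      ring_nf
      simp only [Complex.I_sq]
      ring)
    (fun a η η' => by simp only [_root_.add_apply]; ring)
    (fun c a η => by simp only [_root_.smul_apply, smul_eq_mul]; ring)

/-- The action of forms on forms by contraction (after raising indices with `g`): the algebra
homomorphism for which a covector `ε` acts as the contraction with the vector `ε♯`. -/
def contraction (g : E →L[ℝ] E →L[ℝ] ℝ) : CxExt E →ₐ[ℂ] Module.End ℂ (CxExt E) :=
  ExteriorAlgebra.lift ℂ ⟨CliffordAlgebra.contractLeft ∘ₗ cometric g, fun _ =>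
    LinearMap.ext fun a => CliffordAlgebra.contractLeft_contractLeft _ a⟩

/-- The Hermitian inner product of forms induced by `g`, linear in the first variable:
the scalar part of `contraction (reverse b̄) a`. On decomposable forms it is
`⟨ε₁ ∧ ⋯ ∧ ε_k, η₁ ∧ ⋯ ∧ η_k⟩ = det ⟨ε_i, η_j⟩`. -/
def formInner (g : E →L[ℝ] E →L[ℝ] ℝ) (a b : CxExt E) : ℂ :=
  ExteriorAlgebra.algebraMapInv (contraction g (CliffordAlgebra.reverse (conjForm b)) a)

/-- The adjoint of the exterior multiplication by `b`, see `formInner_wedge`. -/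
def wedgeAdjoint (g : E →L[ℝ] E →L[ℝ] ℝ) (b : CxExt E) : Module.End ℂ (CxExt E) :=
  contraction g (CliffordAlgebra.reverse (conjForm b))

lemma formInner_wedge (g : E →L[ℝ] E →L[ℝ] ℝ) (a b c : CxExt E) :
    formInner g a (b * c) = formInner g (wedgeAdjoint g b a) c := by
  simp [formInner, wedgeAdjoint, conjForm_mul, CliffordAlgebra.reverse.map_mul]

/-- The Hodge star with respect to the metric `g` and the volume form `vol`:
`⋆(ε₁ ∧ ⋯ ∧ ε_k)` is the contraction of `vol` with `ε₁♯`, …, `ε_k♯` in this order. -/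
def hodgeStar (g : E →L[ℝ] E →L[ℝ] ℝ) (vol : CxExt E) : Module.End ℂ (CxExt E) where
  toFun a := contraction g (CliffordAlgebra.reverse a) vol
  map_add' a b := by simp
  map_smul' c a := by simp

/-- A real covector, as a complex covector. -/
def realCovector (ρ : E →L[ℝ] ℝ) : CxCovector E := Complex.ofRealCLM.comp ρ

/-- The fundamental form `ω(v, w) = g(J v, w)` as an element of the exterior algebra:
`ω = (1/2) ∑ e^i ∧ ω(e_i, ·)` for a real basis `e_i` with dual basis `e^i`. -/
def fundamentalElt [FiniteDimensional ℂ E] (g : E →L[ℝ] E →L[ℝ] ℝ) : CxExt E :=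
  (2⁻¹ : ℂ) • ∑ i, ExteriorAlgebra.ι ℂ
      (realCovector (LinearMap.toContinuousLinearMap ((Module.finBasis ℝ E).coord i))) *
    ExteriorAlgebra.ι ℂ (realCovector (g (Complex.I • Module.finBasis ℝ E i)))

/-! ### Naturality under complex linear isomorphisms -/

lemma CxExt.induction {P : CxExt E → Prop} (h0 : ∀ c, P (algebraMap ℂ (CxExt E) c))
    (h1 : ∀ a b, P a → P b → P (a + b))
    (h2 : ∀ a ε, P a → P (ExteriorAlgebra.ι ℂ ε * a)) (a : CxExt E) : P a :=
  CliffordAlgebra.left_induction _ h0 h1 h2 a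

lemma pullExt_ι (T : E →L[ℂ] E) (ε : CxCovector E) :
    pullExt T (ExteriorAlgebra.ι ℂ ε) = ExteriorAlgebra.ι ℂ (pullCovector T ε) :=
  ExteriorAlgebra.map_apply_ι _ _

lemma pullExt_comp (S T : E →L[ℂ] E) (a : CxExt E) :
    pullExt (S.comp T) a = pullExt T (pullExt S a) := by
  induction a using CxExt.induction with
  | h0 c => simp only [AlgHom.commutes]
  | h1 a b ha hb => simp only [map_add, ha, hb]
  | h2 a ε ha => simp only [map_mul, ha, pullExt_ι]; rfl

lemma pullExt_id (a : CxExt E) : pullExt (ContinuousLinearMap.id ℂ E) a = a := by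
  induction a using CxExt.induction with
  | h0 c => simp only [AlgHom.commutes]
  | h1 a b ha hb => simp only [map_add, ha, hb]
  | h2 a ε ha => simp only [map_mul, ha, pullExt_ι]; rfl

lemma covectorJ_pull (T : E →L[ℂ] E) (ε : CxCovector E) :
    covectorJ (pullCovector T ε) = pullCovector T (covectorJ ε) := by
  ext v
  change ε (T (Complex.I • v)) = ε (Complex.I • T v)
  rw [map_smul]

lemma typeHom_ι (ε : CxCovector E) : typeHom (ExteriorAlgebra.ι ℂ ε) =
    Polynomial.C (Polynomial.monomial 1 (ExteriorAlgebra.ι ℂ (covector10 ε)))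
      + Polynomial.monomial 1 (Polynomial.C (ExteriorAlgebra.ι ℂ (covector01 ε))) :=
  ExteriorAlgebra.lift_ι_apply ..

lemma typeHom_pull (T : E →L[ℂ] E) (a : CxExt E) : typeHom (pullExt T a) =
    Polynomial.mapAlgHom (Polynomial.mapAlgHom (pullExt T)) (typeHom a) := by
  induction a using CxExt.induction with
  | h0 c => simp only [AlgHom.commutes]
  | h1 a b ha hb => simp only [map_add, ha, hb]
  | h2 a ε ha =>
    have h10 : covector10 (pullCovector T ε) = pullCovector T (covector10 ε) := by
      simp [covector10, covectorJ_pull]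
    have h01 : covector01 (pullCovector T ε) = pullCovector T (covector01 ε) := by
      simp [covector01, covectorJ_pull]
    simp only [map_mul, ha, pullExt_ι, typeHom_ι, h10, h01]
    simp [pullExt_ι]

lemma typeProj_pull (T : E →L[ℂ] E) (p q : ℕ) (a : CxExt E) :
    typeProj p q (pullExt T a) = pullExt T (typeProj p q a) := by
  change ((typeHom (pullExt T a)).coeff q).coeff p = pullExt T (((typeHom a).coeff q).coeff p)
  rw [typeHom_pull]
  simp

lemma conjForm_pull (T : E →L[ℂ] E) (a : CxExt E) :
    conjForm (pullExt T a) = pullExt T (conjForm a) := by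
  induction a using CxExt.induction with
  | h0 c => simp only [AlgHom.commutes, conjForm_algebraMap]
  | h1 a b ha hb => simp only [map_add, conjForm_add, ha, hb]
  | h2 a ε ha => simp only [map_mul, conjForm_mul, ha, pullExt_ι, conjForm_ι]; rfl

lemma reverse_ι' (ε : CxCovector E) :
    CliffordAlgebra.reverse (ExteriorAlgebra.ι ℂ ε : CxExt E) = ExteriorAlgebra.ι ℂ ε :=
  CliffordAlgebra.reverse_ι ε

lemma reverse_pull (T : E →L[ℂ] E) (a : CxExt E) :
    CliffordAlgebra.reverse (pullExt T a) = pullExt T (CliffordAlgebra.reverse a) := by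
  induction a using CxExt.induction with
  | h0 c => simp only [AlgHom.commutes, CliffordAlgebra.reverse.commutes]
  | h1 a b ha hb => simp only [map_add, ha, hb]
  | h2 a ε ha =>
    rw [map_mul, pullExt_ι, CliffordAlgebra.reverse.map_mul, CliffordAlgebra.reverse.map_mul,
      reverse_ι', reverse_ι', ha, map_mul, pullExt_ι]

/-- Pull-back of a bilinear form along a complex linear map. -/
def pullMetric (T : E →L[ℂ] E) (g : E →L[ℝ] E →L[ℝ] ℝ) : E →L[ℝ] E →L[ℝ] ℝ :=
  g.bilinearComp (T.restrictScalars ℝ) (T.restrictScalars ℝ)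

lemma pullMetric_apply (T : E →L[ℂ] E) (g : E →L[ℝ] E →L[ℝ] ℝ) (v w : E) :
    pullMetric T g v w = g (T v) (T w) := rfl

lemma isInvertible_of_pos [FiniteDimensional ℂ E] (g : E →L[ℝ] E →L[ℝ] ℝ)
    (hg : ∀ v, v ≠ 0 → 0 < g v v) : g.IsInvertible := by
  have hinj : Function.Injective (g : E →ₗ[ℝ] (E →L[ℝ] ℝ)) := by
    rw [← LinearMap.ker_eq_bot, LinearMap.ker_eq_bot']
    intro v hv
    by_contra hne
    have h1 := hg v hne
    have h2 : g v = 0 := hv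
    rw [h2] at h1
    exact lt_irrefl _ h1
  have hrank : Module.finrank ℝ E = Module.finrank ℝ (E →L[ℝ] ℝ) := by
    rw [← (LinearMap.toContinuousLinearMap : (E →ₗ[ℝ] ℝ) ≃ₗ[ℝ] (E →L[ℝ] ℝ)).finrank_eq]
    exact (Subspace.dual_finrank_eq (K := ℝ) (V := E)).symm
  refine ⟨(LinearEquiv.ofInjectiveOfFinrankEq _ hinj hrank).toContinuousLinearEquiv, ?_⟩
  ext v w
  rfl

lemma inverse_apply_of_eq {g : E →L[ℝ] E →L[ℝ] ℝ} (hg : g.IsInvertible) {v : E} {ρ : E →L[ℝ] ℝ}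
    (h : g v = ρ) : g.inverse ρ = v := by
  obtain ⟨e, rfl⟩ := hg
  rw [ContinuousLinearMap.inverse_equiv, ← h]
  exact e.symm_apply_apply v

lemma apply_inverse {g : E →L[ℝ] E →L[ℝ] ℝ} (hg : g.IsInvertible) (ρ : E →L[ℝ] ℝ) :
    g (g.inverse ρ) = ρ := by
  obtain ⟨e, rfl⟩ := hg
  rw [ContinuousLinearMap.inverse_equiv]
  exact e.apply_symm_apply ρ

lemma cometric_pull {g : E →L[ℝ] E →L[ℝ] ℝ} (hg : g.IsInvertible) {T S : E →L[ℂ] E}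
    (hTS : ∀ v, T (S v) = v) (hg' : (pullMetric T g).IsInvertible) (ε η : CxCovector E) :
    cometric (pullMetric T g) (pullCovector T ε) (pullCovector T η) = cometric g ε η := by
  have key : ∀ ρ : E →L[ℝ] ℝ, (pullMetric T g).inverse (ρ.comp (T.restrictScalars ℝ)) =
      S (g.inverse ρ) := fun ρ => inverse_apply_of_eq hg' (by
    ext w
    change g (T (S (g.inverse ρ))) (T w) = ρ (T w)
    rw [hTS, apply_inverse hg])
  change η (T ((pullMetric T g).inverse ((Complex.reCLM.comp ε).comp (T.restrictScalars ℝ)))) +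
    Complex.I * η (T ((pullMetric T g).inverse
      ((Complex.imCLM.comp ε).comp (T.restrictScalars ℝ)))) = _
  rw [key, key, hTS, hTS]
  rfl

lemma contraction_ι_mul (g : E →L[ℝ] E →L[ℝ] ℝ) (ε : CxCovector E) (a b : CxExt E) :
    contraction g (ExteriorAlgebra.ι ℂ ε * a) b =
      CliffordAlgebra.contractLeft (cometric g ε) (contraction g a b) := by
  rw [map_mul]
  simp only [contraction, ExteriorAlgebra.lift_ι_apply]
  rfl

lemma contractLeft_ι_mul' (δ : Module.Dual ℂ (CxCovector E)) (ε : CxCovector E) (a : CxExt E) :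
    CliffordAlgebra.contractLeft δ (ExteriorAlgebra.ι ℂ ε * a) =
      δ ε • a - ExteriorAlgebra.ι ℂ ε * CliffordAlgebra.contractLeft δ a :=
  CliffordAlgebra.contractLeft_ι_mul ..

lemma contractLeft_pull (T : E →L[ℂ] E) (δ δ' : Module.Dual ℂ (CxCovector E))
    (h : ∀ η, δ' (pullCovector T η) = δ η) (a : CxExt E) :
    CliffordAlgebra.contractLeft δ' (pullExt T a) =
      pullExt T (CliffordAlgebra.contractLeft δ a) := by
  induction a using CxExt.induction with
  | h0 c =>
    rw [AlgHom.commutes]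
    have h : ∀ δ : Module.Dual ℂ (CxCovector E),
        CliffordAlgebra.contractLeft δ (algebraMap ℂ (CxExt E) c) = 0 := fun δ =>
      CliffordAlgebra.contractLeft_algebraMap _ δ c
    rw [h, h, map_zero]
  | h1 a b ha hb => simp only [map_add, ha, hb]
  | h2 a ε ha =>
    rw [map_mul, pullExt_ι, contractLeft_ι_mul', contractLeft_ι_mul', ha, h, map_sub, map_smul,
      map_mul, pullExt_ι]

lemma contraction_pull {g : E →L[ℝ] E →L[ℝ] ℝ} (hg : g.IsInvertible) {T S : E →L[ℂ] E}
    (hTS : ∀ v, T (S v) = v) (hg' : (pullMetric T g).IsInvertible) (a b : CxExt E) :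
    contraction (pullMetric T g) (pullExt T a) (pullExt T b) =
      pullExt T (contraction g a b) := by
  induction a using CxExt.induction with
  | h0 c =>
    simp only [AlgHom.commutes]
    exact (map_smul (pullExt T) c b).symm
  | h1 a a' ha ha' =>
    rw [map_add, map_add, map_add, LinearMap.add_apply, LinearMap.add_apply, ha, ha', map_add]
  | h2 a ε ha =>
    rw [map_mul, pullExt_ι, contraction_ι_mul, contraction_ι_mul, ha]
    exact contractLeft_pull T _ _ (fun η => cometric_pull hg hTS hg' ε η) _

lemma realCovector_expand [FiniteDimensional ℂ E] (ρ : E →L[ℝ] ℝ) :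
    realCovector ρ = ∑ j, ((ρ (Module.finBasis ℝ E j) : ℝ) : ℂ) •
      realCovector (LinearMap.toContinuousLinearMap ((Module.finBasis ℝ E).coord j)) := by
  ext v
  have h : ρ v = ∑ j, (Module.finBasis ℝ E).coord j v * ρ (Module.finBasis ℝ E j) := by
    conv_lhs => rw [← (Module.finBasis ℝ E).sum_repr v, map_sum]
    exact Finset.sum_congr rfl fun j _ => by rw [map_smul, smul_eq_mul]; rfl
  simp [realCovector, h, mul_comm]

lemma fundamentalElt_pull [FiniteDimensional ℂ E] (T : E →L[ℂ] E) (g : E →L[ℝ] E →L[ℝ] ℝ) :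
    pullExt T (fundamentalElt g) = fundamentalElt (pullMetric T g) := by
  set e := Module.finBasis ℝ E with he
  have hpull : ∀ ρ : E →L[ℝ] ℝ, pullCovector T (realCovector ρ) =
      realCovector (ρ.comp (T.restrictScalars ℝ)) := fun ρ => rfl
  simp only [fundamentalElt, map_smul, map_sum, map_mul, pullExt_ι, hpull, ← he]
  congr 1
  have h1 : ∀ i, realCovector ((LinearMap.toContinuousLinearMap (e.coord i)).comp
      (T.restrictScalars ℝ)) = ∑ j, ((e.coord i (T (e j)) : ℝ) : ℂ) •
        realCovector (LinearMap.toContinuousLinearMap (e.coord j)) := fun i =>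
    realCovector_expand _
  have h2 : ∀ j, realCovector (pullMetric T g (Complex.I • e j)) =
      ∑ i, ((e.coord i (T (e j)) : ℝ) : ℂ) •
        realCovector ((g (Complex.I • e i)).comp (T.restrictScalars ℝ)) := fun j => by
    have : Complex.I • T (e j) = ∑ i, (e.coord i (T (e j))) • (Complex.I • e i) := by
      conv_lhs => rw [← e.sum_repr (T (e j))]
      rw [Finset.smul_sum]
      exact Finset.sum_congr rfl fun i _ => smul_comm _ _ _
    ext v
    simp only [realCovector, ContinuousLinearMap.comp_apply, pullMetric_apply, map_smul, this,
      map_sum, sum_apply, smul_apply]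
    simp
  simp only [h1, h2, map_sum, map_smul, Finset.sum_mul, Finset.mul_sum, smul_mul_assoc,
    mul_smul_comm]
  exact Finset.sum_comm

/-! ### Symmetry of the inner product of forms -/

lemma cometric_comm {g : E →L[ℝ] E →L[ℝ] ℝ} (hg : g.IsInvertible)
    (hsymm : ∀ v w, g v w = g w v) (ε η : CxCovector E) :
    cometric g ε η = cometric g η ε := by
  have key : ∀ ρ σ : E →L[ℝ] ℝ, σ (g.inverse ρ) = ρ (g.inverse σ) := fun ρ σ => by
    conv_lhs => rw [← apply_inverse hg σ]
    conv_rhs => rw [← apply_inverse hg ρ]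
    exact hsymm _ _
  have h : ∀ (η : CxCovector E) (v : E), η v =
      ((Complex.reCLM.comp η v : ℝ) : ℂ) + ((Complex.imCLM.comp η v : ℝ) : ℂ) * Complex.I :=
    fun η v => (Complex.re_add_im (η v)).symm
  change η (g.inverse (Complex.reCLM.comp ε)) + Complex.I * η (g.inverse (Complex.imCLM.comp ε)) =
    ε (g.inverse (Complex.reCLM.comp η)) + Complex.I * ε (g.inverse (Complex.imCLM.comp η))
  rw [h η, h η, h ε, h ε, key (Complex.reCLM.comp ε), key (Complex.imCLM.comp ε),
    key (Complex.reCLM.comp ε), key (Complex.imCLM.comp ε)]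
  ring

lemma cometric_conj (g : E →L[ℝ] E →L[ℝ] ℝ) (ε η : CxCovector E) :
    cometric g (conjCovector ε) (conjCovector η) = conj (cometric g ε η) := by
  have h1 : Complex.reCLM.comp (conjCovector ε) = Complex.reCLM.comp ε := by
    ext v; simp [conjCovector]
  have h2 : Complex.imCLM.comp (conjCovector ε) = -Complex.imCLM.comp ε := by
    ext v; simp [conjCovector]
  change conj (η (g.inverse (Complex.reCLM.comp (conjCovector ε)))) +
    Complex.I * conj (η (g.inverse (Complex.imCLM.comp (conjCovector ε)))) =
    conj (η (g.inverse (Complex.reCLM.comp ε)) + Complex.I * η (g.inverse (Complex.imCLM.comp ε)))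
  rw [h1, h2]
  simp

lemma contraction_algebraMap (g : E →L[ℝ] E →L[ℝ] ℝ) (c : ℂ) (b : CxExt E) :
    contraction g (algebraMap ℂ (CxExt E) c) b = c • b := by
  rw [AlgHom.commutes]; rfl

lemma contraction_add (g : E →L[ℝ] E →L[ℝ] ℝ) (a a' b : CxExt E) :
    contraction g (a + a') b = contraction g a b + contraction g a' b := by
  rw [map_add, LinearMap.add_apply]

lemma contraction_reverse_ι_mul (g : E →L[ℝ] E →L[ℝ] ℝ) (ε : CxCovector E) (a b : CxExt E) :
    contraction g (CliffordAlgebra.reverse (ExteriorAlgebra.ι ℂ ε * a)) b =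
      contraction g (CliffordAlgebra.reverse a)
        (CliffordAlgebra.contractLeft (cometric g ε) b) := by
  rw [CliffordAlgebra.reverse.map_mul, reverse_ι', map_mul]
  simp only [contraction, ExteriorAlgebra.lift_ι_apply]
  rfl

lemma contractLeft_algebraMap' (δ : Module.Dual ℂ (CxCovector E)) (c : ℂ) :
    CliffordAlgebra.contractLeft δ (algebraMap ℂ (CxExt E) c) = 0 :=
  CliffordAlgebra.contractLeft_algebraMap _ δ c

lemma reverse_algebraMap' (c : ℂ) :
    CliffordAlgebra.reverse (algebraMap ℂ (CxExt E) c) = algebraMap ℂ (CxExt E) c :=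
  CliffordAlgebra.reverse.commutes c

lemma algebraMapInv_ι_mul (ε : CxCovector E) (a : CxExt E) :
    ExteriorAlgebra.algebraMapInv (ExteriorAlgebra.ι ℂ ε * a) = 0 := by
  rw [map_mul]
  simp [ExteriorAlgebra.algebraMapInv]

/-- The complex bilinear inner product of forms. -/
def formPairing (g : E →L[ℝ] E →L[ℝ] ℝ) (a b : CxExt E) : ℂ :=
  ExteriorAlgebra.algebraMapInv (contraction g (CliffordAlgebra.reverse a) b)

lemma formPairing_add_left (g : E →L[ℝ] E →L[ℝ] ℝ) (a a' b : CxExt E) :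
    formPairing g (a + a') b = formPairing g a b + formPairing g a' b := by
  rw [formPairing, map_add, contraction_add, map_add]; rfl

lemma formPairing_add_right (g : E →L[ℝ] E →L[ℝ] ℝ) (a b b' : CxExt E) :
    formPairing g a (b + b') = formPairing g a b + formPairing g a b' := by
  rw [formPairing, map_add, map_add]; rfl

lemma formPairing_ι_mul_left (g : E →L[ℝ] E →L[ℝ] ℝ) (ε : CxCovector E) (a b : CxExt E) :
    formPairing g (ExteriorAlgebra.ι ℂ ε * a) b =
      formPairing g a (CliffordAlgebra.contractLeft (cometric g ε) b) := by
  rw [formPairing, contraction_reverse_ι_mul, formPairing]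

lemma formPairing_ι_mul_right {g : E →L[ℝ] E →L[ℝ] ℝ} (hg : g.IsInvertible)
    (hsymm : ∀ v w, g v w = g w v) (ε : CxCovector E) (b a : CxExt E) :
    formPairing g b (ExteriorAlgebra.ι ℂ ε * a) =
      formPairing g (CliffordAlgebra.contractLeft (cometric g ε) b) a := by
  induction b using CxExt.induction generalizing a with
  | h0 c =>
    rw [contractLeft_algebraMap']
    simp only [formPairing, reverse_algebraMap', contraction_algebraMap, map_smul,
      algebraMapInv_ι_mul, map_zero, LinearMap.zero_apply, smul_zero]
  | h1 b b' hb hb' =>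
    rw [formPairing_add_left, hb, hb', map_add, formPairing_add_left]
  | h2 b η hb =>
    rw [formPairing_ι_mul_left, contractLeft_ι_mul', contractLeft_ι_mul',
      cometric_comm hg hsymm η ε]
    have h1 : ∀ x y : CxExt E, formPairing g b (x - y) = formPairing g b x - formPairing g b y :=
      fun x y => by simp only [formPairing, map_sub]
    have h2 : ∀ x y : CxExt E, formPairing g (x - y) a = formPairing g x a - formPairing g y a :=
      fun x y => by simp only [formPairing, map_sub, LinearMap.sub_apply]
    have h3 : ∀ (c : ℂ) (x y : CxExt E), formPairing g (c • x) y = formPairing g x (c • y) :=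
      fun c x y => by simp only [formPairing, map_smul, LinearMap.smul_apply]
    rw [h1, h2, h3, hb, formPairing_ι_mul_left]

lemma formPairing_comm {g : E →L[ℝ] E →L[ℝ] ℝ} (hg : g.IsInvertible)
    (hsymm : ∀ v w, g v w = g w v) (a b : CxExt E) : formPairing g a b = formPairing g b a := by
  induction a using CxExt.induction generalizing b with
  | h0 c =>
    induction b using CxExt.induction with
    | h0 c' =>
      rw [formPairing, formPairing, reverse_algebraMap', reverse_algebraMap',
        contraction_algebraMap, contraction_algebraMap, map_smul, map_smul, AlgHom.commutes,
        AlgHom.commutes]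
      exact mul_comm c c'
    | h1 b b' hb hb' =>
      rw [formPairing_add_left, formPairing_add_right, hb, hb']
    | h2 b η _ =>
      rw [formPairing_ι_mul_right hg hsymm, formPairing_ι_mul_left, contractLeft_algebraMap']
      simp only [formPairing, map_zero, LinearMap.zero_apply]
  | h1 a a' ha ha' =>
    rw [formPairing_add_left, formPairing_add_right, ha, ha']
  | h2 a ε ha =>
    rw [formPairing_ι_mul_left, ha, formPairing_ι_mul_right hg hsymm]

lemma contractLeft_conj (δ δ' : Module.Dual ℂ (CxCovector E))
    (h : ∀ η, δ' (conjCovector η) = conj (δ η)) (a : CxExt E) :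
    CliffordAlgebra.contractLeft δ' (conjForm a) =
      conjForm (CliffordAlgebra.contractLeft δ a) := by
  have h0 : conjForm (0 : CxExt E) = 0 := map_zero conjExt
  have hneg : ∀ a : CxExt E, conjForm (-a) = -conjForm a := fun a => map_neg conjExt a
  induction a using CxExt.induction with
  | h0 c => rw [conjForm_algebraMap, contractLeft_algebraMap', contractLeft_algebraMap', h0]
  | h1 a b ha hb => rw [conjForm_add, map_add, map_add, ha, hb, conjForm_add]
  | h2 a ε ha =>
    rw [conjForm_mul, conjForm_ι, contractLeft_ι_mul', contractLeft_ι_mul', ha, h, sub_eq_add_neg,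
      sub_eq_add_neg, conjForm_add, hneg, conjForm_smul, conjForm_mul, conjForm_ι]

lemma formPairing_conj (g : E →L[ℝ] E →L[ℝ] ℝ) (a b : CxExt E) :
    formPairing g (conjForm a) (conjForm b) = conj (formPairing g a b) := by
  have hinv : ∀ b : CxExt E, ExteriorAlgebra.algebraMapInv (conjForm b) =
      conj (ExteriorAlgebra.algebraMapInv b) := fun b => by
    induction b using CxExt.induction with
    | h0 c => simp only [conjForm_algebraMap, AlgHom.commutes]; rfl
    | h1 a b ha hb => simp only [conjForm_add, map_add, ha, hb]
    | h2 a ε _ => rw [conjForm_mul, conjForm_ι, algebraMapInv_ι_mul, algebraMapInv_ι_mul, map_zero]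
  induction a using CxExt.induction generalizing b with
  | h0 c =>
    simp only [formPairing, conjForm_algebraMap, reverse_algebraMap', contraction_algebraMap,
      map_smul, hinv, smul_eq_mul, map_mul]
  | h1 a a' ha ha' =>
    rw [conjForm_add, formPairing_add_left, formPairing_add_left, ha, ha', map_add]
  | h2 a ε ha =>
    rw [conjForm_mul, conjForm_ι, formPairing_ι_mul_left, formPairing_ι_mul_left,
      contractLeft_conj _ _ (fun η => cometric_conj g ε η), ha]

lemma conjForm_conjForm (a : CxExt E) : conjForm (conjForm a) = a := by
  induction a using CxExt.induction with
  | h0 c => simp only [conjForm_algebraMap, Complex.conj_conj]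
  | h1 a b ha hb => simp only [conjForm_add, ha, hb]
  | h2 a ε ha =>
    simp only [conjForm_mul, ha, conjForm_ι]
    congr 2
    ext v
    simp [conjCovector]

lemma formInner_conj {g : E →L[ℝ] E →L[ℝ] ℝ} (hg : g.IsInvertible)
    (hsymm : ∀ v w, g v w = g w v) (a b : CxExt E) :
    conj (formInner g a b) = formInner g b a := by
  change conj (formPairing g (conjForm b) a) = formPairing g (conjForm a) b
  rw [← formPairing_conj, conjForm_conjForm, formPairing_comm hg hsymm]

lemma formInner_wedge_left {g : E →L[ℝ] E →L[ℝ] ℝ} (hg : g.IsInvertible)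
    (hsymm : ∀ v w, g v w = g w v) (a b c : CxExt E) :
    formInner g (b * a) c = formInner g a (wedgeAdjoint g b c) := by
  rw [← formInner_conj hg hsymm, formInner_wedge, formInner_conj hg hsymm]

end Fibre

/-! ### Smooth functions with values in finite-dimensional spaces, and the exterior derivative -/

section Smooth

variable {E : Type*} [NormedAddCommGroup E] [NormedSpace ℂ E]
variable {W W₁ W₂ : Type*} [AddCommGroup W] [Module ℂ W] [AddCommGroup W₁] [Module ℂ W₁]
  [AddCommGroup W₂] [Module ℂ W₂]

/-- A function with values in a finite-dimensional complex vector space (without a chosen norm) is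
smooth in the real sense on `s` if all its components are. -/
def SmoothOn (f : E → W) (s : Set E) : Prop :=
  ∀ l : W →ₗ[ℂ] ℂ, ContDiffOn ℝ ∞ (fun y => l (f y)) s

/-- Componentwise real differentiability at a point. -/
def CompDiffAt (f : E → W) (y : E) : Prop :=
  ∀ l : W →ₗ[ℂ] ℂ, DifferentiableAt ℝ (fun y => l (f y)) y

lemma SmoothOn.congr {f f' : E → W} {s : Set E} (h : SmoothOn f s)
    (hf : ∀ y ∈ s, f' y = f y) : SmoothOn f' s := fun l =>
  (h l).congr fun y hy => by rw [hf y hy]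

lemma SmoothOn.add {f f' : E → W} {s : Set E} (h : SmoothOn f s) (h' : SmoothOn f' s) :
    SmoothOn (fun y => f y + f' y) s := fun l => by
  simpa only [map_add] using (h l).add (h' l)

lemma SmoothOn.sum {ι : Type*} {t : Finset ι} {f : ι → E → W} {s : Set E}
    (h : ∀ i ∈ t, SmoothOn (f i) s) : SmoothOn (fun y => ∑ i ∈ t, f i y) s := fun l => by
  simp only [map_sum]
  exact ContDiffOn.sum fun i hi => h i hi l

lemma SmoothOn.map {f : E → W} {s : Set E} (h : SmoothOn f s) (L : W →ₗ[ℂ] W₁) :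
    SmoothOn (fun y => L (f y)) s := fun l => h (l ∘ₗ L)

lemma SmoothOn.const (w : W) (s : Set E) : SmoothOn (fun _ : E => w) s := fun _ =>
  contDiffOn_const

lemma SmoothOn.smul {a : E → ℂ} {f : E → W} {s : Set E} (ha : ContDiffOn ℝ ∞ a s)
    (h : SmoothOn f s) : SmoothOn (fun y => a y • f y) s := fun l => by
  simpa only [map_smul, smul_eq_mul] using ha.mul (h l)

lemma SmoothOn.bilin [Module.Finite ℂ W] {f : E → W} {f₁ : E → W₁} {s : Set E}
    (h : SmoothOn f s) (h₁ : SmoothOn f₁ s) (L : W →ₗ[ℂ] W₁ →ₗ[ℂ] W₂) :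
    SmoothOn (fun y => L (f y) (f₁ y)) s := by
  set b := Module.finBasis ℂ W
  have : ∀ y, L (f y) (f₁ y) = ∑ i, b.coord i (f y) • L (b i) (f₁ y) := fun y => by
    conv_lhs => rw [← b.sum_repr (f y), map_sum, LinearMap.sum_apply]
    exact Finset.sum_congr rfl fun i _ => by rw [map_smul, LinearMap.smul_apply]; rfl
  simp only [this]
  exact SmoothOn.sum fun i _ => SmoothOn.smul (h (b.coord i)) (h₁.map (L (b i)))

lemma SmoothOn.compDiffAt {f : E → W} {s : Set E} (h : SmoothOn f s) (hs : IsOpen s) {y : E}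
    (hy : y ∈ s) : CompDiffAt f y := fun l =>
  ((h l).contDiffAt (hs.mem_nhds hy)).differentiableAt (by simp)

lemma SmoothOn.conjForm {β : E → CxExt E} {s : Set E} (h : SmoothOn β s) :
    SmoothOn (fun y => conjForm (β y)) s := by
  intro l
  let l' : CxExt E →ₗ[ℂ] ℂ :=
    { toFun := fun a => conj (l (_root_.conjForm a))
      map_add' := fun a b => by simp [conjForm_add]
      map_smul' := fun c a => by simp [conjForm_smul] }
  have h1 : ContDiffOn ℝ ∞ (fun y => (Complex.conjCLE : ℂ →L[ℝ] ℂ) (l' (β y))) s :=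
    (Complex.conjCLE : ℂ →L[ℝ] ℂ).contDiff.comp_contDiffOn (h l')
  refine h1.congr fun y _ => ?_
  simp [l']

variable [FiniteDimensional ℂ E]

/-- The exterior derivative of a complex differential form on an open set of `E`:
`d (∑ f_J B_J) = ∑ df_J ∧ B_J` for a basis `B_J` of constant forms. -/
def extD (β : E → CxExt E) (y : E) : CxExt E :=
  ∑ J, ExteriorAlgebra.ι ℂ
    (fderiv ℝ (fun z => (Module.finBasis ℂ (CxExt E)).coord J (β z)) y) *
      Module.finBasis ℂ (CxExt E) J

lemma extD_congr {β γ : E → CxExt E} {y : E} (h : β =ᶠ[nhds y] γ) : extD β y = extD γ y := by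
  refine Finset.sum_congr rfl fun J _ => ?_
  rw [Filter.EventuallyEq.fderiv_eq (h.mono fun z hz => by rw [hz])]

lemma extD_add {β γ : E → CxExt E} {y : E} (hβ : CompDiffAt β y) (hγ : CompDiffAt γ y) :
    extD (fun z => β z + γ z) y = extD β y + extD γ y := by
  simp only [extD, map_add, ← Finset.sum_add_distrib]
  refine Finset.sum_congr rfl fun J _ => ?_
  rw [fderiv_fun_add (hβ _) (hγ _), map_add, add_mul]

lemma extD_const (c : CxExt E) (y : E) : extD (fun _ => c) y = 0 := by
  simp [extD]

/-- `d (f c) = df ∧ c` for a function `f` and a constant form `c`. -/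
lemma extD_smul_const {f : E → ℂ} {y : E} (hf : DifferentiableAt ℝ f y) (c : CxExt E) :
    extD (fun z => f z • c) y = ExteriorAlgebra.ι ℂ (fderiv ℝ f y) * c := by
  set b := Module.finBasis ℂ (CxExt E) with hb
  have h : ∀ J, fderiv ℝ (fun z => b.coord J (f z • c)) y = b.coord J c • fderiv ℝ f y := by
    intro J
    have h1 : (fun z => b.coord J (f z • c)) = fun z => f z * b.coord J c := by
      ext z; rw [map_smul, smul_eq_mul]
    rw [h1, fderiv_mul_const hf]
  conv_rhs => rw [← b.sum_repr c, Finset.mul_sum]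
  refine Finset.sum_congr rfl fun J _ => ?_
  rw [← hb, h J, map_smul, smul_mul_assoc, mul_smul_comm]
  rfl

lemma extD_sum {ι : Type*} (t : Finset ι) {β : ι → E → CxExt E} {y : E}
    (h : ∀ i ∈ t, CompDiffAt (β i) y) :
    extD (fun z => ∑ i ∈ t, β i z) y = ∑ i ∈ t, extD (β i) y := by
  classical
  induction t using Finset.induction_on with
  | empty => simpa using extD_const (0 : CxExt E) y
  | insert i t hi ih =>
    simp only [Finset.sum_insert hi]
    rw [extD_add (h i (Finset.mem_insert_self i t)), ih fun j hj => h j (Finset.mem_insert_of_mem hj)]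
    intro l
    simp only [map_sum]
    exact DifferentiableAt.fun_sum fun j hj => h j (Finset.mem_insert_of_mem hj) l

lemma CompDiffAt.mul {β γ : E → CxExt E} {y : E} (hβ : CompDiffAt β y) (hγ : CompDiffAt γ y) :
    CompDiffAt (fun z => β z * γ z) y := by
  set b := Module.finBasis ℂ (CxExt E)
  intro l
  have : ∀ z, l (β z * γ z) = ∑ i, b.coord i (β z) * l (b i * γ z) := fun z => by
    conv_lhs => rw [← b.sum_repr (β z), Finset.sum_mul, map_sum]
    exact Finset.sum_congr rfl fun i _ => by rw [smul_mul_assoc, map_smul]; rfl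
  simp only [this]
  exact DifferentiableAt.fun_sum fun i _ => (hβ (b.coord i)).mul
    (hγ (l ∘ₗ LinearMap.mulLeft ℂ (b i)))

/-- The Leibniz rule for a product of a (possibly non-constant) covector and a closed form. -/
lemma extD_ι_mul {h : E → CxCovector E} {γ : E → CxExt E} {y : E}
    (hh : CompDiffAt (fun z => (ExteriorAlgebra.ι ℂ (h z) : CxExt E)) y) (hγ : CompDiffAt γ y)
    (h0 : extD (fun z => ExteriorAlgebra.ι ℂ (h z)) y = 0) (hγ0 : extD γ y = 0) :
    extD (fun z => ExteriorAlgebra.ι ℂ (h z) * γ z) y = 0 := by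
  set b := Module.finBasis ℂ (CxExt E) with hb
  set v := Module.finBasis ℂ (CxCovector E)
  have hco : ∀ i, DifferentiableAt ℝ (fun z => v.coord i (h z)) y := fun i => by
    have := hh (v.coord i ∘ₗ ExteriorAlgebra.ιInv)
    simpa [ExteriorAlgebra.ι_leftInverse _] using this
  have hexp : ∀ z, (ExteriorAlgebra.ι ℂ (h z) : CxExt E) =
      ∑ i, v.coord i (h z) • ExteriorAlgebra.ι ℂ (v i) := fun z => by
    conv_lhs => rw [← v.sum_repr (h z), map_sum]
    exact Finset.sum_congr rfl fun i _ => by rw [map_smul]; rfl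
  have hγexp : ∀ z, γ z = ∑ J, b.coord J (γ z) • b J := fun z => (b.sum_repr (γ z)).symm
  have e1 : (fun z => (ExteriorAlgebra.ι ℂ (h z) : CxExt E) * γ z) = fun z => ∑ i, ∑ J,
      (v.coord i (h z) * b.coord J (γ z)) • (ExteriorAlgebra.ι ℂ (v i) * b J) := by
    ext z
    rw [hexp z]
    conv_lhs => rw [hγexp z]
    rw [Finset.sum_mul_sum]
    refine Finset.sum_congr rfl fun i _ => Finset.sum_congr rfl fun J _ => ?_
    rw [smul_mul_smul_comm]
  have hd : ∀ i J, DifferentiableAt ℝ (fun z => v.coord i (h z) * b.coord J (γ z)) y :=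
    fun i J => (hco i).mul (hγ (b.coord J))
  have hcd : ∀ (f : E → ℂ) (c : CxExt E), DifferentiableAt ℝ f y →
      CompDiffAt (fun z => f z • c) y := fun f c hf l => by
    simpa only [map_smul, smul_eq_mul] using hf.mul_const (l c)
  have e2 : extD (fun z => ∑ i, ∑ J, (v.coord i (h z) * b.coord J (γ z)) •
      (ExteriorAlgebra.ι ℂ (v i) * b J)) y =
      ∑ i, ∑ J, ExteriorAlgebra.ι ℂ (fderiv ℝ (fun z => v.coord i (h z) * b.coord J (γ z)) y) *
        (ExteriorAlgebra.ι ℂ (v i) * b J) := by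
    rw [extD_sum]
    · refine Finset.sum_congr rfl fun i _ => ?_
      rw [extD_sum]
      · exact Finset.sum_congr rfl fun J _ => extD_smul_const (hd i J) _
      · exact fun J _ => hcd _ _ (hd i J)
    · intro i _ l
      simp only [map_sum]
      exact DifferentiableAt.fun_sum fun J _ => hcd _ _ (hd i J) l
  have h0' : ∑ i, ExteriorAlgebra.ι ℂ (fderiv ℝ (fun z => v.coord i (h z)) y) *
      ExteriorAlgebra.ι ℂ (v i) = 0 := by
    rw [← h0]
    simp only [hexp]
    rw [extD_sum]
    · exact Finset.sum_congr rfl fun i _ => (extD_smul_const (hco i) _).symm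
    · exact fun i _ => hcd _ _ (hco i)
  have hγ0' : ∑ J, ExteriorAlgebra.ι ℂ (fderiv ℝ (fun z => b.coord J (γ z)) y) * b J = 0 := hγ0
  rw [e1, e2]
  have e3 : ∀ i J, ExteriorAlgebra.ι ℂ
      (fderiv ℝ (fun z => v.coord i (h z) * b.coord J (γ z)) y) *
        (ExteriorAlgebra.ι ℂ (v i) * b J) =
      b.coord J (γ y) • ((ExteriorAlgebra.ι ℂ (fderiv ℝ (fun z => v.coord i (h z)) y) *
        ExteriorAlgebra.ι ℂ (v i)) * b J) -
      v.coord i (h y) • (ExteriorAlgebra.ι ℂ (v i) *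
        (ExteriorAlgebra.ι ℂ (fderiv ℝ (fun z => b.coord J (γ z)) y) * b J)) := fun i J => by
    rw [fderiv_fun_mul (hco i) (hγ (b.coord J)), map_add, map_smul, map_smul, add_mul,
      smul_mul_assoc, smul_mul_assoc, ← mul_assoc, ← mul_assoc, ← mul_assoc]
    have := ExteriorAlgebra.ι_add_mul_swap (R := ℂ)
      (fderiv ℝ (fun z => b.coord J (γ z)) y) (v i)
    rw [eq_neg_of_add_eq_zero_left this, neg_mul, smul_neg]
    abel
  simp only [e3, Finset.sum_sub_distrib]
  rw [Finset.sum_comm]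
  simp only [← Finset.smul_sum, ← Finset.sum_mul, ← Finset.mul_sum, h0', hγ0']
  simp

/-- `d d f = 0`. -/
lemma extD_ι_fderiv {f : E → ℂ} {y : E} (hf : ContDiffAt ℝ 2 f y) :
    CompDiffAt (fun z => (ExteriorAlgebra.ι ℂ (fderiv ℝ f z) : CxExt E)) y ∧
    extD (fun z => ExteriorAlgebra.ι ℂ (fderiv ℝ f z)) y = 0 := by
  set e := Module.finBasis ℝ E
  have hd : DifferentiableAt ℝ (fderiv ℝ f) y :=
    (hf.fderiv_right (m := 1) le_rfl).differentiableAt one_ne_zero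
  set c : Fin (Module.finrank ℝ E) → CxCovector E := fun k =>
    realCovector (LinearMap.toContinuousLinearMap (e.coord k))
  have hexp : ∀ h : CxCovector E, h = ∑ k, h (e k) • c k := fun h => by
    ext w
    have : h w = ∑ k, ((e.coord k w : ℝ) : ℂ) * h (e k) := by
      conv_lhs => rw [← e.sum_repr w, map_sum]
      exact Finset.sum_congr rfl fun k _ => by rw [map_smul, Complex.real_smul]; rfl
    rw [this, sum_apply]
    exact Finset.sum_congr rfl fun k _ => mul_comm _ _
  have hco : ∀ k, DifferentiableAt ℝ (fun z => fderiv ℝ f z (e k)) y := fun k =>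
    hd.clm_apply (differentiableAt_const _)
  have e1 : (fun z => (ExteriorAlgebra.ι ℂ (fderiv ℝ f z) : CxExt E)) =
      fun z => ∑ k, fderiv ℝ f z (e k) • ExteriorAlgebra.ι ℂ (c k) := by
    ext z
    conv_lhs => rw [hexp (fderiv ℝ f z), map_sum]
    simp only [map_smul]
  have hcd : ∀ k, CompDiffAt (fun z => fderiv ℝ f z (e k) •
      (ExteriorAlgebra.ι ℂ (c k) : CxExt E)) y := fun k l => by
    simpa only [map_smul, smul_eq_mul] using (hco k).mul_const (l _)
  rw [e1]
  refine ⟨fun l => ?_, ?_⟩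
  · simp only [map_sum]
    exact DifferentiableAt.fun_sum fun k _ => hcd k l
  rw [extD_sum _ fun k _ => hcd k]
  have hsym := hf.isSymmSndFDerivAt (by simp)
  have e2 : ∀ k, extD (fun z => fderiv ℝ f z (e k) • (ExteriorAlgebra.ι ℂ (c k) : CxExt E)) y =
      ∑ j, fderiv ℝ (fderiv ℝ f) y (e j) (e k) •
        (ExteriorAlgebra.ι ℂ (c j) * ExteriorAlgebra.ι ℂ (c k)) := fun k => by
    rw [extD_smul_const (hco k), hexp (fderiv ℝ (fun z => fderiv ℝ f z (e k)) y), map_sum,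
      Finset.sum_mul]
    refine Finset.sum_congr rfl fun j _ => ?_
    rw [map_smul, smul_mul_assoc]
    congr 1
    rw [fderiv_clm_apply hd (differentiableAt_const _)]
    simp
  simp only [e2]
  set S : CxExt E := ∑ k, ∑ j, fderiv ℝ (fderiv ℝ f) y (e j) (e k) •
        (ExteriorAlgebra.ι ℂ (c j) * ExteriorAlgebra.ι ℂ (c k)) with hS
  have : S = -S := by
    conv_rhs => rw [hS, Finset.sum_comm, ← Finset.sum_neg_distrib]
    refine Finset.sum_congr rfl fun k _ => ?_
    rw [← Finset.sum_neg_distrib]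
    refine Finset.sum_congr rfl fun j _ => ?_
    rw [hsym.eq (e j) (e k), ← smul_neg]
    congr 1
    exact eq_neg_of_add_eq_zero_left (ExteriorAlgebra.ι_add_mul_swap _ _)
  have h2 : (2 : ℂ) • S = 0 := by
    rw [two_smul]
    exact add_eq_zero_iff_eq_neg.mpr this
  exact (smul_eq_zero.mp h2).resolve_left two_ne_zero

/-- Pull-backs of constant forms are closed. -/
lemma extD_pullExt_const {φ : E → E} {y : E} (hφ : ContDiffAt ℂ ω φ y) (c : CxExt E) :
    CompDiffAt (fun z => pullExt (fderiv ℂ φ z) c) y ∧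
      extD (fun z => pullExt (fderiv ℂ φ z) c) y = 0 := by
  induction c using CxExt.induction with
  | h0 r =>
    simp only [AlgHom.commutes]
    exact ⟨fun l => differentiableAt_const _, extD_const _ _⟩
  | h1 a b ha hb =>
    simp only [map_add]
    refine ⟨fun l => ?_, ?_⟩
    · simpa only [map_add] using (ha.1 l).fun_add (hb.1 l)
    · rw [extD_add ha.1 hb.1, ha.2, hb.2, add_zero]
  | h2 a ε ha =>
    have hev : (fun z => (ExteriorAlgebra.ι ℂ (pullCovector (fderiv ℂ φ z) ε) : CxExt E)) =ᶠ[nhds y]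
        fun z => ExteriorAlgebra.ι ℂ (fderiv ℝ (fun w => ε (φ w)) z) := by
      filter_upwards [hφ.eventually (by simp)] with z hz
      congr 1
      have h1 : DifferentiableAt ℂ φ z := hz.differentiableAt (by simp)
      have h2 : HasFDerivAt φ ((fderiv ℂ φ z).restrictScalars ℝ) z :=
        h1.hasFDerivAt.restrictScalars ℝ
      exact ((ε.hasFDerivAt.comp z h2).fderiv).symm
    have hf : ContDiffAt ℝ 2 (fun w => ε (φ w)) y :=
      ε.contDiff.contDiffAt.comp y ((hφ.restrict_scalars ℝ).of_le (by simp))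
    obtain ⟨h1, h2⟩ := extD_ι_fderiv hf
    have h1' : CompDiffAt (fun z =>
        (ExteriorAlgebra.ι ℂ (pullCovector (fderiv ℂ φ z) ε) : CxExt E)) y := fun l =>
      (h1 l).congr_of_eventuallyEq (hev.mono fun z hz => congrArg l hz)
    simp only [map_mul, pullExt_ι]
    exact ⟨h1'.mul ha.1, extD_ι_mul h1' ha.1 ((extD_congr hev).trans h2) ha.2⟩

/-- The exterior derivative commutes with pull-backs along holomorphic maps. -/
lemma extD_pullExt {φ : E → E} {y : E} (hφ : ContDiffAt ℂ ω φ y) {β : E → CxExt E}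
    (hβ : CompDiffAt β (φ y)) :
    extD (fun z => pullExt (fderiv ℂ φ z) (β (φ z))) y =
      pullExt (fderiv ℂ φ y) (extD β (φ y)) := by
  set b := Module.finBasis ℂ (CxExt E) with hb
  have hφd : HasFDerivAt φ ((fderiv ℂ φ y).restrictScalars ℝ) y :=
    (hφ.differentiableAt (by simp)).hasFDerivAt.restrictScalars ℝ
  have hexp : (fun z => pullExt (fderiv ℂ φ z) (β (φ z))) = fun z =>
      ∑ J, b.coord J (β (φ z)) • pullExt (fderiv ℂ φ z) (b J) := by
    ext z
    conv_lhs => rw [← b.sum_repr (β (φ z)), map_sum]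
    exact Finset.sum_congr rfl fun J _ => by rw [map_smul]; rfl
  have hco : ∀ J, HasFDerivAt (fun z => b.coord J (β (φ z)))
      ((fderiv ℝ (fun w => b.coord J (β w)) (φ y)).comp ((fderiv ℂ φ y).restrictScalars ℝ)) y :=
    fun J => HasFDerivAt.comp y (hβ (b.coord J)).hasFDerivAt hφd
  have hprod : ∀ J, CompDiffAt (fun z => b.coord J (β (φ z)) • pullExt (fderiv ℂ φ z) (b J)) y ∧
      extD (fun z => b.coord J (β (φ z)) • pullExt (fderiv ℂ φ z) (b J)) y =
        pullExt (fderiv ℂ φ y) (ExteriorAlgebra.ι ℂ (fderiv ℝ (fun w => b.coord J (β w)) (φ y)) *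
          b J) := fun J => by
    obtain ⟨hp1, hp2⟩ := extD_pullExt_const hφ (b J)
    refine ⟨fun l => ?_, ?_⟩
    · simpa only [map_smul, smul_eq_mul] using (hco J).differentiableAt.fun_mul (hp1 l)
    have e1 : (fun z => b.coord J (β (φ z)) • pullExt (fderiv ℂ φ z) (b J)) = fun z =>
        ∑ I, (b.coord J (β (φ z)) * b.coord I (pullExt (fderiv ℂ φ z) (b J))) • b I := by
      ext z
      conv_lhs => rw [← b.sum_repr (pullExt (fderiv ℂ φ z) (b J)), Finset.smul_sum]
      exact Finset.sum_congr rfl fun I _ => by rw [smul_smul]; rfl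
    have hd : ∀ I, DifferentiableAt ℝ
        (fun z => b.coord J (β (φ z)) * b.coord I (pullExt (fderiv ℂ φ z) (b J))) y := fun I =>
      (hco J).differentiableAt.mul (hp1 (b.coord I))
    rw [e1, extD_sum _ fun I _ l => by
      simpa only [map_smul, smul_eq_mul] using (hd I).mul_const (l (b I))]
    have e2 : ∀ I, extD (fun z => (b.coord J (β (φ z)) *
        b.coord I (pullExt (fderiv ℂ φ z) (b J))) • b I) y =
        b.coord J (β (φ y)) • (ExteriorAlgebra.ι ℂ
          (fderiv ℝ (fun z => b.coord I (pullExt (fderiv ℂ φ z) (b J))) y) * b I) +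
        ExteriorAlgebra.ι ℂ (fderiv ℝ (fun z => b.coord J (β (φ z))) y) *
          (b.coord I (pullExt (fderiv ℂ φ y) (b J)) • b I) := fun I => by
      rw [extD_smul_const (hd I), fderiv_fun_mul (hco J).differentiableAt (hp1 (b.coord I)),
        map_add, map_smul, map_smul, add_mul, smul_mul_assoc, smul_mul_assoc, mul_smul_comm]
    simp only [e2, Finset.sum_add_distrib, ← Finset.smul_sum, ← Finset.mul_sum]
    have e3 : ∑ I, ExteriorAlgebra.ι ℂ
          (fderiv ℝ (fun z => b.coord I (pullExt (fderiv ℂ φ z) (b J))) y) * b I = 0 := hp2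
    have e4 : ∑ I, b.coord I (pullExt (fderiv ℂ φ y) (b J)) • b I =
        pullExt (fderiv ℂ φ y) (b J) := b.sum_repr _
    rw [e3, e4, smul_zero, zero_add, (hco J).fderiv, map_mul, pullExt_ι]
    rfl
  rw [hexp, extD_sum _ fun J _ => (hprod J).1]
  simp only [(hprod _).2]
  rw [← map_sum]
  rfl

lemma SmoothOn.extD {β : E → CxExt E} {s : Set E} (hs : IsOpen s) (h : SmoothOn β s) :
    SmoothOn (extD β) s := by
  refine SmoothOn.sum fun J _ => ?_
  intro l
  have h1 : ContDiffOn ℝ ∞ (fderiv ℝ fun z => (Module.finBasis ℂ (CxExt E)).coord J (β z)) s :=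
    (h _).fderiv_of_isOpen hs (by simp)
  let L : CxCovector E →ₗ[ℝ] ℂ :=
    ((l ∘ₗ LinearMap.mulRight ℂ (Module.finBasis ℂ (CxExt E) J)) ∘ₗ
      ExteriorAlgebra.ι ℂ).restrictScalars ℝ
  exact (LinearMap.toContinuousLinearMap L).contDiff.comp_contDiffOn h1

lemma SmoothOn.realCovector {ρ : E → E →L[ℝ] ℝ} {s : Set E} (h : ContDiffOn ℝ ∞ ρ s) :
    SmoothOn (fun y => (ExteriorAlgebra.ι ℂ (realCovector (ρ y)) : CxExt E)) s := by
  intro l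
  let L : (E →L[ℝ] ℝ) →ₗ[ℝ] ℂ :=
    { toFun := fun ρ => l (ExteriorAlgebra.ι ℂ (_root_.realCovector ρ))
      map_add' := fun a b => by
        have : _root_.realCovector (a + b) = _root_.realCovector a + _root_.realCovector b := by
          ext v; simp [_root_.realCovector]
        rw [this, map_add, map_add]
      map_smul' := fun c a => by
        have : _root_.realCovector (c • a) = (c : ℂ) • _root_.realCovector a := by
          ext v; simp [_root_.realCovector]
        rw [this, map_smul, map_smul]; simp }
  exact (LinearMap.toContinuousLinearMap L).contDiff.comp_contDiffOn h

lemma SmoothOn.fundamentalElt {g : E → E →L[ℝ] E →L[ℝ] ℝ} {s : Set E}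
    (h : ContDiffOn ℝ ∞ g s) : SmoothOn (fun y => fundamentalElt (g y)) s := by
  refine SmoothOn.smul contDiffOn_const (SmoothOn.sum fun i _ => ?_)
  exact (SmoothOn.realCovector (h.clm_apply contDiffOn_const)).map (LinearMap.mulLeft ℂ _)

lemma SmoothOn.contraction {g : E → E →L[ℝ] E →L[ℝ] ℝ} {s : Set E} (h : ContDiffOn ℝ ∞ g s)
    (hg : ∀ y ∈ s, (g y).IsInvertible) {β γ : E → CxExt E} (hβ : SmoothOn β s)
    (hγ : SmoothOn γ s) : SmoothOn (fun y => contraction (g y) (β y) (γ y)) s := by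
  have hinv : ContDiffOn ℝ ∞ (fun y => (g y).inverse) s := fun y hy => by
    obtain ⟨e, he⟩ := hg y hy
    have := contDiffAt_map_inverse (n := ∞) e
    rw [he] at this
    exact this.comp_contDiffWithinAt y (h y hy)
  have hco : ∀ ε : CxCovector E, SmoothOn (fun y => cometric (g y) ε) s := by
    intro ε l
    obtain ⟨η, rfl⟩ := (Module.evalEquiv ℂ (CxCovector E)).surjective l
    have h1 : ∀ ρ : E →L[ℝ] ℝ, ContDiffOn ℝ ∞ (fun y => η ((g y).inverse ρ)) s := fun ρ =>
      η.contDiff.comp_contDiffOn (hinv.clm_apply contDiffOn_const)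
    exact (h1 _).add (contDiffOn_const.mul (h1 _))
  have main : ∀ a : CxExt E, ∀ γ : E → CxExt E, SmoothOn γ s →
      SmoothOn (fun y => _root_.contraction (g y) a (γ y)) s := by
    intro a
    induction a using CxExt.induction with
    | h0 c =>
      intro γ hγ
      refine (hγ.map (LinearMap.lsmul ℂ (CxExt E) c)).congr fun y _ => ?_
      rw [AlgHom.commutes]
      rfl
    | h1 a b ha hb =>
      intro γ hγ
      refine ((ha γ hγ).add (hb γ hγ)).congr fun y _ => ?_
      rw [map_add, LinearMap.add_apply]
    | h2 a ε ha =>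
      intro γ hγ
      refine ((hco ε).bilin (ha γ hγ) CliffordAlgebra.contractLeft).congr fun y _ => ?_
      rw [contraction_ι_mul]
  set b := Module.finBasis ℂ (CxExt E)
  refine (SmoothOn.sum (t := Finset.univ) fun J _ =>
    SmoothOn.smul (hβ (b.coord J)) (main (b J) γ hγ)).congr fun y _ => ?_
  conv_lhs => rw [← b.sum_repr (β y), map_sum, LinearMap.sum_apply]
  exact Finset.sum_congr rfl fun J _ => by rw [map_smul, LinearMap.smul_apply]; rfl

end Smooth

/-! ## Complex manifolds, Hermitian metrics and smooth complex forms -/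

section Manifold

variable {E : Type*} [NormedAddCommGroup E] [NormedSpace ℂ E]
  {M : Type*} [TopologicalSpace M] [ChartedSpace E M]

/-- A complex manifold is in particular a smooth real manifold. -/
instance IsManifold.realOfComplex [IsManifold 𝓘(ℂ, E) ω M] : IsManifold 𝓘(ℝ, E) ∞ M := by
  refine isManifold_of_contDiffOn _ _ _ fun e e' he he' => ?_
  have h := (HasGroupoid.compatible (G := contDiffGroupoid ω 𝓘(ℂ, E)) he he').1
  exact ((h : ContDiffOn ℂ ω _ _).restrict_scalars ℝ).of_le (by simp)

variable [IsManifold 𝓘(ℂ, E) ω M]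

variable (E M) in
/-- A Hermitian metric on a complex manifold: a smooth Riemannian metric on the underlying real
manifold for which the complex structure `J` (multiplication by `i` on the tangent spaces, each of
which is a copy of the model space `E`) is orthogonal. -/
structure HermitianMetric extends
    Bundle.ContMDiffRiemannianMetric 𝓘(ℝ, E) ∞ E (fun x : M => TangentSpace 𝓘(ℝ, E) x) where
  inner_J : ∀ (x : M) (v w : E),
    (inner x : E →L[ℝ] E →L[ℝ] ℝ) (Complex.I • v) (Complex.I • w) =
      (inner x : E →L[ℝ] E →L[ℝ] ℝ) v w

/-- The metric at the point `x`. -/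
def HermitianMetric.at (g : HermitianMetric E M) (x : M) : E →L[ℝ] E →L[ℝ] ℝ := g.inner x

/-- The differential, at the point `y` of the chart at `x₀`, of the inverse of this chart,
as a map from `E` to the tangent space of `M` at the image of `y`. -/
def chartFrame (x₀ : M) (y : E) : E →L[ℂ] E :=
  tangentCoordChange 𝓘(ℂ, E) x₀ ((extChartAt 𝓘(ℂ, E) x₀).symm y)
    ((extChartAt 𝓘(ℂ, E) x₀).symm y)

/-- The expression in the chart at `x₀` of a complex form `α` on `M`. -/
def chartRep (x₀ : M) (α : M → CxExt E) (y : E) : CxExt E :=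
  pullExt (chartFrame x₀ y) (α ((extChartAt 𝓘(ℂ, E) x₀).symm y))

lemma tangentCoordChange_restrictScalars {x y z : M}
    (hx : z ∈ (extChartAt 𝓘(ℂ, E) x).source) (hy : z ∈ (extChartAt 𝓘(ℂ, E) y).source) :
    tangentCoordChange 𝓘(ℝ, E) x y z =
      (tangentCoordChange 𝓘(ℂ, E) x y z).restrictScalars ℝ := by
  have h := hasFDerivWithinAt_tangentCoordChange (I := 𝓘(ℂ, E)) ⟨hx, hy⟩
  have h' := hasFDerivWithinAt_tangentCoordChange (I := 𝓘(ℝ, E)) (x := x) (y := y) (z := z)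
    ⟨by simpa using hx, by simpa using hy⟩
  simp only [modelWithCornersSelf_coe, Set.range_id, hasFDerivWithinAt_univ] at h h'
  exact h'.unique (h.restrictScalars ℝ)

lemma chartFrame_inverse (x₀ : M) {y : E} (hy : y ∈ (extChartAt 𝓘(ℂ, E) x₀).target) :
    ∃ S : E →L[ℂ] E, (∀ v, chartFrame x₀ y (S v) = v) ∧ ∀ v, S (chartFrame x₀ y v) = v := by
  have hz := (extChartAt 𝓘(ℂ, E) x₀).map_target hy
  have hz' := mem_extChartAt_source (I := 𝓘(ℂ, E)) ((extChartAt 𝓘(ℂ, E) x₀).symm y)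
  refine ⟨tangentCoordChange 𝓘(ℂ, E) ((extChartAt 𝓘(ℂ, E) x₀).symm y) x₀
    ((extChartAt 𝓘(ℂ, E) x₀).symm y), fun v => ?_, fun v => ?_⟩
  · rw [chartFrame, tangentCoordChange_comp ⟨⟨hz', hz⟩, hz'⟩, tangentCoordChange_self hz']
  · rw [chartFrame, tangentCoordChange_comp ⟨⟨hz, hz'⟩, hz⟩, tangentCoordChange_self hz]

lemma HermitianMetric.contDiffOn [FiniteDimensional ℂ E] (g : HermitianMetric E M) (x₀ : M) :
    ContDiffOn ℝ ∞ (fun y => pullMetric (chartFrame x₀ y)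
      (g.at ((extChartAt 𝓘(ℂ, E) x₀).symm y))) (extChartAt 𝓘(ℂ, E) x₀).target := by
  simp only [contDiffOn_clm_apply]
  intro v w
  set e := trivializationAt E (TangentSpace 𝓘(ℝ, E) : M → Type _) x₀ with he
  have hbase : e.baseSet = (chartAt E x₀).source := rfl
  have hsec : ∀ v : E, ContMDiffOn 𝓘(ℝ, E) (𝓘(ℝ, E).prod 𝓘(ℝ, E)) ∞
      (fun x => (⟨x, e.symm x v⟩ : TangentBundle 𝓘(ℝ, E) M)) e.baseSet := fun v => by
    rw [e.contMDiffOn_section_baseSet_iff]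
    refine (contMDiffOn_const (c := v)).congr fun x hx => ?_
    rw [e.apply_mk_symm hx]
  have hg : ContMDiffOn 𝓘(ℝ, E) 𝓘(ℝ, ℝ) ∞
      (fun x => g.inner x (e.symm x v) (e.symm x w)) e.baseSet := by
    intro x hx
    have : ContMDiffWithinAt 𝓘(ℝ, E) (𝓘(ℝ, E).prod 𝓘(ℝ)) ∞
      (fun m ↦ Bundle.TotalSpace.mk' ℝ (E := Bundle.Trivial M ℝ) m
        (g.inner m (e.symm m v) (e.symm m w))) e.baseSet x := by
      apply ContMDiffWithinAt.clm_bundle_apply₂ (F₁ := E) (F₂ := E)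
      · exact g.contMDiff.contMDiffAt.contMDiffWithinAt
      · exact hsec v x hx
      · exact hsec w x hx
    simp only [Bundle.contMDiffWithinAt_totalSpace] at this
    exact this.2
  have hsymm := contMDiffOn_extChartAt_symm (I := 𝓘(ℝ, E)) (n := ∞) x₀
  have hcomp := contMDiffOn_iff_contDiffOn.mp (hg.comp hsymm fun y hy => by
    rw [hbase]
    simpa using (extChartAt 𝓘(ℝ, E) x₀).map_target hy)
  have htarget : (extChartAt 𝓘(ℂ, E) x₀).target = (extChartAt 𝓘(ℝ, E) x₀).target := by simp
  rw [htarget]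
  refine hcomp.congr fun y hy => ?_
  have hsy : (extChartAt 𝓘(ℂ, E) x₀).symm y = (extChartAt 𝓘(ℝ, E) x₀).symm y := by simp
  have hz : (extChartAt 𝓘(ℝ, E) x₀).symm y ∈ (chartAt E x₀).source := by
    simpa using (extChartAt 𝓘(ℝ, E) x₀).map_target hy
  have hv : ∀ v : E, e.symm ((extChartAt 𝓘(ℝ, E) x₀).symm y) v = chartFrame x₀ y v := fun v => by
    have h1 := TangentBundle.symmL_trivializationAt_eq_core (I := 𝓘(ℝ, E)) hz
    have h2 : e.symm ((extChartAt 𝓘(ℝ, E) x₀).symm y) v =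
      tangentCoordChange 𝓘(ℝ, E) x₀ ((extChartAt 𝓘(ℝ, E) x₀).symm y)
        ((extChartAt 𝓘(ℝ, E) x₀).symm y) v :=
      (e.symmL_apply (R := ℝ) hz v).symm.trans (congrArg (fun L => L v) h1)
    rw [h2, tangentCoordChange_restrictScalars (by simpa using hz) (by simp), chartFrame, hsy]
    rfl
  change g.at _ (chartFrame x₀ y v) (chartFrame x₀ y w) =
    g.at ((extChartAt 𝓘(ℝ, E) x₀).symm y) (e.symm _ v) (e.symm _ w)
  rw [hv, hv, hsy]

lemma HermitianMetric.isInvertible [FiniteDimensional ℂ E] (g : HermitianMetric E M) (x : M) :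
    (g.at x).IsInvertible :=
  isInvertible_of_pos _ fun v hv => g.pos x v hv

lemma HermitianMetric.isInvertible_pull [FiniteDimensional ℂ E] (g : HermitianMetric E M) (x₀ : M)
    {y : E} (hy : y ∈ (extChartAt 𝓘(ℂ, E) x₀).target) :
    (pullMetric (chartFrame x₀ y) (g.at ((extChartAt 𝓘(ℂ, E) x₀).symm y))).IsInvertible := by
  obtain ⟨S, -, hS⟩ := chartFrame_inverse x₀ hy
  refine isInvertible_of_pos _ fun v hv => g.pos _ _ fun h0 => hv ?_
  have h0' : chartFrame x₀ y v = 0 := h0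
  rw [← hS v, h0', map_zero]

/-- A change of charts is holomorphic, and it relates the frames of the two charts. -/
lemma chartFrame_change (x₀ z : M) {y : E} (hy : y ∈ (extChartAt 𝓘(ℂ, E) x₀).target)
    (hz : (extChartAt 𝓘(ℂ, E) x₀).symm y ∈ (extChartAt 𝓘(ℂ, E) z).source) :
    ContDiffAt ℂ ω (extChartAt 𝓘(ℂ, E) z ∘ (extChartAt 𝓘(ℂ, E) x₀).symm) y ∧
    fderiv ℂ (extChartAt 𝓘(ℂ, E) z ∘ (extChartAt 𝓘(ℂ, E) x₀).symm) y =
      tangentCoordChange 𝓘(ℂ, E) x₀ z ((extChartAt 𝓘(ℂ, E) x₀).symm y) ∧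
    chartFrame x₀ y = (chartFrame z
      ((extChartAt 𝓘(ℂ, E) z ∘ (extChartAt 𝓘(ℂ, E) x₀).symm) y)).comp
        (fderiv ℂ (extChartAt 𝓘(ℂ, E) z ∘ (extChartAt 𝓘(ℂ, E) x₀).symm) y) := by
  have hs := (extChartAt 𝓘(ℂ, E) x₀).map_target hy
  have h1 := contDiffWithinAt_ext_coord_change (I := 𝓘(ℂ, E)) (n := ω) z x₀ (y := y)
    ⟨hy, hz⟩
  have h2 := hasFDerivWithinAt_tangentCoordChange (I := 𝓘(ℂ, E)) ⟨hs, hz⟩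
  rw [(extChartAt 𝓘(ℂ, E) x₀).right_inv hy] at h2
  simp only [modelWithCornersSelf_coe, Set.range_id, hasFDerivWithinAt_univ,
    contDiffWithinAt_univ] at h1 h2
  refine ⟨h1, h2.fderiv, ?_⟩
  rw [h2.fderiv]
  ext v
  rw [ContinuousLinearMap.comp_apply, chartFrame, chartFrame, Function.comp_apply,
    (extChartAt 𝓘(ℂ, E) z).left_inv hz,
    tangentCoordChange_comp ⟨⟨hs, hz⟩, mem_extChartAt_source _⟩]

/-! ### The algebra of smooth complex forms -/

variable [FiniteDimensional ℂ E]

variable (E M) in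
/-- The algebra `A_ℂ` of smooth complex differential forms on `M`, with the wedge product. A form
assigns to `x` an element of the complexified exterior algebra of the cotangent space at `x`. -/
def smoothForms : Subalgebra ℂ (M → CxExt E) where
  carrier := {α | ∀ x₀ : M, SmoothOn (chartRep x₀ α) (extChartAt 𝓘(ℂ, E) x₀).target}
  mul_mem' hα hβ x₀ := ((hα x₀).bilin (hβ x₀) (LinearMap.mul ℂ (CxExt E))).congr
    fun _ _ => map_mul _ _ _
  add_mem' hα hβ x₀ := ((hα x₀).add (hβ x₀)).congr fun _ _ => map_add _ _ _
  algebraMap_mem' c _ := (SmoothOn.const (algebraMap ℂ (CxExt E) c) _).congr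
    fun _ _ => AlgHom.commutes _ c

/-- The forms of degree `k` on `E` (zero if `k < 0`). -/
def extDegree : ℤ → Submodule ℂ (CxExt E)
  | Int.ofNat m => ⋀[ℂ]^m (CxCovector E)
  | Int.negSucc _ => ⊥

variable (E M) in
/-- The grading of `A_ℂ` by the degree of forms. -/
def formDegree (k : ℤ) : Submodule ℂ (smoothForms E M) where
  carrier := {α | ∀ x, α.1 x ∈ extDegree k}
  add_mem' hα hβ x := add_mem (hα x) (hβ x)
  zero_mem' _ := zero_mem _
  smul_mem' c _ hα x := Submodule.smul_mem _ c (hα x)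

/-- The exterior derivative of a form on `M`, computed at `x` in the chart at `x`; by
`chartRep_extDFun` it is the coordinate exterior derivative in every chart. -/
def extDFun (α : M → CxExt E) (x : M) : CxExt E :=
  extD (chartRep x α) (extChartAt 𝓘(ℂ, E) x x)

lemma chartRep_extDFun {α : M → CxExt E} (hα : α ∈ smoothForms E M) (x₀ : M) {y : E}
    (hy : y ∈ (extChartAt 𝓘(ℂ, E) x₀).target) :
    chartRep x₀ (extDFun α) y = extD (chartRep x₀ α) y := by
  set z := (extChartAt 𝓘(ℂ, E) x₀).symm y with hzdef
  set φ := extChartAt 𝓘(ℂ, E) z ∘ (extChartAt 𝓘(ℂ, E) x₀).symm with hφ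
  have hzz : z ∈ (extChartAt 𝓘(ℂ, E) z).source := mem_extChartAt_source z
  have hev : chartRep x₀ α =ᶠ[nhds y] fun w => pullExt (fderiv ℂ φ w) (chartRep z α (φ w)) := by
    have hc : ContinuousAt (extChartAt 𝓘(ℂ, E) x₀).symm y :=
      continuousAt_extChartAt_symm'' hy
    have hn : (extChartAt 𝓘(ℂ, E) z).source ∈ nhds ((extChartAt 𝓘(ℂ, E) x₀).symm y) :=
      extChartAt_source_mem_nhds z
    filter_upwards [hc hn, (isOpen_extChartAt_target (I := 𝓘(ℂ, E)) x₀).mem_nhds hy] with w hw hw'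
    have h3 := (chartFrame_change x₀ z hw' hw).2.2
    rw [chartRep, h3, pullExt_comp, chartRep, hφ, Function.comp_apply,
      (extChartAt 𝓘(ℂ, E) z).left_inv hw]
  obtain ⟨h1, h2, -⟩ := chartFrame_change x₀ z hy hzz
  rw [extD_congr hev, extD_pullExt h1, ← hφ, h2]
  · rfl
  · exact (hα z).compDiffAt (isOpen_extChartAt_target z)
      ((extChartAt 𝓘(ℂ, E) z).map_source hzz)

lemma chartRep_compDiffAt {α : M → CxExt E} (hα : α ∈ smoothForms E M) (x : M) :
    CompDiffAt (chartRep x α) (extChartAt 𝓘(ℂ, E) x x) :=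
  (hα x).compDiffAt (isOpen_extChartAt_target x) (mem_extChartAt_target x)

variable (E M) in
/-- The exterior derivative `d` on smooth complex forms. -/
def exteriorDerivative : Module.End ℂ (smoothForms E M) where
  toFun α := ⟨extDFun α.1, fun x₀ => ((α.2 x₀).extD (isOpen_extChartAt_target x₀)).congr
    fun _ hy => chartRep_extDFun α.2 x₀ hy⟩
  map_add' α β := Subtype.ext <| funext fun x => by
    refine Eq.trans ?_ (extD_add (chartRep_compDiffAt α.2 x) (chartRep_compDiffAt β.2 x))
    exact congrArg (fun f => extD f _) (funext fun y => map_add _ _ _)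
  map_smul' c α := Subtype.ext <| funext fun x => by
    have h : chartRep x (c • α).1 = fun y => c • chartRep x α.1 y := 
      funext fun y => map_smul (pullExt (chartFrame x y)) c _
    change extD (chartRep x (c • α).1) _ = c • extD (chartRep x α.1) _
    rw [h]
    simp only [extD, Finset.smul_sum, map_smul]
    refine Finset.sum_congr rfl fun J _ => ?_
    rw [fderiv_fun_const_smul (chartRep_compDiffAt α.2 x _), map_smul, smul_mul_assoc]

/-- The projection of forms onto type `(p, q)`. -/
def formTypeProj (p q : ℕ) : Module.End ℂ (smoothForms E M) where
  toFun α := ⟨fun x => typeProj p q (α.1 x), fun x₀ => ((α.2 x₀).map (typeProj p q)).congr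
    fun _ _ => (typeProj_pull _ p q _).symm⟩
  map_add' _ _ := Subtype.ext <| funext fun _ => map_add _ _ _
  map_smul' c α := Subtype.ext <| funext fun x => map_smul (typeProj p q) c (α.1 x)

variable (E M) in
/-- The operator `∂`, the component of type `(1, 0)` of `d`. -/
def partialOp : Module.End ℂ (smoothForms E M) :=
  ∑ p ∈ Finset.range (Module.finrank ℂ E + 1), ∑ q ∈ Finset.range (Module.finrank ℂ E + 1),
    formTypeProj (p + 1) q * exteriorDerivative E M * formTypeProj p q

variable (E M) in
/-- The operator `∂̄`, the component of type `(0, 1)` of `d`. -/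
def dbarOp : Module.End ℂ (smoothForms E M) :=
  ∑ p ∈ Finset.range (Module.finrank ℂ E + 1), ∑ q ∈ Finset.range (Module.finrank ℂ E + 1),
    formTypeProj p (q + 1) * exteriorDerivative E M * formTypeProj p q

/-! ### The operators of Hermitian geometry -/

namespace HermitianMetric

variable (g : HermitianMetric E M)

/-- The fundamental form `ω(v, w) = g(J v, w)`. -/
def fundamentalForm : smoothForms E M :=
  ⟨fun x => fundamentalElt (g.at x), fun x₀ => (SmoothOn.fundamentalElt (g.contDiffOn x₀)).congr
    fun _ _ => fundamentalElt_pull _ _⟩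

/-- The Riemannian volume form `ω^n / n!`, where `n` is the complex dimension. -/
def volumeForm : smoothForms E M :=
  (((Module.finrank ℂ E).factorial : ℂ)⁻¹) • g.fundamentalForm ^ Module.finrank ℂ E

lemma contraction_mem {α β : M → CxExt E} (hα : α ∈ smoothForms E M) (hβ : β ∈ smoothForms E M) :
    (fun x => contraction (g.at x) (α x) (β x)) ∈ smoothForms E M := fun x₀ => by
  refine (SmoothOn.contraction (g.contDiffOn x₀) (fun y hy => g.isInvertible_pull x₀ hy)
    (hα x₀) (hβ x₀)).congr fun y hy => ?_
  obtain ⟨S, hS, -⟩ := chartFrame_inverse x₀ hy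
  exact (contraction_pull (g.isInvertible _) hS (g.isInvertible_pull x₀ hy) _ _).symm

lemma reverse_mem {α : M → CxExt E} (hα : α ∈ smoothForms E M) :
    (fun x => CliffordAlgebra.reverse (α x)) ∈ smoothForms E M := fun x₀ =>
  ((hα x₀).map CliffordAlgebra.reverse).congr fun _ _ => (reverse_pull _ _).symm

lemma conjForm_mem {α : M → CxExt E} (hα : α ∈ smoothForms E M) :
    (fun x => conjForm (α x)) ∈ smoothForms E M := fun x₀ =>
  (hα x₀).conjForm.congr fun _ _ => (conjForm_pull _ _).symm

/-- The (complex linear) Hodge star operator. -/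
def star : Module.End ℂ (smoothForms E M) where
  toFun α := ⟨fun x => hodgeStar (g.at x) (g.volumeForm.1 x) (α.1 x),
    g.contraction_mem (reverse_mem α.2) g.volumeForm.2⟩
  map_add' _ _ := Subtype.ext <| funext fun _ => map_add _ _ _
  map_smul' c α := Subtype.ext <| funext fun x => map_smul (hodgeStar (g.at x) (g.volumeForm.1 x)) c (α.1 x)

/-- The metric adjoint of the exterior multiplication by the form `β`. -/
def wedgeAdj (β : smoothForms E M) : Module.End ℂ (smoothForms E M) where
  toFun α := ⟨fun x => wedgeAdjoint (g.at x) (β.1 x) (α.1 x),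
    g.contraction_mem (reverse_mem (conjForm_mem β.2)) α.2⟩
  map_add' _ _ := Subtype.ext <| funext fun _ => map_add _ _ _
  map_smul' c α := Subtype.ext <| funext fun x => map_smul (wedgeAdjoint (g.at x) (β.1 x)) c (α.1 x)

/-- The operators `S` and `T` on forms are adjoint for the pointwise Hermitian inner product. -/
def IsAdjoint (S T : Module.End ℂ (smoothForms E M)) : Prop :=
  ∀ (α β : smoothForms E M) (x : M),
    formInner (g.at x) ((S α).1 x) (β.1 x) = formInner (g.at x) (α.1 x) ((T β).1 x)

/-- The Lefschetz operator `L = ω ∧ _`. -/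
def lefschetz : Module.End ℂ (smoothForms E M) := LinearMap.mulLeft ℂ g.fundamentalForm

/-- The operator `Λ = L*`. -/
def lefschetzAdj : Module.End ℂ (smoothForms E M) := g.wedgeAdj g.fundamentalForm

/-- The operator `λ = ∂ω ∧ _`. -/
def lambdaOp : Module.End ℂ (smoothForms E M) := LinearMap.mulLeft ℂ (partialOp E M g.fundamentalForm)

/-- The operator `λ*`. -/
def lambdaAdj : Module.End ℂ (smoothForms E M) := g.wedgeAdj (partialOp E M g.fundamentalForm)

/-- The torsion operator `τ = [Λ, λ]`. -/
def torsion : Module.End ℂ (smoothForms E M) := gradedComm (-2) 3 g.lefschetzAdj g.lambdaOp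

/-- The operator `τ* = [λ*, L]`. -/
def torsionAdj : Module.End ℂ (smoothForms E M) := gradedComm (-3) 2 g.lambdaAdj g.lefschetz

/-- The operator `∂* = - ⋆ ∂̄ ⋆`. -/
def partialAdj : Module.End ℂ (smoothForms E M) := -(g.star * dbarOp E M * g.star)

lemma isAdjoint_wedge (β : smoothForms E M) : g.IsAdjoint (LinearMap.mulLeft ℂ β) (g.wedgeAdj β) :=
  fun _ _ x => formInner_wedge_left (g.isInvertible x) (g.symm x) _ _ _

lemma isAdjoint_wedge' (β : smoothForms E M) : g.IsAdjoint (g.wedgeAdj β) (LinearMap.mulLeft ℂ β) :=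
  fun _ _ _ => (formInner_wedge _ _ _ _).symm

/-- `Λ` is the adjoint of `L`. -/
lemma isAdjoint_lefschetz : g.IsAdjoint g.lefschetz g.lefschetzAdj := g.isAdjoint_wedge _

/-- `λ*` is the adjoint of `λ`. -/
lemma isAdjoint_lambda : g.IsAdjoint g.lambdaOp g.lambdaAdj := g.isAdjoint_wedge _

/-- `τ*` is the adjoint of `τ`. -/
lemma isAdjoint_torsion : g.IsAdjoint g.torsion g.torsionAdj := fun α β x => by
  have hl : ∀ a b c : CxExt E, formInner (g.at x) (a - b) c =
      formInner (g.at x) a c - formInner (g.at x) b c := fun a b c => by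
    simp only [formInner, map_sub]
  have hr : ∀ a b c : CxExt E, formInner (g.at x) c (a - b) =
      formInner (g.at x) c a - formInner (g.at x) c b := fun a b c => by
    rw [← formInner_conj (g.isInvertible x) (g.symm x), hl, map_sub,
      formInner_conj (g.isInvertible x) (g.symm x),
      formInner_conj (g.isInvertible x) (g.symm x)]
  have h1 : g.torsion α = g.lefschetzAdj (g.lambdaOp α) - g.lambdaOp (g.lefschetzAdj α) := by
    rw [torsion, gradedComm_of_even ⟨-3, by norm_num⟩]; rfl
  have h2 : g.torsionAdj β = g.lambdaAdj (g.lefschetz β) - g.lefschetz (g.lambdaAdj β) := by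
    rw [torsionAdj, gradedComm_of_even ⟨-3, by norm_num⟩]; rfl
  rw [h1, h2]
  change formInner (g.at x) ((g.lefschetzAdj (g.lambdaOp α)).1 x -
    (g.lambdaOp (g.lefschetzAdj α)).1 x) (β.1 x) = formInner (g.at x) (α.1 x)
      ((g.lambdaAdj (g.lefschetz β)).1 x - (g.lefschetz (g.lambdaAdj β)).1 x)
  rw [hl, hr]
  congr 1
  · exact (g.isAdjoint_wedge' _ _ _ x).trans (g.isAdjoint_lambda _ _ x)
  · exact (g.isAdjoint_lambda _ _ x).trans (g.isAdjoint_wedge' _ _ _ x)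

/-- The operators `Δ₀ = ∂̄`, `Δ₁ = -i (∂* + τ*)`, `Δ₂ = i λ*` and `Δ_n = 0` for `n ≥ 3`. -/
def Delta : ℕ → Module.End ℂ (smoothForms E M)
  | 0 => dbarOp E M
  | 1 => (-Complex.I) • (g.partialAdj + g.torsionAdj)
  | 2 => Complex.I • g.lambdaAdj
  | _ => 0

/-- The total differential `𝔻 = Δ₀ + Δ₁ ξ + Δ₂ ξ²`. -/
def totalDifferential : PowerSeries (Module.End ℂ (smoothForms E M)) :=
  PowerSeries.C (g.Delta 0) + PowerSeries.C (g.Delta 1) * PowerSeries.X +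
    PowerSeries.C (g.Delta 2) * PowerSeries.X ^ 2

end HermitianMetric

end Manifold

end

/-! Everything reduces to two commutators: [Λ, ∂̄] = Δ₁ and [Λ, [Λ, ∂̄]] = 2 Δ₂. Together with [Λ,
λ*] = 0 they say that the iterated commutators of ∂̄ with Λ, divided by n!, are exactly the Δ_n, so
that 𝔻 = e^{Λξ} ∂̄ e^{-Λξ}. This is the gauge equation with φ = Λξ; the multicomplex relations are
the coefficients of 𝔻² = 0, which follows from ∂̄² = 0; and the orders follow because Λ has order 2,
∂̄ has order 1, and the commutator of operators of orders r and s has order at most r + s - 1.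

The commutators, which are the Kähler identities with torsion, are obtained without normal
coordinates and without primitive decompositions. Let W = e^{-L} e^Λ e^{-L} be the Weyl element of
the Lefschetz sl₂ action. On a Hermitian vector space the multiplication by ε ∘ J and the
contraction with ε♯ span a two-dimensional sl₂ representation, so W conjugates the first into the
second (`weylOp_mul_of_comm`). Hence W conjugates the multiplication by J*a into the contraction
with a, for every form a (`weylExt_mul_mulLeft`). Since W 1 = ± vol (`weylExt_one`), the Hodge star
is W up to sign, the action of J and the reversal of products (`hodgeStar_eq`). As a consequence W
conjugates ∂̄ into y = -i ∂*, where ∂* = -⋆∂̄⋆ (`weylOp_mul_dbarOp`), and l = ∂̄ω ∧ _ into z = -i λ*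
(`weylOp_mul_lambdaBar`).

Now [∂̄, L] = l commutes with L, so e^{-L} conjugates ∂̄ into ∂̄ + l and leaves l fixed. Moving the
last e^{-L} to the other side gives e^{ad Λ} (∂̄ + l) = e^{ad L} y and e^{ad Λ} l = e^{ad L} z, that
is, e^{ad Λ} ∂̄ = e^{ad L} (y - z). The degrees decrease by 2 on the left and increase by 2 on the
right. The parts of degree -1 give [Λ, ∂̄] = y + [z, L] = -i (∂* + τ*), and those of degree -3 give
[Λ, [Λ, ∂̄]] = -2 z = 2 i λ* (`ad_of_weylOp_conj`).

The equation ∂̄² = 0 comes from d² = 0 by a weight argument: the pull-back along multiplication by s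
on the tangent spaces separates the parts ∂², ∂∂̄ + ∂̄∂ and ∂̄² of d² by their weights s², |s|² and
s̄². -/

/-! ## Exponentials of nilpotent elements and the adjoint action -/

section NilExp

variable (K : Type*) {B : Type*} [Field K] [Ring B] [Algebra K B]

/-- The exponential of a nilpotent element of an algebra over a field of characteristic zero. -/
noncomputable def nilExp (a : B) : B :=
  ∑ i ∈ Finset.range (nilpotencyClass a), ((i.factorial : K)⁻¹) • a ^ i

/-- The adjoint action `x ↦ a x - x a`. -/
def adOp (a : B) : Module.End K B := LinearMap.mulLeft K a - LinearMap.mulRight K a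

variable {K}

lemma adOp_apply (a x : B) : adOp K a x = a * x - x * a := rfl

lemma commute_mulLeft_mulRight_neg (a : B) :
    Commute (LinearMap.mulLeft K a) (LinearMap.mulRight K (-a)) :=
  LinearMap.commute_mulLeft_right a (-a)

lemma adOp_eq_add (a : B) : adOp K a = LinearMap.mulLeft K a + LinearMap.mulRight K (-a) := by
  ext x; simp [adOp, sub_eq_add_neg]

lemma isNilpotent_adOp {a : B} (h : IsNilpotent a) : IsNilpotent (adOp K a) := by
  rw [adOp_eq_add]
  obtain ⟨k, hk⟩ := h
  refine (commute_mulLeft_mulRight_neg a).isNilpotent_add ⟨k, ?_⟩ ⟨k, ?_⟩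
  · rw [LinearMap.pow_mulLeft, hk, LinearMap.mulLeft_zero_eq_zero]
  · rw [LinearMap.pow_mulRight, neg_pow, hk, mul_zero, LinearMap.mulRight_zero_eq_zero]

variable [CharZero K]

/-- A `K`-algebra as a `ℚ`-module. -/
abbrev ratModule (K B : Type*) [Field K] [CharZero K] [Ring B] [Algebra K B] : Module ℚ B :=
  Module.compHom B (algebraMap ℚ K)

/-- `IsNilpotent.exp` has rational coefficients. Restricting scalars along ℚ → K identifies the two
exponentials, so the functional equation of `IsNilpotent.exp` becomes available for `nilExp`. -/
lemma nilExp_eq_exp (a : B) :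
    let := ratModule K B
    nilExp K a = IsNilpotent.exp a := by
  let := ratModule K B
  refine Finset.sum_congr rfl fun i _ => ?_
  change _ = (algebraMap ℚ K ((i.factorial : ℚ)⁻¹)) • a ^ i
  simp

lemma nilExp_eq_sum {a : B} {k : ℕ} (h : a ^ k = 0) :
    nilExp K a = ∑ i ∈ Finset.range k, ((i.factorial : K)⁻¹) • a ^ i := by
  let := ratModule K B
  rw [nilExp_eq_exp, IsNilpotent.exp_eq_sum h]
  refine Finset.sum_congr rfl fun i _ => ?_
  change (algebraMap ℚ K ((i.factorial : ℚ)⁻¹)) • a ^ i = _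
  simp

lemma nilExp_mul_nilExp_neg {a : B} (h : IsNilpotent a) : nilExp K a * nilExp K (-a) = 1 := by
  let := ratModule K B
  rw [nilExp_eq_exp, nilExp_eq_exp, IsNilpotent.exp_mul_exp_neg_self h]

lemma nilExp_neg_mul_nilExp {a : B} (h : IsNilpotent a) : nilExp K (-a) * nilExp K a = 1 := by
  let := ratModule K B
  rw [nilExp_eq_exp, nilExp_eq_exp, IsNilpotent.exp_neg_mul_exp_self h]

/-- The operator ad a is the sum of the commuting nilpotent operators "multiply by a on the left"
and "multiply by -a on the right", so its exponential is the product of theirs. -/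
lemma nilExp_adOp_apply {a : B} (h : IsNilpotent a) (x : B) :
    nilExp K (adOp K a) x = nilExp K a * x * nilExp K (-a) := by
  obtain ⟨k, hk⟩ := h
  have hl : LinearMap.mulLeft K a ^ k = 0 := by
    rw [LinearMap.pow_mulLeft, hk, LinearMap.mulLeft_zero_eq_zero]
  have hn : (-a) ^ k = 0 := by rw [neg_pow, hk, mul_zero]
  have hr : LinearMap.mulRight K (-a) ^ k = 0 := by
    rw [LinearMap.pow_mulRight, hn, LinearMap.mulRight_zero_eq_zero]
  have key : nilExp K (adOp K a) =
      nilExp K (LinearMap.mulLeft K a) * nilExp K (LinearMap.mulRight K (-a)) := by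
    let := ratModule K (Module.End K B)
    rw [adOp_eq_add, nilExp_eq_exp, nilExp_eq_exp, nilExp_eq_exp]
    exact IsNilpotent.exp_add_of_commute (commute_mulLeft_mulRight_neg a) ⟨k, hl⟩ ⟨k, hr⟩
  have e1 : ∀ y, nilExp K (LinearMap.mulLeft K a) y = nilExp K a * y := fun y => by
    rw [nilExp_eq_sum hl, nilExp_eq_sum hk, LinearMap.sum_apply, Finset.sum_mul]
    exact Finset.sum_congr rfl fun i _ => by
      rw [LinearMap.pow_mulLeft, LinearMap.smul_apply, LinearMap.mulLeft_apply, smul_mul_assoc]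
  have e2 : ∀ y, nilExp K (LinearMap.mulRight K (-a)) y = y * nilExp K (-a) := fun y => by
    rw [nilExp_eq_sum hr, nilExp_eq_sum hn, LinearMap.sum_apply, Finset.mul_sum]
    exact Finset.sum_congr rfl fun i _ => by
      rw [LinearMap.pow_mulRight, LinearMap.smul_apply, LinearMap.mulRight_apply, mul_smul_comm]
  rw [key, Module.End.mul_apply, e2, e1, mul_assoc]

/-- Conjugation of `x` by `e^a` when the second iterated commutator vanishes. -/
lemma nilExp_conj_of_sq {a x z : B} (h : IsNilpotent a) (hz : a * x - x * a = z)
    (hc : a * z = z * a) : nilExp K a * x = (x + z) * nilExp K a := by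
  obtain ⟨k, hk⟩ := isNilpotent_adOp (K := K) h
  have h2 : ∀ n, ((adOp K a) ^ (n + 2)) x = 0 := fun n => by
    rw [pow_add, Module.End.mul_apply, pow_two, Module.End.mul_apply, adOp_apply a x, hz,
      adOp_apply, hc, sub_self, map_zero]
  have e : nilExp K (adOp K a) x = x + z := by
    -- The sum runs up to `k + 2` so that the terms of index 0 and 1 can always be split off; the
    -- remaining ones vanish by `h2`.
    rw [nilExp_eq_sum (pow_eq_zero_of_le (Nat.le_add_right k 2) hk), LinearMap.sum_apply,
      Finset.sum_range_succ', Finset.sum_range_succ', Finset.sum_eq_zero]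
    · simp [adOp_apply, hz, add_comm]
    · intro i _
      rw [LinearMap.smul_apply, add_assoc, h2, smul_zero]
  rw [← e, nilExp_adOp_apply h, mul_assoc _ _ (nilExp K a), nilExp_neg_mul_nilExp h, mul_one]

/-- The binomial theorem for the commuting left and right multiplications. It computes the
coefficient of ξ^n in e^{aξ} x e^{-aξ}, and a need not be nilpotent. -/
lemma sum_antidiagonal_conj (a x : B) (n : ℕ) :
    ∑ ij ∈ Finset.HasAntidiagonal.antidiagonal n, (((ij.1.factorial : K)⁻¹) • a ^ ij.1) * x *
      (((ij.2.factorial : K)⁻¹) • (-a) ^ ij.2) = ((n.factorial : K)⁻¹) • ((adOp K a) ^ n) x := by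
  rw [adOp_eq_add, (commute_mulLeft_mulRight_neg a).add_pow', LinearMap.sum_apply,
    Finset.smul_sum]
  refine Finset.sum_congr rfl fun ij hij => ?_
  rw [LinearMap.pow_mulLeft, LinearMap.pow_mulRight, LinearMap.smul_apply, Module.End.mul_apply,
    LinearMap.mulLeft_apply, LinearMap.mulRight_apply, smul_mul_assoc, mul_smul_comm,
    smul_mul_assoc, smul_smul, ← mul_assoc, ← Nat.cast_smul_eq_nsmul K, smul_smul]
  congr 1
  rw [← Finset.HasAntidiagonal.mem_antidiagonal.mp hij]
  have := Nat.choose_mul_factorial_mul_factorial (Nat.le_add_right ij.1 ij.2)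
  rw [Nat.add_sub_cancel_left] at this
  have h1 : ((ij.1.factorial : ℕ) : K) ≠ 0 := by exact_mod_cast ij.1.factorial_ne_zero
  have h2 : ((ij.2.factorial : ℕ) : K) ≠ 0 := by exact_mod_cast ij.2.factorial_ne_zero
  have h3 : (((ij.1 + ij.2).factorial : ℕ) : K) ≠ 0 := by
    exact_mod_cast (ij.1 + ij.2).factorial_ne_zero
  have h4 : (((ij.1 + ij.2).choose ij.1 : ℕ) : K) * (ij.1.factorial : K) * (ij.2.factorial : K) =
    ((ij.1 + ij.2).factorial : K) := by exact_mod_cast this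
  field_simp
  rw [← h4]; ring

end NilExp

/-! ### Formal exponentials of aξ. -/

section OpExp

variable {K A : Type*} [Field K] [Ring A] [Algebra K A]

/-- Since ξ is central, (aξ)^k = a^k ξ^k, and only the summand k = n contributes. -/
lemma coeff_opExp_C_mul_X (a : Module.End K A) (n : ℕ) :
    PowerSeries.coeff n (opExp (PowerSeries.C a * PowerSeries.X)) =
      ((n.factorial : K)⁻¹) • a ^ n := by
  have hpow : ∀ k : ℕ, (PowerSeries.C a * PowerSeries.X) ^ k =
      PowerSeries.C (a ^ k) * (PowerSeries.X : PowerSeries (Module.End K A)) ^ k := fun k => by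
    rw [(PowerSeries.commute_X (PowerSeries.C a)).mul_pow, map_pow]
  rw [opExp, PowerSeries.coeff_mk, Finset.sum_eq_single n]
  · rw [hpow, PowerSeries.coeff_C_mul, PowerSeries.coeff_X_pow_self, mul_one]
  · intro k _ hk
    rw [hpow, PowerSeries.coeff_C_mul, PowerSeries.coeff_X_pow, if_neg (Ne.symm hk), mul_zero,
      smul_zero]
  · intro h
    exact absurd (Finset.self_mem_range_succ n) h

lemma neg_C_mul_X (a : Module.End K A) :
    -(PowerSeries.C a * PowerSeries.X) = PowerSeries.C (-a) * PowerSeries.X := by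
  ext1 n
  rw [map_neg, PowerSeries.coeff_C_mul, PowerSeries.coeff_C_mul]
  exact (neg_mul a _).symm

variable [CharZero K]

/-- The coefficients of `e^{aξ} d e^{-aξ}` are the iterated commutators `[a, …, [a, d]] / n!`. -/
lemma coeff_opExp_conj (a d : Module.End K A) (n : ℕ) :
    PowerSeries.coeff n (opExp (PowerSeries.C a * PowerSeries.X) * PowerSeries.C d *
      opExp (-(PowerSeries.C a * PowerSeries.X))) =
      ((n.factorial : K)⁻¹) • ((adOp K a) ^ n) d := by
  rw [neg_C_mul_X, PowerSeries.coeff_mul, ← sum_antidiagonal_conj]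
  refine Finset.sum_congr rfl fun ij _ => ?_
  rw [PowerSeries.coeff_mul_C, coeff_opExp_C_mul_X, coeff_opExp_C_mul_X]

/-- This is the case d = 1 of `coeff_opExp_conj`: all commutators with 1 vanish. -/
lemma opExp_mul_opExp_neg (a : Module.End K A) :
    opExp (PowerSeries.C a * PowerSeries.X) * opExp (-(PowerSeries.C a * PowerSeries.X)) = 1 := by
  ext1 n
  have h := coeff_opExp_conj a 1 n
  rw [map_one, mul_one] at h
  rw [h]
  cases n with
  | zero => simp
  | succ n =>
    rw [pow_succ, Module.End.mul_apply, adOp_apply, mul_one, one_mul, sub_self, map_zero,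
      smul_zero, PowerSeries.coeff_one, if_neg n.succ_ne_zero]

lemma opExp_neg_mul_opExp (a : Module.End K A) :
    opExp (-(PowerSeries.C a * PowerSeries.X)) * opExp (PowerSeries.C a * PowerSeries.X) = 1 := by
  have h := opExp_mul_opExp_neg (-a)
  rwa [neg_C_mul_X, neg_neg, ← neg_C_mul_X] at h

end OpExp


/-! ## Homogeneous operators and operators of finite order -/

section Degree

variable {K A : Type*} [Field K] [Ring A] [Algebra K A] {𝒜 : ℤ → Submodule K A}

lemma HasDegree.congr {j k : ℤ} {f : Module.End K A} (h : HasDegree 𝒜 j f) (e : j = k) :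
    HasDegree 𝒜 k f := e ▸ h

lemma HasDegree.zero (k : ℤ) : HasDegree 𝒜 k 0 := fun _ _ _ => zero_mem _

lemma HasDegree.add {k : ℤ} {f g : Module.End K A} (hf : HasDegree 𝒜 k f)
    (hg : HasDegree 𝒜 k g) : HasDegree 𝒜 k (f + g) := fun j a ha =>
  add_mem (hf j a ha) (hg j a ha)

lemma HasDegree.sub {k : ℤ} {f g : Module.End K A} (hf : HasDegree 𝒜 k f)
    (hg : HasDegree 𝒜 k g) : HasDegree 𝒜 k (f - g) := fun j a ha =>
  sub_mem (hf j a ha) (hg j a ha)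

lemma HasDegree.smul {k : ℤ} {f : Module.End K A} (hf : HasDegree 𝒜 k f) (c : K) :
    HasDegree 𝒜 k (c • f) := fun j a ha => Submodule.smul_mem _ c (hf j a ha)

lemma HasDegree.units_smul {k : ℤ} {f : Module.End K A} (hf : HasDegree 𝒜 k f) (u : ℤˣ) :
    HasDegree 𝒜 k (u • f) := fun j a ha => by
  rcases Int.units_eq_one_or u with rfl | rfl
  · simpa using hf j a ha
  · simpa using hf j a ha

lemma HasDegree.mul {j k : ℤ} {f g : Module.End K A} (hf : HasDegree 𝒜 j f)
    (hg : HasDegree 𝒜 k g) : HasDegree 𝒜 (j + k) (f * g) := fun i a ha => by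
  have := hf _ _ (hg i a ha)
  rwa [add_assoc, add_comm k j] at this

lemma HasDegree.mulLeft [SetLike.GradedMonoid 𝒜] {j : ℤ} {a : A} (ha : a ∈ 𝒜 j) :
    HasDegree 𝒜 j (LinearMap.mulLeft K a) := fun i b hb => by
  rw [add_comm i j]
  exact SetLike.mul_mem_graded ha hb

lemma HasDegree.gradedComm {j k : ℤ} {f g : Module.End K A} (hf : HasDegree 𝒜 j f)
    (hg : HasDegree 𝒜 k g) : HasDegree 𝒜 (j + k) (gradedComm j k f g) :=
  (hf.mul hg).sub (((hg.mul hf).congr (add_comm k j)).units_smul _)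

lemma HasDegree.adOp_pow {j k : ℤ} {f g : Module.End K A} (hf : HasDegree 𝒜 j f)
    (hg : HasDegree 𝒜 k g) (n : ℕ) : HasDegree 𝒜 (k + n * j) (((adOp K f) ^ n) g) := by
  induction n with
  | zero => simpa using hg
  | succ n ih =>
    rw [pow_succ', Module.End.mul_apply, adOp_apply]
    exact ((hf.mul ih).sub ((ih.mul hf).congr (add_comm _ _))).congr (by push_cast; ring)

/-- Two operators that agree on homogeneous elements are equal. -/
lemma End.ext_homogeneous (hI : DirectSum.IsInternal 𝒜) {f g : Module.End K A}
    (h : ∀ j : ℤ, ∀ a ∈ 𝒜 j, f a = g a) : f = g := by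
  refine LinearMap.ext fun a => ?_
  have ha : a ∈ ⨆ j, 𝒜 j := by rw [hI.submodule_iSup_eq_top]; trivial
  induction ha using Submodule.iSup_induction' with
  | mem j a ha => exact h j a ha
  | zero => simp
  | add a b _ _ ha hb => rw [map_add, map_add, ha, hb]

/-- The projections onto the homogeneous components. -/
lemma exists_homogeneous_proj (hI : DirectSum.IsInternal 𝒜) :
    ∃ p : ℤ → A →ₗ[K] A, ∀ j k : ℤ, ∀ a ∈ 𝒜 j, p k a = if j = k then a else 0 := by
  classical
  refine ⟨fun k => (𝒜 k).subtype ∘ₗ DirectSum.component K ℤ (fun i => 𝒜 i) k ∘ₗ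
    (LinearEquiv.ofBijective (DirectSum.coeLinearMap 𝒜) hI).symm.toLinearMap, fun j k a ha => ?_⟩
  have h : (LinearEquiv.ofBijective (DirectSum.coeLinearMap 𝒜) hI).symm a =
      DirectSum.lof K ℤ (fun i => 𝒜 i) j ⟨a, ha⟩ := by
    rw [LinearEquiv.symm_apply_eq]
    exact (DirectSum.coeLinearMap_lof 𝒜 j ⟨a, ha⟩).symm
  simp only [LinearMap.comp_apply, LinearEquiv.coe_coe, h]
  by_cases hjk : j = k
  · subst hjk
    simp [DirectSum.component.lof_self]
  · simp [DirectSum.component.of, hjk]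

/-- A family of projections onto the members of a family of submodules makes it a direct sum
decomposition. -/
lemma isInternal_of_proj (p : ℤ → A →ₗ[K] A) (hp : ∀ j k : ℤ, ∀ a ∈ 𝒜 j,
    p k a = if j = k then a else 0) (hmem : ∀ k a, p k a ∈ 𝒜 k) (s : Finset ℤ)
    (hs : ∀ a, ∑ k ∈ s, p k a = a) : DirectSum.IsInternal 𝒜 := by
  classical
  refine (DirectSum.isInternal_submodule_iff_iSupIndep_and_iSup_eq_top 𝒜).mpr ⟨?_, ?_⟩
  · refine iSupIndep_def.mpr fun i => Submodule.disjoint_def.mpr fun z hz hz' => ?_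
    have h1 : (⨆ (j) (_ : j ≠ i), 𝒜 j) ≤ LinearMap.ker (p i) :=
      iSup₂_le fun j hj a ha => by rw [LinearMap.mem_ker, hp j i a ha, if_neg hj]
    have h2 : p i z = 0 := h1 hz'
    rwa [hp i i z hz, if_pos rfl] at h2
  · refine eq_top_iff.mpr fun a _ => ?_
    rw [← hs a]
    exact sum_mem fun k _ => Submodule.mem_iSup_of_mem k (hmem k a)

end Degree

/-! ### Calculus of orders under composition and graded commutators. -/

section Order

variable {K A : Type*} [Field K] [Ring A] [Algebra K A] {𝒜 : ℤ → Submodule K A}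

lemma gradedComm_swap (j k : ℤ) (f g : Module.End K A) :
    gradedComm j k f g = -((j * k).negOnePow • gradedComm k j g f) := by
  simp only [gradedComm, mul_comm k j]
  rcases Int.units_eq_one_or (j * k).negOnePow with h | h <;> rw [h] <;> simp

lemma gradedComm_add_right (j k : ℤ) (f g g' : Module.End K A) :
    gradedComm j k f (g + g') = gradedComm j k f g + gradedComm j k f g' := by
  simp only [gradedComm, mul_add, add_mul, smul_add]; abel

lemma gradedComm_smul_right (j k : ℤ) (c : K) (f g : Module.End K A) :
    gradedComm j k f (c • g) = c • gradedComm j k f g := by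
  simp only [gradedComm, mul_smul_comm, smul_mul_assoc, smul_sub]
  rw [smul_comm c]

lemma gradedComm_zero_right (j k : ℤ) (f : Module.End K A) : gradedComm j k f 0 = 0 := by
  simp [gradedComm]

/-- The graded Jacobi identity. -/
lemma gradedComm_jacobi (i j k : ℤ) (a f g : Module.End K A) :
    gradedComm i (j + k) a (gradedComm j k f g) =
      gradedComm (i + j) k (gradedComm i j a f) g +
        (i * j).negOnePow • gradedComm j (i + k) f (gradedComm i k a g) := by
  -- The degrees enter only through the signs x = (-1)^{ij}, y = (-1)^{ik}, z = (-1)^{jk}. The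
  -- identity holds for arbitrary signs and is checked in the eight cases.
  have key : ∀ {B : Type _} [Ring B] (x y z : ℤˣ) (a f g : B),
      a * (f * g - z • (g * f)) - (x * y) • ((f * g - z • (g * f)) * a) =
        (a * f - x • (f * a)) * g - (y * z) • (g * (a * f - x • (f * a))) +
          x • (f * (a * g - y • (g * a)) - (x * z) • ((a * g - y • (g * a)) * f)) := by
    intro B _ x y z a f g
    rcases Int.units_eq_one_or x with h | h <;>
    rcases Int.units_eq_one_or y with h' | h' <;>
    rcases Int.units_eq_one_or z with h'' | h'' <;>
    simp only [h, h', h'', one_smul, mul_one, Units.neg_smul, neg_neg, mul_neg] <;>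
    noncomm_ring
  have h := key (i * j).negOnePow (i * k).negOnePow (j * k).negOnePow a f g
  simpa only [gradedComm, mul_add, add_mul, Int.negOnePow_add, mul_comm j i] using h

/-- The graded commutator with `a` is a graded derivation of the composition. -/
lemma gradedComm_mul_right (i j k : ℤ) (a f g : Module.End K A) :
    gradedComm i (j + k) a (f * g) =
      gradedComm i j a f * g + (i * j).negOnePow • (f * gradedComm i k a g) := by
  have key : ∀ {B : Type _} [Ring B] (x y : ℤˣ) (a f g : B),
      a * (f * g) - (x * y) • (f * g * a) =
        (a * f - x • (f * a)) * g + x • (f * (a * g - y • (g * a))) := by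
    intro B _ x y a f g
    rcases Int.units_eq_one_or x with h | h <;>
    rcases Int.units_eq_one_or y with h' | h' <;>
    simp only [h, h', one_smul, mul_one, Units.neg_smul, neg_neg, mul_neg] <;>
    noncomm_ring
  simpa only [gradedComm, mul_add, Int.negOnePow_add] using
    key (i * j).negOnePow (i * k).negOnePow a f g

lemma HasOrderLE.hasDegree {r : ℕ} {k : ℤ} {f : Module.End K A} (h : HasOrderLE 𝒜 r k f) :
    HasDegree 𝒜 k f := by
  cases r <;> exact h.1

lemma HasOrderLE.congr {r : ℕ} {j k : ℤ} {f : Module.End K A} (h : HasOrderLE 𝒜 r j f)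
    (e : j = k) : HasOrderLE 𝒜 r k f := e ▸ h

lemma HasOrderLE.zero (r : ℕ) (k : ℤ) : HasOrderLE 𝒜 r k 0 := by
  induction r generalizing k with
  | zero => exact ⟨HasDegree.zero k, fun j a _ => gradedComm_zero_right _ _ _⟩
  | succ r ih =>
    refine ⟨HasDegree.zero k, fun j a _ => ?_⟩
    rw [gradedComm_zero_right]
    exact ih _

lemma HasOrderLE.add {r : ℕ} {k : ℤ} {f g : Module.End K A} (hf : HasOrderLE 𝒜 r k f)
    (hg : HasOrderLE 𝒜 r k g) : HasOrderLE 𝒜 r k (f + g) := by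
  induction r generalizing k f g with
  | zero =>
    refine ⟨hf.1.add hg.1, fun j a ha => ?_⟩
    rw [gradedComm_add_right, hf.2 j a ha, hg.2 j a ha, add_zero]
  | succ r ih =>
    refine ⟨hf.1.add hg.1, fun j a ha => ?_⟩
    rw [gradedComm_add_right]
    exact ih (hf.2 j a ha) (hg.2 j a ha)

lemma HasOrderLE.smul {r : ℕ} {k : ℤ} {f : Module.End K A} (hf : HasOrderLE 𝒜 r k f) (c : K) :
    HasOrderLE 𝒜 r k (c • f) := by
  induction r generalizing k f with
  | zero =>
    refine ⟨hf.1.smul c, fun j a ha => ?_⟩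
    rw [gradedComm_smul_right, hf.2 j a ha, smul_zero]
  | succ r ih =>
    refine ⟨hf.1.smul c, fun j a ha => ?_⟩
    rw [gradedComm_smul_right]
    exact ih (hf.2 j a ha)

lemma HasOrderLE.neg {r : ℕ} {k : ℤ} {f : Module.End K A} (hf : HasOrderLE 𝒜 r k f) :
    HasOrderLE 𝒜 r k (-f) := by
  have h := hf.smul (-1)
  rwa [show (-1 : K) • f = -f from neg_one_smul K f] at h

lemma HasOrderLE.units_smul {r : ℕ} {k : ℤ} {f : Module.End K A} (hf : HasOrderLE 𝒜 r k f)
    (u : ℤˣ) : HasOrderLE 𝒜 r k (u • f) := by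
  rcases Int.units_eq_one_or u with rfl | rfl
  · simpa using hf
  · simpa using hf.neg

lemma HasOrderLE.sum {ι : Type*} {r : ℕ} {k : ℤ} (t : Finset ι) {f : ι → Module.End K A}
    (hf : ∀ i ∈ t, HasOrderLE 𝒜 r k (f i)) : HasOrderLE 𝒜 r k (∑ i ∈ t, f i) :=
  Finset.sum_induction f _ (fun _ _ => HasOrderLE.add) (HasOrderLE.zero r k) hf

/-- Orders add up under composition. -/
lemma HasOrderLE.mul {n r s : ℕ} {j k : ℤ} {f g : Module.End K A} (hn : r + s = n)
    (hf : HasOrderLE 𝒜 r j f) (hg : HasOrderLE 𝒜 s k g) : HasOrderLE 𝒜 n (j + k) (f * g) := by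
  induction n generalizing r s j k f g with
  | zero =>
    obtain ⟨rfl, rfl⟩ : r = 0 ∧ s = 0 := by omega
    refine ⟨hf.1.mul hg.1, fun i a ha => ?_⟩
    rw [gradedComm_mul_right, hf.2 i a ha, hg.2 i a ha]
    simp
  | succ n ih =>
    refine ⟨hf.hasDegree.mul hg.hasDegree, fun i a ha => ?_⟩
    -- The commutator with `a` differentiates one factor at a time, which lowers the total order by
    -- one; a factor of order 0 has zero commutator.
    rw [gradedComm_mul_right]
    refine HasOrderLE.add ?_ (HasOrderLE.units_smul ?_ _)
    · cases r with
      | zero => rw [hf.2 i a ha, zero_mul]; exact HasOrderLE.zero _ _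
      | succ r => exact (ih (by omega) (hf.2 i a ha) hg).congr (by ring)
    · cases s with
      | zero => rw [hg.2 i a ha, mul_zero]; exact HasOrderLE.zero _ _
      | succ s => exact (ih (by omega) hf (hg.2 i a ha)).congr (by ring)

lemma mulLeft_gradedComm (hcomm : ∀ i j : ℤ, ∀ a ∈ 𝒜 i, ∀ b ∈ 𝒜 j,
    a * b = (i * j).negOnePow • (b * a)) {i j : ℤ} {a b : A} (ha : a ∈ 𝒜 i) (hb : b ∈ 𝒜 j) :
    gradedComm i j (LinearMap.mulLeft K a) (LinearMap.mulLeft K b) = 0 := by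
  ext x
  have h := hcomm i j a ha b hb
  simp only [gradedComm, LinearMap.sub_apply, Module.End.mul_apply, LinearMap.mulLeft_apply,
    LinearMap.zero_apply]
  rcases Int.units_eq_one_or (i * j).negOnePow with h' | h' <;> rw [h'] at h ⊢ <;>
    simp [← mul_assoc, h]

/-- Left multiplications have order `0`. -/
lemma HasOrderLE.mulLeft [SetLike.GradedMonoid 𝒜] (hcomm : ∀ i j : ℤ, ∀ a ∈ 𝒜 i, ∀ b ∈ 𝒜 j,
    a * b = (i * j).negOnePow • (b * a)) {j : ℤ} {b : A} (hb : b ∈ 𝒜 j) :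
    HasOrderLE 𝒜 0 j (LinearMap.mulLeft K b) :=
  ⟨HasDegree.mulLeft hb, fun _ _ ha => mulLeft_gradedComm hcomm ha hb⟩

/-- Graded derivations have order at most `1`. -/
lemma HasOrderLE.of_derivation [SetLike.GradedMonoid 𝒜] (hcomm : ∀ i j : ℤ, ∀ a ∈ 𝒜 i,
    ∀ b ∈ 𝒜 j, a * b = (i * j).negOnePow • (b * a)) {k : ℤ} {d : Module.End K A}
    (hd : HasDegree 𝒜 k d) (hleib : ∀ i : ℤ, ∀ a ∈ 𝒜 i, ∀ b : A,
      d (a * b) = d a * b + (i * k).negOnePow • (a * d b)) : HasOrderLE 𝒜 1 k d := by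
  refine ⟨hd, fun i a ha => ?_⟩
  -- By the Leibniz rule the commutator with `a` is, up to sign, the multiplication by `d a`, which
  -- has order 0.
  have h : gradedComm i k (LinearMap.mulLeft K a) d =
      -((i * k).negOnePow • LinearMap.mulLeft K (d a)) := by
    ext x
    simp only [gradedComm, LinearMap.sub_apply, Module.End.mul_apply, LinearMap.mulLeft_apply,
      LinearMap.neg_apply, LinearMap.smul_apply, hleib i a ha]
    rcases Int.units_eq_one_or (i * k).negOnePow with h' | h' <;> rw [h'] <;> simp
  rw [h]
  exact ((HasOrderLE.mulLeft hcomm (hd i a ha)).units_smul _).neg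

/-- An operator of order `0` is the left multiplication by its value at `1`. -/
lemma HasOrderLE.eq_mulLeft [SetLike.GradedMonoid 𝒜] (hI : DirectSum.IsInternal 𝒜)
    (hcomm : ∀ i j : ℤ, ∀ a ∈ 𝒜 i, ∀ b ∈ 𝒜 j, a * b = (i * j).negOnePow • (b * a)) {k : ℤ}
    {f : Module.End K A} (hf : HasOrderLE 𝒜 0 k f) :
    f 1 ∈ 𝒜 k ∧ f = LinearMap.mulLeft K (f 1) := by
  have h1 : f 1 ∈ 𝒜 k := by simpa using hf.1 0 1 SetLike.GradedOne.one_mem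
  refine ⟨h1, End.ext_homogeneous hI fun j a ha => ?_⟩
  -- Evaluation of [a, f] = 0 at 1 gives f a = ± a (f 1), and graded commutativity absorbs the sign.
  have h := LinearMap.congr_fun (hf.2 j a ha) 1
  have h' := hcomm j k a ha _ h1
  simp only [gradedComm, LinearMap.sub_apply, Module.End.mul_apply, LinearMap.mulLeft_apply,
    LinearMap.zero_apply, LinearMap.smul_apply, mul_one] at h
  rw [LinearMap.mulLeft_apply]
  rw [h', ← smul_sub] at h
  rcases Int.units_eq_one_or (j * k).negOnePow with e | e <;> rw [e] at h <;>
    simp [sub_eq_zero] at h <;> first | exact h | exact h.symm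

/-- The graded commutator of operators of orders `r` and `s` has order at most `r + s - 1`. -/
lemma HasOrderLE.gradedComm [SetLike.GradedMonoid 𝒜] (hI : DirectSum.IsInternal 𝒜)
    (hcomm : ∀ i j : ℤ, ∀ a ∈ 𝒜 i, ∀ b ∈ 𝒜 j, a * b = (i * j).negOnePow • (b * a))
    {n r s : ℕ} {j k : ℤ} {f g : Module.End K A} (hn : r + s = n + 1)
    (hf : HasOrderLE 𝒜 r j f) (hg : HasOrderLE 𝒜 s k g) :
    HasOrderLE 𝒜 n (j + k) (gradedComm j k f g) := by
  induction n generalizing r s j k f g with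
  | zero =>
    -- If one of the orders is 0, that operator is a left multiplication, and the claim is the
    -- definition of the order of the other one.
    rcases r with - | r
    · obtain rfl : s = 1 := by omega
      obtain ⟨h1, h2⟩ := hf.eq_mulLeft hI hcomm
      rw [h2]
      exact hg.2 j _ h1
    · obtain ⟨rfl, rfl⟩ : r = 0 ∧ s = 0 := by omega
      obtain ⟨h1, h2⟩ := hg.eq_mulLeft hI hcomm
      rw [gradedComm_swap, h2]
      exact (((hf.2 k _ h1).congr (add_comm k j)).units_smul _).neg
  | succ n ih =>
    rcases r with - | r
    · obtain rfl : s = n + 2 := by omega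
      obtain ⟨h1, h2⟩ := hf.eq_mulLeft hI hcomm
      rw [h2]
      exact hg.2 j _ h1
    rcases s with - | s
    · obtain rfl : r = n + 1 := by omega
      obtain ⟨h1, h2⟩ := hg.eq_mulLeft hI hcomm
      rw [gradedComm_swap, h2]
      exact (((hf.2 k _ h1).congr (add_comm k j)).units_smul _).neg
    refine ⟨hf.hasDegree.gradedComm hg.hasDegree, fun i a ha => ?_⟩
    -- Both terms [[a, f], g] and ± [f, [a, g]] have total order one less, so the induction
    -- hypothesis applies to them.
    rw [gradedComm_jacobi]
    refine HasOrderLE.add ?_ (HasOrderLE.units_smul ?_ _)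
    · exact (ih (by omega) (hf.2 i a ha) hg).congr (by ring)
    · exact (ih (by omega) hf (hg.2 i a ha)).congr (by ring)

end Order

/-! ## Conjugation by the Weyl element of an `sl₂` action -/

section Weyl

variable {K A : Type*} [Field K] [CharZero K] [Ring A] [Algebra K A] {𝒜 : ℤ → Submodule K A}

/-- The Weyl element `e^{-L} e^Λ e^{-L}`. -/
noncomputable def weylOp (K : Type*) {B : Type*} [Field K] [Ring B] [Algebra K B] (L Λ : B) : B :=
  nilExp K (-L) * nilExp K Λ * nilExp K (-L)

/-- If the Weyl element conjugates `x` into `y`, then `e^{ad Λ} e^{-ad L} x = e^{ad L} y`. -/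
lemma weylOp_conj {B : Type*} [Ring B] [Algebra K B] {L Λ x x' y : B} (hL : IsNilpotent L)
    (hΛ : IsNilpotent Λ) (hx : nilExp K (-L) * x = x' * nilExp K (-L))
    (h : weylOp K L Λ * x = y * weylOp K L Λ) :
    nilExp K (adOp K Λ) x' = nilExp K (adOp K L) y := by
  rw [nilExp_adOp_apply hΛ, nilExp_adOp_apply hL]
  have h1 := nilExp_mul_nilExp_neg (K := K) hL
  have h2 := nilExp_neg_mul_nilExp (K := K) hL
  have h3 := nilExp_mul_nilExp_neg (K := K) hΛ
  have h4 := nilExp_neg_mul_nilExp (K := K) hΛ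
  rw [weylOp, mul_assoc, hx] at h
  generalize nilExp K L = e at *
  generalize nilExp K (-L) = e' at *
  generalize nilExp K Λ = f at *
  generalize nilExp K (-Λ) = f' at *
  calc f * x' * f' = e * (e' * f * (x' * e')) * e * f' := by
        rw [mul_assoc e', ← mul_assoc e, h1, one_mul, ← mul_assoc f, mul_assoc _ e' e, h2, mul_one]
    _ = e * (y * (e' * f * e')) * e * f' := by rw [h]
    _ = e * y * e' * (f * (e' * e) * f') := by simp only [mul_assoc]
    _ = e * y * e' := by rw [h2, mul_one, h3, mul_one]

/-- If the Weyl element conjugates `d` into `y`, and `l = [d, L]` commutes with `L`, then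
`e^{ad Λ} (d + l) = e^{ad L} y`. -/
lemma weylOp_conj_of_comm {B : Type*} [Ring B] [Algebra K B] {L Λ d l y : B} (hL : IsNilpotent L)
    (hΛ : IsNilpotent Λ) (hdL : d * L - L * d = l) (hlL : L * l = l * L)
    (hW : weylOp K L Λ * d = y * weylOp K L Λ) :
    nilExp K (adOp K Λ) (d + l) = nilExp K (adOp K L) y := by
  refine weylOp_conj hL hΛ (nilExp_conj_of_sq hL.neg ?_ ?_) hW
  · rw [← hdL]; noncomm_ring
  · rw [neg_mul, hlL, mul_neg]

/-- If `Λ m - m Λ = c` and `L c - c L = m`, where `m` commutes with `L` and `c` with `Λ`, then the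
Weyl element conjugates `m` into `c`. -/
lemma weylOp_mul_of_comm {B : Type*} [Ring B] [Algebra K B] {L Λ m c : B} (hL : IsNilpotent L)
    (hΛ : IsNilpotent Λ) (hLm : L * m = m * L) (hΛm : Λ * m - m * Λ = c) (hΛc : Λ * c = c * Λ)
    (hLc : L * c - c * L = m) : weylOp K L Λ * m = c * weylOp K L Λ := by
  -- In the representation spanned by m and c, the three factors of W act by m ↦ m, then m ↦ m + c,
  -- then m + c ↦ (m + c) - m = c.
  have h1 : nilExp K (-L) * m = (m + 0) * nilExp K (-L) :=
    nilExp_conj_of_sq hL.neg (by rw [neg_mul, mul_neg, hLm, sub_self]) (by simp)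
  have h2 : nilExp K Λ * m = (m + c) * nilExp K Λ := nilExp_conj_of_sq hΛ hΛm hΛc
  have h3 : nilExp K (-L) * (m + c) = (m + c + -m) * nilExp K (-L) := by
    refine nilExp_conj_of_sq hL.neg ?_ (by rw [neg_mul, mul_neg, mul_neg, neg_mul, hLm])
    rw [neg_mul, mul_neg, mul_add, add_mul, hLm, ← hLc]
    abel
  rw [add_zero] at h1
  rw [weylOp, mul_assoc, h1, ← mul_assoc, mul_assoc (nilExp K (-L)), h2, ← mul_assoc, h3,
    add_neg_cancel_comm]
  simp only [mul_assoc]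

/-- The i-th term of e^{ad f} g has degree k + i d. As d ≠ 0, these degrees are distinct, so a
projection to a homogeneous component picks out a single term. -/
lemma proj_nilExp_adOp {p : ℤ → A →ₗ[K] A}
    (hp : ∀ j k : ℤ, ∀ a ∈ 𝒜 j, p k a = if j = k then a else 0) {f g : Module.End K A}
    (hf : IsNilpotent f) {d k : ℤ} (hd : d ≠ 0) (hfd : HasDegree 𝒜 d f) (hg : HasDegree 𝒜 k g)
    (n : ℕ) {j : ℤ} {a : A} (ha : a ∈ 𝒜 j) :
    p (j + (k + n * d)) (nilExp K (adOp K f) g a) =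
      ((n.factorial : K)⁻¹) • (((adOp K f) ^ n) g) a := by
  obtain ⟨N, hN⟩ := isNilpotent_adOp (K := K) hf
  rw [nilExp_eq_sum (pow_eq_zero_of_le (Nat.le_add_right N (n + 1)) hN), LinearMap.sum_apply,
    LinearMap.sum_apply, map_sum, Finset.sum_eq_single n]
  · rw [LinearMap.smul_apply, LinearMap.smul_apply, map_smul,
      hp _ _ _ (hfd.adOp_pow hg n j a ha), if_pos rfl]
  · intro i _ hi
    rw [LinearMap.smul_apply, LinearMap.smul_apply, map_smul,
      hp _ _ _ (hfd.adOp_pow hg i j a ha), if_neg, smul_zero]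
    intro h
    apply hi
    have h' : (i : ℤ) * d = n * d := by linarith
    exact_mod_cast mul_right_cancel₀ hd h'
  · intro h
    exact absurd (Finset.mem_range.mpr (by omega)) h

lemma proj_nilExp_adOp_eq_zero {p : ℤ → A →ₗ[K] A}
    (hp : ∀ j k : ℤ, ∀ a ∈ 𝒜 j, p k a = if j = k then a else 0) {f g : Module.End K A}
    (hf : IsNilpotent f) {d k e : ℤ} (hfd : HasDegree 𝒜 d f) (hg : HasDegree 𝒜 k g)
    (he : ∀ n : ℕ, k + n * d ≠ e) {j : ℤ} {a : A} (ha : a ∈ 𝒜 j) :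
    p (j + e) (nilExp K (adOp K f) g a) = 0 := by
  obtain ⟨N, hN⟩ := isNilpotent_adOp (K := K) hf
  rw [nilExp_eq_sum hN, LinearMap.sum_apply, LinearMap.sum_apply, map_sum]
  refine Finset.sum_eq_zero fun i _ => ?_
  rw [LinearMap.smul_apply, LinearMap.smul_apply, map_smul,
    hp _ _ _ (hfd.adOp_pow hg i j a ha), if_neg, smul_zero]
  intro h
  exact he i (by linarith)

/-- Let `L` and `Λ` be nilpotent of degrees `2` and `-2`, let `d` have degree `1`, and let
`l = [d, L]` commute with `L`. If the Weyl element conjugates `d` and `l` into operators `y` and `z`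
of degrees `-1` and `-3`, then `[Λ, d] = y + [z, L]` and `[Λ, [Λ, d]] = -2 z`. -/
lemma ad_of_weylOp_conj (hI : DirectSum.IsInternal 𝒜) {L Λ d l y z : Module.End K A}
    (hL : IsNilpotent L) (hΛ : IsNilpotent Λ) (hLd : HasDegree 𝒜 2 L) (hΛd : HasDegree 𝒜 (-2) Λ)
    (hd : HasDegree 𝒜 1 d) (hy : HasDegree 𝒜 (-1) y)
    (hz : HasDegree 𝒜 (-3) z) (hdL : d * L - L * d = l) (hlL : L * l = l * L)
    (hWd : weylOp K L Λ * d = y * weylOp K L Λ) (hWl : weylOp K L Λ * l = z * weylOp K L Λ) :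
    adOp K Λ d = y + (z * L - L * z) ∧ ((adOp K Λ) ^ 2) d = -((2 : K) • z) := by
  obtain ⟨p, hp⟩ := exists_homogeneous_proj hI
  have e1 : nilExp K (adOp K Λ) d + nilExp K (adOp K Λ) l = nilExp K (adOp K L) y := by
    rw [← map_add]
    exact weylOp_conj_of_comm hL hΛ hdL hlL hWd
  -- As `l` commutes with `L`, it can take the place of `d`, with commutator 0 in place of `l`.
  have e2 : nilExp K (adOp K Λ) l = nilExp K (adOp K L) z := by
    have := weylOp_conj_of_comm (l := 0) hL hΛ (by rw [hlL]; exact sub_self _)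
      (by rw [mul_zero, zero_mul]) hWl
    rwa [add_zero] at this
  have two : (-2 : ℤ) ≠ 0 := by norm_num
  have two' : (2 : ℤ) ≠ 0 := by norm_num
  have comp : ∀ (e : ℤ) {j : ℤ} {a : A}, a ∈ 𝒜 j →
      p (j + e) (nilExp K (adOp K Λ) l a) = p (j + e) (nilExp K (adOp K L) z a) ∧
      p (j + e) (nilExp K (adOp K Λ) d a) + p (j + e) (nilExp K (adOp K Λ) l a) =
        p (j + e) (nilExp K (adOp K L) y a) := fun e j a _ => by
    rw [← e1, e2, LinearMap.add_apply, map_add]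
    exact ⟨rfl, rfl⟩
  refine ⟨End.ext_homogeneous hI fun j a ha => ?_, End.ext_homogeneous hI fun j a ha => ?_⟩
  -- In degree -1, the summand `d` contributes [Λ, d], the summand `l` contributes [L, z] by `e2`,
  -- and the right side contributes y.
  · obtain ⟨c1, c2⟩ := comp (-1) ha
    have h1 := proj_nilExp_adOp hp hL two' hLd hz 1 ha
    have h2 := proj_nilExp_adOp hp hΛ two hΛd hd 1 ha
    have h3 := proj_nilExp_adOp hp hL two' hLd hy 0 ha
    norm_num at h1 h2 h3
    rw [c1, h1, h2, h3, adOp_apply L z] at c2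
    rw [LinearMap.add_apply, ← c2, LinearMap.sub_apply, LinearMap.sub_apply]
    abel
  -- In degree -3, the contributions are [Λ, [Λ, d]] / 2 and z on the left, and nothing on the right
  -- because e^{ad L} y has no part of degree below -1.
  · obtain ⟨c1, c2⟩ := comp (-3) ha
    have h1 := proj_nilExp_adOp hp hL two' hLd hz 0 ha
    have h2 := proj_nilExp_adOp hp hΛ two hΛd hd 2 ha
    have h3 := proj_nilExp_adOp_eq_zero (e := -3) hp hL hLd hy
      (fun n => by have := Int.natCast_nonneg n; omega) ha
    norm_num at h1 h2
    rw [c1, h1, h2, h3, one_div] at c2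
    rw [LinearMap.neg_apply, LinearMap.smul_apply, ← add_eq_zero_iff_eq_neg]
    calc _ = (2 : K) • ((2 : K)⁻¹ • ((adOp K Λ) ^ 2) d a + z a) := by
          rw [smul_add, smul_inv_smul₀ two_ne_zero]
      _ = 0 := by rw [c2, smul_zero]

end Weyl


/-! ## The exterior algebra of a Hermitian vector space -/

noncomputable section

section Fibre

variable {E : Type*} [NormedAddCommGroup E] [NormedSpace ℂ E]

/-- The pull-back of forms along the multiplication by `s` on `E`. -/
def scaleExt (s : ℂ) : CxExt E →ₐ[ℂ] CxExt E := pullExt (s • ContinuousLinearMap.id ℂ E)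

/-- The pull-back of covectors along the multiplication by `s` on `E`. -/
def scaleCovector (s : ℂ) : CxCovector E →ₗ[ℂ] CxCovector E :=
  pullCovector (s • ContinuousLinearMap.id ℂ E)

lemma scaleCovector_apply (s : ℂ) (ε : CxCovector E) (v : E) :
    scaleCovector s ε v = ε (s • v) := rfl

lemma covectorJ_apply (ε : CxCovector E) (v : E) : covectorJ ε v = ε (Complex.I • v) := rfl

lemma covectorJ_covectorJ (ε : CxCovector E) : covectorJ (covectorJ ε) = -ε := by
  ext v
  rw [covectorJ_apply, covectorJ_apply, smul_smul, Complex.I_mul_I, neg_one_smul, map_neg]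
  rfl

lemma scaleExt_ι (s : ℂ) (ε : CxCovector E) :
    scaleExt s (ExteriorAlgebra.ι ℂ ε) = ExteriorAlgebra.ι ℂ (scaleCovector s ε) :=
  pullExt_ι _ _

lemma scaleExt_I_ι (ε : CxCovector E) :
    scaleExt Complex.I (ExteriorAlgebra.ι ℂ ε) = ExteriorAlgebra.ι ℂ (covectorJ ε) :=
  pullExt_ι _ _

lemma scaleExt_scaleExt (s t : ℂ) (a : CxExt E) :
    scaleExt s (scaleExt t a) = scaleExt (s * t) a := by
  rw [scaleExt, scaleExt, scaleExt, ← pullExt_comp]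
  congr 1
  ext v
  simp [smul_smul]

lemma scaleExt_one (a : CxExt E) : scaleExt 1 a = a := by
  rw [scaleExt, one_smul, pullExt_id]

lemma scaleExt_pull (s : ℂ) (T : E →L[ℂ] E) (a : CxExt E) :
    scaleExt s (pullExt T a) = pullExt T (scaleExt s a) := by
  rw [scaleExt, ← pullExt_comp, ← pullExt_comp]
  congr 1
  ext v
  simp

lemma contraction_ι (g : E →L[ℝ] E →L[ℝ] ℝ) (ε : CxCovector E) (a : CxExt E) :
    contraction g (ExteriorAlgebra.ι ℂ ε) a = CliffordAlgebra.contractLeft (cometric g ε) a := by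
  simp only [contraction, ExteriorAlgebra.lift_ι_apply]
  rfl

lemma cometric_realCovector {g : E →L[ℝ] E →L[ℝ] ℝ} (hg : g.IsInvertible) (v : E)
    (η : CxCovector E) : cometric g (realCovector (g v)) η = η v := by
  have h1 : Complex.reCLM.comp (realCovector (g v)) = g v := by
    ext w; simp [realCovector]
  have h2 : Complex.imCLM.comp (realCovector (g v)) = 0 := by
    ext w; simp [realCovector]
  change η (g.inverse (Complex.reCLM.comp (realCovector (g v)))) +
    Complex.I * η (g.inverse (Complex.imCLM.comp (realCovector (g v)))) = η v
  rw [h1, h2, inverse_apply_of_eq hg rfl, map_zero, map_zero, mul_zero, add_zero]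

lemma ι_mem_exteriorPower (ε : CxCovector E) :
    ExteriorAlgebra.ι ℂ ε ∈ (⋀[ℂ]^1 (CxCovector E) : Submodule ℂ (CxExt E)) := by
  change _ ∈ LinearMap.range (ExteriorAlgebra.ι ℂ) ^ 1
  rw [pow_one]
  exact ⟨ε, rfl⟩

lemma ι_mul_ι_comm (α β ε : CxCovector E) :
    ExteriorAlgebra.ι ℂ α * ExteriorAlgebra.ι ℂ β * ExteriorAlgebra.ι ℂ ε =
      ExteriorAlgebra.ι ℂ ε * (ExteriorAlgebra.ι ℂ α * ExteriorAlgebra.ι ℂ β) := by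
  have h : ∀ x y : CxCovector E, (ExteriorAlgebra.ι ℂ x * ExteriorAlgebra.ι ℂ y : CxExt E) =
      -(ExteriorAlgebra.ι ℂ y * ExteriorAlgebra.ι ℂ x) := fun x y =>
    eq_neg_of_add_eq_zero_left (ExteriorAlgebra.ι_add_mul_swap _ _)
  rw [mul_assoc, h β ε, mul_neg, ← mul_assoc, h α ε, neg_mul, neg_neg, mul_assoc]

lemma conjCovector_realCovector (ρ : E →L[ℝ] ℝ) :
    conjCovector (realCovector ρ) = realCovector ρ := by
  ext v; simp [conjCovector, realCovector]

lemma conjForm_sum {ι : Type*} (t : Finset ι) (f : ι → CxExt E) :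
    conjForm (∑ i ∈ t, f i) = ∑ i ∈ t, conjForm (f i) :=
  map_sum conjExt f t

variable [FiniteDimensional ℂ E]

/-- The complex covectors dual to the chosen real basis of `E`. -/
def dualCovector (i : Fin (Module.finrank ℝ E)) : CxCovector E :=
  realCovector (LinearMap.toContinuousLinearMap ((Module.finBasis ℝ E).coord i))

lemma dualCovector_apply (i : Fin (Module.finrank ℝ E)) (v : E) :
    dualCovector i v = (((Module.finBasis ℝ E).coord i v : ℝ) : ℂ) := rfl

lemma apply_eq_sum_coord {F : Type*} [AddCommGroup F] [Module ℝ F] (f : E →ₗ[ℝ] F) (v : E) :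
    f v = ∑ i, (Module.finBasis ℝ E).coord i v • f (Module.finBasis ℝ E i) := by
  conv_lhs => rw [← (Module.finBasis ℝ E).sum_repr v, map_sum]
  exact Finset.sum_congr rfl fun k _ => by rw [map_smul]; rfl

lemma covector_expand (ε : CxCovector E) :
    ∑ i, ε (Module.finBasis ℝ E i) • dualCovector i = ε := by
  ext v
  have := apply_eq_sum_coord (ε : E →ₗ[ℝ] ℂ) v
  rw [sum_apply]
  refine Eq.trans (Finset.sum_congr rfl fun i _ => ?_) this.symm
  rw [Complex.real_smul, mul_comm]
  rfl

/-- The real covector `ω(e_i, ·) = g(J e_i, ·)`, as a complex covector. -/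
def rotCovector (g : E →L[ℝ] E →L[ℝ] ℝ) (i : Fin (Module.finrank ℝ E)) : CxCovector E :=
  realCovector (g (Complex.I • Module.finBasis ℝ E i))

lemma fundamentalElt_eq (g : E →L[ℝ] E →L[ℝ] ℝ) : fundamentalElt g =
    (2⁻¹ : ℂ) • ∑ i, ExteriorAlgebra.ι ℂ (dualCovector i) * ExteriorAlgebra.ι ℂ (rotCovector g i) :=
  rfl

/-- The covectors dual to a real basis span. The upper bound is all that is needed for forms of
degree above 2 n to vanish. -/
lemma finrank_cxCovector_le : Module.finrank ℂ (CxCovector E) ≤ 2 * Module.finrank ℂ E := by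
  have htop : Submodule.span ℂ (Set.range (dualCovector (E := E))) = ⊤ := by
    refine eq_top_iff.mpr fun ε _ => ?_
    rw [← covector_expand ε]
    exact sum_mem fun i _ => Submodule.smul_mem _ _ (Submodule.subset_span ⟨i, rfl⟩)
  have h := finrank_range_le_card (R := ℂ) (dualCovector (E := E))
  rw [Set.finrank, htop, finrank_top, Fintype.card_fin, finrank_real_of_complex] at h
  exact h

lemma exteriorPower_eq_bot {k : ℕ} (hk : 2 * Module.finrank ℂ E < k) :
    (⋀[ℂ]^k (CxCovector E) : Submodule ℂ (CxExt E)) = ⊥ := by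
  rw [← Submodule.finrank_eq_zero, exteriorPower.finrank_eq]
  exact Nat.choose_eq_zero_of_lt (finrank_cxCovector_le.trans_lt hk)

lemma fundamentalElt_mem (g : E →L[ℝ] E →L[ℝ] ℝ) :
    fundamentalElt g ∈ (⋀[ℂ]^2 (CxCovector E) : Submodule ℂ (CxExt E)) := by
  rw [fundamentalElt_eq]
  refine Submodule.smul_mem _ _ (sum_mem fun i _ => ?_)
  exact SetLike.mul_mem_graded (A := fun i : ℕ => ⋀[ℂ]^i (CxCovector E))
    (ι_mem_exteriorPower _) (ι_mem_exteriorPower _)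

/-- The degree 2 n + 2 exceeds the real dimension. This makes L and Λ nilpotent with an exponent
that does not depend on the point. -/
lemma fundamentalElt_pow_eq_zero (g : E →L[ℝ] E →L[ℝ] ℝ) :
    fundamentalElt g ^ (Module.finrank ℂ E + 1) = 0 := by
  have h := SetLike.pow_mem_graded (A := fun i : ℕ => ⋀[ℂ]^i (CxCovector E))
    (Module.finrank ℂ E + 1) (fundamentalElt_mem g)
  rw [exteriorPower_eq_bot (by rw [smul_eq_mul]; omega)] at h
  exact h

lemma fundamentalElt_mul_ι (g : E →L[ℝ] E →L[ℝ] ℝ) (ε : CxCovector E) :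
    fundamentalElt g * ExteriorAlgebra.ι ℂ ε = ExteriorAlgebra.ι ℂ ε * fundamentalElt g := by
  rw [fundamentalElt_eq, smul_mul_assoc, mul_smul_comm, Finset.sum_mul, Finset.mul_sum]
  simp only [ι_mul_ι_comm]

lemma reverse_fundamentalElt (g : E →L[ℝ] E →L[ℝ] ℝ) :
    CliffordAlgebra.reverse (fundamentalElt g) = -fundamentalElt g := by
  rw [fundamentalElt_eq, map_smul, map_sum, ← smul_neg, ← Finset.sum_neg_distrib]
  congr 1
  refine Finset.sum_congr rfl fun i _ => ?_
  rw [CliffordAlgebra.reverse.map_mul, reverse_ι', reverse_ι']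
  exact eq_neg_of_add_eq_zero_left (ExteriorAlgebra.ι_add_mul_swap _ _)

lemma conjForm_fundamentalElt (g : E →L[ℝ] E →L[ℝ] ℝ) :
    conjForm (fundamentalElt g) = fundamentalElt g := by
  rw [fundamentalElt, conjForm_smul, conjForm_sum]
  simp only [conjForm_mul, conjForm_ι, conjCovector_realCovector]
  rw [map_inv₀, map_ofNat]

/-- The form ω is real, and reversal changes the sign of a 2-form; so Λ is minus the contraction
with ω. -/
lemma wedgeAdjoint_fundamentalElt (g : E →L[ℝ] E →L[ℝ] ℝ) :
    wedgeAdjoint g (fundamentalElt g) = contraction g (-fundamentalElt g) := by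
  rw [wedgeAdjoint, conjForm_fundamentalElt, reverse_fundamentalElt]

variable {g : E →L[ℝ] E →L[ℝ] ℝ}

lemma sum_apply_rot (ε : CxCovector E) :
    ∑ i, ε (Complex.I • Module.finBasis ℝ E i) • dualCovector i = covectorJ ε :=
  covector_expand (covectorJ ε)

lemma cometric_rotCovector (hg : g.IsInvertible) (i : Fin (Module.finrank ℝ E))
    (η : CxCovector E) :
    cometric g (rotCovector g i) η = η (Complex.I • Module.finBasis ℝ E i) :=
  cometric_realCovector hg _ η

/-- The sum is the covector g(J ε♯, ·), extended complex linearly in ε. Since J is skew for g, this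
is -g(ε♯, J ·) = -ε ∘ J. -/
lemma sum_cometric_dual (hg : g.IsInvertible)
    (hJ : ∀ v w, g (Complex.I • v) (Complex.I • w) = g v w) (ε : CxCovector E) :
    ∑ i, cometric g ε (dualCovector i) • rotCovector g i = -covectorJ ε := by
  ext v
  set a := g.inverse (Complex.reCLM.comp ε) with ha
  set b := g.inverse (Complex.imCLM.comp ε) with hb
  have hsum : ∀ a : E, ∑ i, (((Module.finBasis ℝ E).coord i a : ℝ) : ℂ) * rotCovector g i v =
      ((g (Complex.I • a) v : ℝ) : ℂ) := fun a => by
    let f : E →ₗ[ℝ] ℝ :=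
      { toFun := fun a => g (Complex.I • a) v
        map_add' := fun x y => by rw [smul_add, map_add, add_apply]
        map_smul' := fun c x => by rw [smul_comm, map_smul]; rfl }
    have h := apply_eq_sum_coord f a
    change g (Complex.I • a) v = _ at h
    rw [h, Complex.ofReal_sum]
    refine Finset.sum_congr rfl fun i _ => ?_
    rw [smul_eq_mul, Complex.ofReal_mul]
    rfl
  have hI : ∀ x : E, g (Complex.I • x) v = -g x (Complex.I • v) := fun x => by
    have := hJ x (Complex.I • v)
    rw [smul_smul, Complex.I_mul_I, neg_one_smul, map_neg] at this
    linarith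
  have hga : g a (Complex.I • v) = (ε (Complex.I • v)).re := by
    rw [ha, apply_inverse hg]; rfl
  have hgb : g b (Complex.I • v) = (ε (Complex.I • v)).im := by
    rw [hb, apply_inverse hg]; rfl
  have hc : ∀ i, cometric g ε (dualCovector i) = (((Module.finBasis ℝ E).coord i a : ℝ) : ℂ) +
      Complex.I * (((Module.finBasis ℝ E).coord i b : ℝ) : ℂ) := fun i => rfl
  simp only [sum_apply, smul_apply, hc, smul_eq_mul, add_mul, Finset.sum_add_distrib, mul_assoc,
    ← Finset.mul_sum, hsum, hI, hga, hgb]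
  rw [neg_apply, covectorJ_apply]
  conv_rhs => rw [← Complex.re_add_im (ε (Complex.I • v))]
  push_cast
  ring

/-- The commutator of the contraction with `ω` and an exterior multiplication. -/
lemma contraction_fundamentalElt_ι_mul (hg : g.IsInvertible) (hsymm : ∀ v w, g v w = g w v)
    (hJ : ∀ v w, g (Complex.I • v) (Complex.I • w) = g v w) (ε : CxCovector E) (a : CxExt E) :
    contraction g (fundamentalElt g) (ExteriorAlgebra.ι ℂ ε * a) =
      ExteriorAlgebra.ι ℂ ε * contraction g (fundamentalElt g) a +
        contraction g (ExteriorAlgebra.ι ℂ (covectorJ ε)) a := by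
  have hterm : ∀ i, contraction g (ExteriorAlgebra.ι ℂ (dualCovector i) *
      ExteriorAlgebra.ι ℂ (rotCovector g i)) (ExteriorAlgebra.ι ℂ ε * a) =
      ExteriorAlgebra.ι ℂ ε * contraction g (ExteriorAlgebra.ι ℂ (dualCovector i) *
        ExteriorAlgebra.ι ℂ (rotCovector g i)) a +
      contraction g (ExteriorAlgebra.ι ℂ (ε (Complex.I • Module.finBasis ℝ E i) •
        dualCovector i)) a -
      contraction g (ExteriorAlgebra.ι ℂ (cometric g ε (dualCovector i) • rotCovector g i)) a := by
    intro i
    rw [contraction_ι_mul, contraction_ι_mul, contraction_ι, contraction_ι, contractLeft_ι_mul',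
      map_sub, contractLeft_ι_mul', map_smul, cometric_rotCovector hg,
      cometric_comm hg hsymm (dualCovector i) ε]
    simp only [map_smul, LinearMap.smul_apply, contraction_ι]
    abel
  have hω : ∀ b : CxExt E, contraction g (fundamentalElt g) b = (2⁻¹ : ℂ) • ∑ i,
      contraction g (ExteriorAlgebra.ι ℂ (dualCovector i) *
        ExteriorAlgebra.ι ℂ (rotCovector g i)) b := fun b => by
    rw [fundamentalElt_eq, map_smul, map_sum, LinearMap.smul_apply, LinearMap.sum_apply]
  have hs : ∀ (c : Fin (Module.finrank ℝ E) → CxCovector E),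
      ∑ i, contraction g (ExteriorAlgebra.ι ℂ (c i)) a =
        contraction g (ExteriorAlgebra.ι ℂ (∑ i, c i)) a := fun c => by
    rw [map_sum, map_sum, LinearMap.sum_apply]
  rw [hω, hω]
  simp only [hterm, Finset.sum_sub_distrib, Finset.sum_add_distrib, hs, sum_apply_rot,
    sum_cometric_dual hg hJ, ← Finset.mul_sum]
  -- The correction terms from the two factors of each summand of ω have equal sums; together they
  -- cancel the factor 1/2 of ω.
  rw [map_neg, map_neg, LinearMap.neg_apply, sub_neg_eq_add, add_assoc, smul_add, mul_smul_comm,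
    ← two_smul ℂ, inv_smul_smul₀ two_ne_zero]

/-- The commutator of the multiplication by `ω` and a contraction. -/
lemma contraction_ι_fundamentalElt_mul (hg : g.IsInvertible) (hsymm : ∀ v w, g v w = g w v)
    (hJ : ∀ v w, g (Complex.I • v) (Complex.I • w) = g v w) (ε : CxCovector E) (a : CxExt E) :
    contraction g (ExteriorAlgebra.ι ℂ ε) (fundamentalElt g * a) =
      fundamentalElt g * contraction g (ExteriorAlgebra.ι ℂ ε) a -
        ExteriorAlgebra.ι ℂ (covectorJ ε) * a := by
  have hterm : ∀ i, contraction g (ExteriorAlgebra.ι ℂ ε) (ExteriorAlgebra.ι ℂ (dualCovector i) *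
      ExteriorAlgebra.ι ℂ (rotCovector g i) * a) =
      ExteriorAlgebra.ι ℂ (dualCovector i) * ExteriorAlgebra.ι ℂ (rotCovector g i) *
        contraction g (ExteriorAlgebra.ι ℂ ε) a +
      ExteriorAlgebra.ι ℂ (cometric g ε (dualCovector i) • rotCovector g i) * a -
      ExteriorAlgebra.ι ℂ (ε (Complex.I • Module.finBasis ℝ E i) • dualCovector i) * a := by
    intro i
    rw [mul_assoc, contraction_ι, contractLeft_ι_mul', contractLeft_ι_mul',
      cometric_comm hg hsymm ε (rotCovector g i), cometric_rotCovector hg,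
      contraction_ι, mul_sub, mul_smul_comm, map_smul (ExteriorAlgebra.ι ℂ), map_smul (ExteriorAlgebra.ι ℂ), smul_mul_assoc, smul_mul_assoc,
      mul_assoc]
    abel
  rw [fundamentalElt_eq, smul_mul_assoc, smul_mul_assoc, Finset.sum_mul, Finset.sum_mul, map_smul,
    map_sum]
  simp only [hterm, Finset.sum_sub_distrib, Finset.sum_add_distrib, ← Finset.sum_mul, ← map_sum,
    sum_apply_rot, sum_cometric_dual hg hJ]
  rw [map_neg, neg_mul, add_sub_assoc, ← neg_add', ← two_smul ℂ, smul_add, smul_neg,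
    inv_smul_smul₀ two_ne_zero, ← sub_eq_add_neg]

end Fibre

end


/-! ### The Weyl element and the Hodge star -/

noncomputable section

section FibreWeyl

variable {E : Type*} [NormedAddCommGroup E] [NormedSpace ℂ E] [FiniteDimensional ℂ E]
  {g : E →L[ℝ] E →L[ℝ] ℝ}

lemma neg_mulLeft {A : Type*} [Ring A] [Algebra ℂ A] (a : A) :
    -LinearMap.mulLeft ℂ a = LinearMap.mulLeft ℂ (-a) := by
  ext b; simp

lemma neg_pow_eq_smul {A : Type*} [Ring A] [Algebra ℂ A] (a : A) (k : ℕ) :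
    (-a) ^ k = ((-1) ^ k : ℂ) • a ^ k := by
  rw [← neg_one_smul ℂ a, smul_pow]

lemma mulLeft_fundamentalElt_pow_eq_zero (g : E →L[ℝ] E →L[ℝ] ℝ) :
    LinearMap.mulLeft ℂ (fundamentalElt g) ^ (Module.finrank ℂ E + 1) = 0 := by
  rw [LinearMap.pow_mulLeft, fundamentalElt_pow_eq_zero, LinearMap.mulLeft_zero_eq_zero]

lemma neg_fundamentalElt_pow_eq_zero (g : E →L[ℝ] E →L[ℝ] ℝ) :
    (-fundamentalElt g) ^ (Module.finrank ℂ E + 1) = 0 := by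
  rw [neg_pow, fundamentalElt_pow_eq_zero, mul_zero]

lemma wedgeAdjoint_fundamentalElt_pow_eq_zero (g : E →L[ℝ] E →L[ℝ] ℝ) :
    wedgeAdjoint g (fundamentalElt g) ^ (Module.finrank ℂ E + 1) = 0 := by
  rw [wedgeAdjoint_fundamentalElt, ← map_pow, neg_fundamentalElt_pow_eq_zero, map_zero]

/-- The Weyl element of the Lefschetz `sl₂` action on the exterior algebra. -/
def weylExt (g : E →L[ℝ] E →L[ℝ] ℝ) : Module.End ℂ (CxExt E) :=
  weylOp ℂ (LinearMap.mulLeft ℂ (fundamentalElt g)) (wedgeAdjoint g (fundamentalElt g))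

/-- The Weyl element turns exterior multiplications into contractions. -/
lemma weylExt_mul_mulLeft (hg : g.IsInvertible) (hsymm : ∀ v w, g v w = g w v)
    (hJ : ∀ v w, g (Complex.I • v) (Complex.I • w) = g v w) (a : CxExt E) :
    weylExt g * LinearMap.mulLeft ℂ (scaleExt Complex.I a) = contraction g a * weylExt g := by
  -- The multiplication by ε ∘ J and the contraction with ε♯ satisfy the hypotheses of
  -- `weylOp_mul_of_comm`. The general case follows because multiplication and contraction are both
  -- multiplicative in the form.
  have hι : ∀ ε : CxCovector E,
      weylExt g * LinearMap.mulLeft ℂ (ExteriorAlgebra.ι ℂ (covectorJ ε)) =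
        contraction g (ExteriorAlgebra.ι ℂ ε) * weylExt g := fun ε => by
    refine weylOp_mul_of_comm ⟨_, mulLeft_fundamentalElt_pow_eq_zero g⟩
      ⟨_, wedgeAdjoint_fundamentalElt_pow_eq_zero g⟩ ?_ ?_ ?_ ?_
    · refine LinearMap.ext fun b => ?_
      change fundamentalElt g * (ExteriorAlgebra.ι ℂ (covectorJ ε) * b) =
        ExteriorAlgebra.ι ℂ (covectorJ ε) * (fundamentalElt g * b)
      rw [← mul_assoc, fundamentalElt_mul_ι, mul_assoc]
    · refine LinearMap.ext fun b => ?_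
      rw [wedgeAdjoint_fundamentalElt, map_neg]
      change -contraction g (fundamentalElt g) (ExteriorAlgebra.ι ℂ (covectorJ ε) * b) -
        ExteriorAlgebra.ι ℂ (covectorJ ε) * -contraction g (fundamentalElt g) b = _
      rw [contraction_fundamentalElt_ι_mul hg hsymm hJ, covectorJ_covectorJ, map_neg, map_neg,
        LinearMap.neg_apply, mul_neg]
      abel
    · rw [wedgeAdjoint_fundamentalElt, ← map_mul, ← map_mul, neg_mul, fundamentalElt_mul_ι,
        mul_neg]
    · refine LinearMap.ext fun b => ?_
      change fundamentalElt g * contraction g (ExteriorAlgebra.ι ℂ ε) b -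
        contraction g (ExteriorAlgebra.ι ℂ ε) (fundamentalElt g * b) = _ * b
      rw [contraction_ι_fundamentalElt_mul hg hsymm hJ]
      abel
  induction a using CxExt.induction with
  | h0 c =>
    refine LinearMap.ext fun b => ?_
    rw [AlgHom.commutes, AlgHom.commutes]
    change weylExt g (algebraMap ℂ (CxExt E) c * b) = c • weylExt g b
    rw [← Algebra.smul_def, map_smul]
  | h1 a b ha hb =>
    rw [map_add, map_add, add_mul, ← ha, ← hb, ← mul_add]
    congr 1
    exact LinearMap.ext fun x => add_mul _ _ x
  | h2 a ε ha =>
    rw [map_mul, map_mul, scaleExt_I_ι, LinearMap.mulLeft_mul]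
    change weylExt g * (_ * _) = _
    rw [← mul_assoc, hι, mul_assoc, ha, mul_assoc]

/-- This is the sl₂ relation [H, L] = 2 L for H = [i_ω, L] = -[Λ, L], where i_ω is the contraction
with ω. Multiplication by a covector raises the weight of H by one, and ω is a sum of products of
two covectors. -/
lemma wedgeAdjoint_fundamentalElt_comm_mul (hg : g.IsInvertible) (hsymm : ∀ v w, g v w = g w v)
    (hJ : ∀ v w, g (Complex.I • v) (Complex.I • w) = g v w) (a : CxExt E) :
    contraction g (fundamentalElt g) (fundamentalElt g * (fundamentalElt g * a)) -
        fundamentalElt g * contraction g (fundamentalElt g) (fundamentalElt g * a) =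
      fundamentalElt g * (contraction g (fundamentalElt g) (fundamentalElt g * a) -
        fundamentalElt g * contraction g (fundamentalElt g) a) +
        (2 : ℂ) • (fundamentalElt g * a) := by
  set w := fundamentalElt g with hw
  have hι : ∀ (ε : CxCovector E) (a : CxExt E),
      contraction g w (w * (ExteriorAlgebra.ι ℂ ε * a)) -
        w * contraction g w (ExteriorAlgebra.ι ℂ ε * a) =
      ExteriorAlgebra.ι ℂ ε * (contraction g w (w * a) - w * contraction g w a) +
        ExteriorAlgebra.ι ℂ ε * a := fun ε a => by
    rw [← mul_assoc, hw, fundamentalElt_mul_ι, mul_assoc, contraction_fundamentalElt_ι_mul hg hsymm hJ,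
      contraction_fundamentalElt_ι_mul hg hsymm hJ, contraction_ι_fundamentalElt_mul hg hsymm hJ,
      covectorJ_covectorJ, map_neg, mul_add, ← mul_assoc (fundamentalElt g), fundamentalElt_mul_ι,
      mul_sub, mul_assoc, neg_mul]
    abel
  have hlin : ∀ (c : ℂ) (x : CxExt E), contraction g w (w * (c • x)) -
      w * contraction g w (c • x) = c • (contraction g w (w * x) - w * contraction g w x) := by
    intro c x
    rw [mul_smul_comm, map_smul, map_smul, mul_smul_comm, smul_sub]
  have hsum : ∀ (x : Fin (Module.finrank ℝ E) → CxExt E), contraction g w (w * (∑ i, x i)) -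
      w * contraction g w (∑ i, x i) =
        ∑ i, (contraction g w (w * x i) - w * contraction g w (x i)) := by
    intro x
    rw [Finset.mul_sum, map_sum, map_sum, Finset.mul_sum, Finset.sum_sub_distrib]
  have hexp : ∀ b : CxExt E, w * b = (2⁻¹ : ℂ) • ∑ i, ExteriorAlgebra.ι ℂ (dualCovector i) *
      (ExteriorAlgebra.ι ℂ (rotCovector g i) * b) := fun b => by
    rw [hw, fundamentalElt_eq, smul_mul_assoc, Finset.sum_mul]
    simp only [mul_assoc]
  have e : contraction g w (w * (w * a)) - w * contraction g w (w * a) = (2⁻¹ : ℂ) • ∑ i,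
      (ExteriorAlgebra.ι ℂ (dualCovector i) * (ExteriorAlgebra.ι ℂ (rotCovector g i) *
        (contraction g w (w * a) - w * contraction g w a)) +
      (2 : ℂ) • (ExteriorAlgebra.ι ℂ (dualCovector i) *
        (ExteriorAlgebra.ι ℂ (rotCovector g i) * a))) := by
    conv_lhs => rw [hexp a, hlin, hsum]
    congr 1
    refine Finset.sum_congr rfl fun i _ => ?_
    rw [hι, hι, mul_add, two_smul, add_assoc]
  rw [e, Finset.sum_add_distrib, smul_add, ← hexp, ← Finset.smul_sum, smul_comm, ← hexp]

/-- Each of the 2 n summands e^i ∧ ω(e_i, ·) contributes -1: contracting ω with ω(e_i, ·)♯ gives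
-g(e_i, ·), whose pairing with e^i is -1. The factor 1/2 of ω turns -2 n into -n. -/
lemma contraction_fundamentalElt_self (hg : g.IsInvertible) (hsymm : ∀ v w, g v w = g w v)
    (hJ : ∀ v w, g (Complex.I • v) (Complex.I • w) = g v w) :
    contraction g (fundamentalElt g) (fundamentalElt g) =
      algebraMap ℂ (CxExt E) (-(Module.finrank ℂ E : ℂ)) := by
  have hrot : ∀ i, covectorJ (rotCovector g i) = realCovector (g (Module.finBasis ℝ E i)) := by
    intro i
    ext v
    rw [covectorJ_apply]
    exact congrArg Complex.ofReal (hJ _ _)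
  have h1 : ∀ i, contraction g (ExteriorAlgebra.ι ℂ (dualCovector i) *
      ExteriorAlgebra.ι ℂ (rotCovector g i)) (fundamentalElt g) = algebraMap ℂ (CxExt E) (-1) := by
    intro i
    have h := contraction_ι_fundamentalElt_mul hg hsymm hJ (rotCovector g i) 1
    have h0 : contraction g (ExteriorAlgebra.ι ℂ (rotCovector g i)) 1 = 0 := by
      rw [contraction_ι]; exact CliffordAlgebra.contractLeft_one _ _
    rw [mul_one, h0, mul_zero, zero_sub, mul_one, hrot] at h
    rw [map_mul, Module.End.mul_apply, h, map_neg, contraction_ι, map_neg]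
    congr 1
    refine Eq.trans (CliffordAlgebra.contractLeft_ι _ _ _) ?_
    rw [cometric_comm hg hsymm, cometric_realCovector hg, dualCovector_apply, Module.Basis.coord_apply,
      Module.Basis.repr_self, Finsupp.single_eq_same, Complex.ofReal_one]
  have h2 : ∀ b : CxExt E, contraction g (fundamentalElt g) b = (2⁻¹ : ℂ) • ∑ i,
      contraction g (ExteriorAlgebra.ι ℂ (dualCovector i) *
        ExteriorAlgebra.ι ℂ (rotCovector g i)) b := fun b => by
    rw [fundamentalElt_eq, map_smul, map_sum, LinearMap.smul_apply, LinearMap.sum_apply]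
  rw [h2]
  simp only [h1]
  rw [Finset.sum_const, Finset.card_univ, Fintype.card_fin, finrank_real_of_complex,
    ← Nat.cast_smul_eq_nsmul ℂ, smul_smul, Algebra.smul_def, ← map_mul]
  congr 1
  push_cast
  ring

/-- `Λ ω^{k+1} = (k + 1) (n - k) ω^k`. -/
lemma wedgeAdjoint_fundamentalElt_pow (hg : g.IsInvertible) (hsymm : ∀ v w, g v w = g w v)
    (hJ : ∀ v w, g (Complex.I • v) (Complex.I • w) = g v w) (k : ℕ) :
    wedgeAdjoint g (fundamentalElt g) (fundamentalElt g ^ (k + 1)) =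
      (((k : ℂ) + 1) * ((Module.finrank ℂ E : ℂ) - k)) • fundamentalElt g ^ k := by
  set w := fundamentalElt g with hw
  -- The power ω^k has weight 2 k - n for H = [i_ω, L]: the weight of 1 is -n, and each factor ω
  -- adds 2.
  have hcomm : ∀ k : ℕ, contraction g w (w * w ^ k) - w * contraction g w (w ^ k) =
      (2 * (k : ℂ) - (Module.finrank ℂ E : ℂ)) • w ^ k := by
    intro k
    induction k with
    | zero =>
      have h0 : contraction g w 1 = 0 := by
        have h1 : ∀ i, contraction g (ExteriorAlgebra.ι ℂ (dualCovector i) *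
            ExteriorAlgebra.ι ℂ (rotCovector g i)) 1 = 0 := fun i => by
          rw [contraction_ι_mul, contraction_ι, show CliffordAlgebra.contractLeft
            (cometric g (rotCovector g i)) (1 : CxExt E) = 0 from
              CliffordAlgebra.contractLeft_one _ _, map_zero]
        rw [hw, fundamentalElt_eq, map_smul, map_sum, LinearMap.smul_apply, LinearMap.sum_apply]
        simp only [h1, Finset.sum_const_zero, smul_zero]
      rw [pow_zero, mul_one, h0, mul_zero, sub_zero, hw,
        contraction_fundamentalElt_self hg hsymm hJ, Algebra.algebraMap_eq_smul_one]
      simp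
    | succ k ih =>
      rw [pow_succ', wedgeAdjoint_fundamentalElt_comm_mul hg hsymm hJ, ih, mul_smul_comm,
        ← add_smul]
      congr 1
      push_cast
      ring
  have hneg : ∀ b, wedgeAdjoint g w b = -contraction g w b := fun b => by
    rw [hw, wedgeAdjoint_fundamentalElt, map_neg, LinearMap.neg_apply]
  induction k with
  | zero =>
    rw [hneg, zero_add, pow_one, hw, contraction_fundamentalElt_self hg hsymm hJ, pow_zero,
      ← Algebra.algebraMap_eq_smul_one, ← map_neg]
    congr 1
    push_cast
    ring
  | succ k ih =>
    rw [hneg, neg_eq_iff_eq_neg] at ih ⊢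
    rw [pow_succ' w (k + 1), sub_eq_iff_eq_add.mp (hcomm (k + 1)), ih, mul_neg,
      mul_smul_comm, ← pow_succ', ← neg_smul, ← neg_smul, ← add_smul]
    congr 1
    push_cast
    ring

/-- The volume form `ω^n / n!`. -/
def volElt (g : E →L[ℝ] E →L[ℝ] ℝ) : CxExt E :=
  (((Module.finrank ℂ E).factorial : ℂ)⁻¹) • fundamentalElt g ^ Module.finrank ℂ E

/-- Iteration of `wedgeAdjoint_fundamentalElt_pow` downwards from ω^n; the variable m stands for n -
j and avoids truncated subtraction. -/
lemma wedgeAdjoint_pow_volElt (hg : g.IsInvertible) (hsymm : ∀ v w, g v w = g w v)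
    (hJ : ∀ v w, g (Complex.I • v) (Complex.I • w) = g v w) (j m : ℕ)
    (hjm : m + j = Module.finrank ℂ E) :
    (wedgeAdjoint g (fundamentalElt g) ^ j) (volElt g) =
      ((j.factorial : ℂ) * (m.factorial : ℂ)⁻¹) • fundamentalElt g ^ m := by
  induction j generalizing m with
  | zero =>
    obtain rfl : m = Module.finrank ℂ E := by omega
    simp [volElt]
  | succ j ih =>
    rw [pow_succ', Module.End.mul_apply, ih (m + 1) (by omega), map_smul,
      wedgeAdjoint_fundamentalElt_pow hg hsymm hJ, smul_smul, ← hjm]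
    congr 1
    have h1 : ((m.factorial : ℕ) : ℂ) ≠ 0 := by exact_mod_cast m.factorial_ne_zero
    have h2 : (m : ℂ) + 1 ≠ 0 := by exact_mod_cast m.succ_ne_zero
    rw [Nat.factorial_succ, Nat.factorial_succ]
    push_cast
    field_simp
    ring

/-- The Weyl element maps `1` to the volume form, up to sign. -/
lemma weylExt_one (hg : g.IsInvertible) (hsymm : ∀ v w, g v w = g w v)
    (hJ : ∀ v w, g (Complex.I • v) (Complex.I • w) = g v w) :
    weylExt g 1 = ((-1) ^ Module.finrank ℂ E : ℂ) • volElt g := by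
  set n := Module.finrank ℂ E with hn
  set w := fundamentalElt g with hw
  have hL : ∀ b, nilExp ℂ (-LinearMap.mulLeft ℂ w) b =
      ∑ k ∈ Finset.range (n + 1), ((k.factorial : ℂ)⁻¹) • ((-w) ^ k * b) := fun b => by
    rw [neg_mulLeft, nilExp_eq_sum (k := n + 1), LinearMap.sum_apply]
    · simp only [LinearMap.pow_mulLeft]; rfl
    · rw [LinearMap.pow_mulLeft, hw, neg_fundamentalElt_pow_eq_zero,
        LinearMap.mulLeft_zero_eq_zero]
  have hnil : IsNilpotent (wedgeAdjoint g w) := ⟨_, wedgeAdjoint_fundamentalElt_pow_eq_zero g⟩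
  have hneg : -wedgeAdjoint g w = contraction g w := by
    rw [hw, wedgeAdjoint_fundamentalElt]
    exact LinearMap.ext fun b => by rw [map_neg, neg_neg]
  -- Both sides are ∑ (-ω)^k / k!: the term Λ^j vol / j! is ω^{n-j} / (n-j)!, so the two sums match
  -- after the reflection k = n - j.
  have h1 : nilExp ℂ (-LinearMap.mulLeft ℂ w) 1 =
      nilExp ℂ (-wedgeAdjoint g w) (((-1) ^ n : ℂ) • volElt g) := by
    rw [hL, hneg, nilExp_eq_sum (k := n + 1), LinearMap.sum_apply, ← Finset.sum_range_reflect]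
    · refine Finset.sum_congr rfl fun j hj => ?_
      have hj' : j ≤ n := Nat.lt_succ_iff.mp (Finset.mem_range.mp hj)
      have hp : ∀ b, (contraction g w ^ j) b = ((-1) ^ j : ℂ) • (wedgeAdjoint g w ^ j) b := by
        intro b
        rw [hw, wedgeAdjoint_fundamentalElt, ← map_pow, ← map_pow, neg_pow_eq_smul (fundamentalElt g), map_smul,
          LinearMap.smul_apply, smul_smul, ← mul_pow, neg_mul_neg, one_mul, one_pow, one_smul]
      rw [LinearMap.smul_apply, map_smul, hp,
        wedgeAdjoint_pow_volElt hg hsymm hJ j (n - j) (by omega), mul_one, neg_pow_eq_smul,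
        smul_smul,
        smul_smul, smul_smul, smul_smul, show n + 1 - 1 - j = n - j by omega]
      congr 1
      have h1 : ((j.factorial : ℕ) : ℂ) ≠ 0 := by exact_mod_cast j.factorial_ne_zero
      have h2 : ((-1) ^ n : ℂ) = (-1) ^ (n - j) * (-1) ^ j := by
        rw [← pow_add, Nat.sub_add_cancel hj']
      have h3 : ((-1) ^ j * (-1) ^ j : ℂ) = 1 := by rw [← mul_pow]; norm_num
      rw [h2]
      have h4 : (j.factorial : ℂ)⁻¹ * (j.factorial : ℂ) = 1 := inv_mul_cancel₀ h1
      linear_combination (-((n - j).factorial : ℂ)⁻¹ * (-1) ^ (n - j)) * (h4 +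
        ((j.factorial : ℂ)⁻¹ * (j.factorial : ℂ)) * h3)
    · rw [← map_pow, hw, fundamentalElt_pow_eq_zero, map_zero]
  -- The factor e^Λ of W cancels e^{-Λ}, and the last e^{-L} fixes the volume form because ω^{n+1} =
  -- 0.
  rw [weylExt, weylOp, ← hw, Module.End.mul_apply, h1, Module.End.mul_apply,
    ← Module.End.mul_apply (nilExp ℂ (wedgeAdjoint g w)), nilExp_mul_nilExp_neg hnil,
    Module.End.one_apply, hL, Finset.sum_range_succ',
    Finset.sum_eq_zero]
  · simp
  · intro k _
    rw [mul_smul_comm, volElt, mul_smul_comm, pow_succ, mul_assoc, neg_mul, ← pow_succ' _ n, hw, hn,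
      fundamentalElt_pow_eq_zero]
    simp

/-- The Hodge star in terms of the Weyl element. -/
lemma hodgeStar_eq (hg : g.IsInvertible) (hsymm : ∀ v w, g v w = g w v)
    (hJ : ∀ v w, g (Complex.I • v) (Complex.I • w) = g v w) (a : CxExt E) :
    hodgeStar g (volElt g) a = ((-1) ^ Module.finrank ℂ E : ℂ) •
      weylExt g (scaleExt Complex.I (CliffordAlgebra.reverse a)) := by
  have h1 : ((-1) ^ Module.finrank ℂ E * (-1) ^ Module.finrank ℂ E : ℂ) = 1 := by
    rw [← mul_pow]; norm_num
  -- The conjugation formula is evaluated at 1, which W maps to ± vol; the contraction of vol with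
  -- the reversal of `a` is ⋆a by definition.
  have h := LinearMap.congr_fun
    (weylExt_mul_mulLeft hg hsymm hJ (CliffordAlgebra.reverse a)) 1
  rw [Module.End.mul_apply, Module.End.mul_apply, LinearMap.mulLeft_apply, mul_one,
    weylExt_one hg hsymm hJ, map_smul] at h
  rw [h, smul_smul, h1, one_smul]
  rfl

end FibreWeyl

end


/-! ### The degree of exterior forms -/

noncomputable section

section ExtDegree

variable {E : Type*} [NormedAddCommGroup E] [NormedSpace ℂ E]

lemma extDegree_natCast (m : ℕ) :
    extDegree (E := E) (m : ℤ) = ⋀[ℂ]^m (CxCovector E) := rfl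

lemma extDegree_eq_bot_of_neg {k : ℤ} (hk : k < 0) : extDegree (E := E) k = ⊥ := by
  obtain ⟨m, rfl⟩ := Int.eq_negSucc_of_lt_zero hk
  rfl

instance extDegree_gradedMonoid : SetLike.GradedMonoid (extDegree (E := E)) where
  one_mem := SetLike.GradedOne.one_mem (A := fun i : ℕ => ⋀[ℂ]^i (CxCovector E))
  mul_mem := fun i j a b ha hb => by
    rcases lt_or_ge i 0 with hi | hi
    · rw [extDegree_eq_bot_of_neg hi, Submodule.mem_bot] at ha
      rw [ha, zero_mul]; exact zero_mem _
    rcases lt_or_ge j 0 with hj | hj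
    · rw [extDegree_eq_bot_of_neg hj, Submodule.mem_bot] at hb
      rw [hb, mul_zero]; exact zero_mem _
    obtain ⟨m, rfl⟩ := Int.eq_ofNat_of_zero_le hi
    obtain ⟨n, rfl⟩ := Int.eq_ofNat_of_zero_le hj
    exact SetLike.GradedMul.mul_mem (A := fun i : ℕ => ⋀[ℂ]^i (CxCovector E)) ha hb

lemma ι_mem_extDegree (ε : CxCovector E) : ExteriorAlgebra.ι ℂ ε ∈ extDegree (E := E) 1 :=
  ι_mem_exteriorPower ε

lemma algebraMap_mem_extDegree (c : ℂ) : algebraMap ℂ (CxExt E) c ∈ extDegree (E := E) 0 := by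
  rw [Algebra.algebraMap_eq_smul_one]
  exact Submodule.smul_mem _ _ SetLike.GradedOne.one_mem

lemma ι_mul_mem_extDegree (ε : CxCovector E) {k : ℤ} {a : CxExt E} (ha : a ∈ extDegree k) :
    ExteriorAlgebra.ι ℂ ε * a ∈ extDegree (E := E) (k + 1) := by
  rw [add_comm]
  exact SetLike.mul_mem_graded (ι_mem_extDegree ε) ha

/-- Induction on the degree of homogeneous exterior forms. -/
lemma extDegree_induction {P : ∀ (k : ℤ) (a : CxExt E), a ∈ extDegree k → Prop}
    (h0 : ∀ c, P 0 (algebraMap ℂ (CxExt E) c) (algebraMap_mem_extDegree c))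
    (h1 : ∀ k a b ha hb, P k a ha → P k b hb → P k (a + b) (add_mem ha hb))
    (hz : ∀ k, P k 0 (zero_mem _))
    (h2 : ∀ k a ε ha, P k a ha →
      P (k + 1) (ExteriorAlgebra.ι ℂ ε * a) (ι_mul_mem_extDegree ε ha)) {k : ℤ}
    {a : CxExt E} (ha : a ∈ extDegree k) : P k a ha := by
  rcases lt_or_ge k 0 with hk | hk
  · have ha' := ha
    rw [extDegree_eq_bot_of_neg hk, Submodule.mem_bot] at ha'
    subst ha'
    exact hz k
  obtain ⟨m, rfl⟩ := Int.eq_ofNat_of_zero_le hk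
  induction m generalizing a with
  | zero =>
    have ha' : a ∈ (LinearMap.range (ExteriorAlgebra.ι ℂ) ^ 0 : Submodule ℂ (CxExt E)) := ha
    rw [pow_zero, Submodule.mem_one] at ha'
    obtain ⟨c, rfl⟩ := ha'
    exact h0 c
  | succ m ih =>
    have ha' : a ∈ (LinearMap.range (ExteriorAlgebra.ι ℂ) ^ (m + 1) : Submodule ℂ (CxExt E)) := ha
    rw [pow_succ'] at ha'
    -- The predicate depends on the proof of membership, so the induction over the product of
    -- submodules carries this proof along.
    have key : ∃ h : a ∈ extDegree ((m : ℤ) + 1), P ((m : ℤ) + 1) a h := by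
      refine Submodule.mul_induction_on ha' ?_ ?_
      · rintro _ ⟨ε, rfl⟩ b hb
        exact ⟨_, h2 _ _ ε hb (ih hb (Int.natCast_nonneg m))⟩
      · rintro a b ⟨ha, hPa⟩ ⟨hb, hPb⟩
        exact ⟨_, h1 _ _ _ _ _ hPa hPb⟩
    exact key.2

lemma mul_ι_of_mem {k : ℤ} {a : CxExt E} (ha : a ∈ extDegree k) (ε : CxCovector E) :
    a * ExteriorAlgebra.ι ℂ ε = k.negOnePow • (ExteriorAlgebra.ι ℂ ε * a) := by
  induction ha using extDegree_induction with
  | h0 c => rw [Int.negOnePow_zero, one_smul, Algebra.commutes]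
  | h1 k a b _ _ ha hb => rw [add_mul, ha, hb, mul_add, smul_add]
  | hz k => simp
  | h2 k a η _ ha =>
    have h : (ExteriorAlgebra.ι ℂ η * ExteriorAlgebra.ι ℂ ε : CxExt E) =
      -(ExteriorAlgebra.ι ℂ ε * ExteriorAlgebra.ι ℂ η) :=
      eq_neg_of_add_eq_zero_left (ExteriorAlgebra.ι_add_mul_swap _ _)
    rw [mul_assoc, ha, mul_smul_comm, ← mul_assoc, h, Int.negOnePow_succ, neg_mul, mul_assoc,
      Units.neg_smul, smul_neg]

lemma extDegree_graded_comm (i j : ℤ) (a : CxExt E) (ha : a ∈ extDegree i) (b : CxExt E)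
    (hb : b ∈ extDegree j) : a * b = (i * j).negOnePow • (b * a) := by
  induction ha using extDegree_induction with
  | h0 c => rw [zero_mul, Int.negOnePow_zero, one_smul, Algebra.commutes]
  | h1 k a a' _ _ ha ha' => rw [add_mul, ha, ha', mul_add, smul_add]
  | hz k => simp
  | h2 k a η _ ha =>
    rw [mul_assoc, ha, mul_smul_comm, ← mul_assoc b, mul_ι_of_mem hb, smul_mul_assoc, smul_smul,
      add_mul, one_mul, Int.negOnePow_add, mul_assoc, Int.units_mul_self, mul_one, mul_assoc]

lemma contractLeft_mem (δ : Module.Dual ℂ (CxCovector E)) {k : ℤ} {a : CxExt E}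
    (ha : a ∈ extDegree k) : CliffordAlgebra.contractLeft δ a ∈ extDegree (E := E) (k + -1) := by
  induction ha using extDegree_induction with
  | h0 c => rw [contractLeft_algebraMap']; exact zero_mem _
  | h1 k a b _ _ ha hb => rw [map_add]; exact add_mem ha hb
  | hz k => rw [map_zero]; exact zero_mem _
  | h2 k a ε hk ha =>
    rw [contractLeft_ι_mul', add_neg_cancel_right]
    refine sub_mem (Submodule.smul_mem _ _ hk) ?_
    have := SetLike.mul_mem_graded (ι_mem_extDegree ε) ha
    rwa [add_left_comm, add_neg_cancel, add_zero] at this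

lemma contractLeft_mul (δ : Module.Dual ℂ (CxCovector E)) {k : ℤ} {a : CxExt E}
    (ha : a ∈ extDegree k) (b : CxExt E) : CliffordAlgebra.contractLeft δ (a * b) =
      CliffordAlgebra.contractLeft δ a * b +
        k.negOnePow • (a * CliffordAlgebra.contractLeft δ b) := by
  induction ha using extDegree_induction with
  | h0 c =>
    rw [contractLeft_algebraMap', zero_mul, zero_add, Int.negOnePow_zero, one_smul,
      ← Algebra.smul_def, ← Algebra.smul_def, map_smul]
  | h1 k a a' _ _ ha ha' =>
    rw [add_mul, map_add, map_add, ha, ha', add_mul, add_mul, smul_add]; abel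
  | hz k => simp
  | h2 k a ε _ ha =>
    rw [mul_assoc, contractLeft_ι_mul', contractLeft_ι_mul', ha, mul_add, sub_mul, smul_mul_assoc,
      mul_smul_comm, Int.negOnePow_succ, Units.neg_smul, mul_assoc, mul_assoc]
    abel

lemma hasOrderLE_contractLeft (δ : Module.Dual ℂ (CxCovector E)) :
    HasOrderLE (extDegree (E := E)) 1 (-1) (CliffordAlgebra.contractLeft δ) := by
  refine HasOrderLE.of_derivation extDegree_graded_comm (fun _ _ ha => contractLeft_mem δ ha)
    fun i a ha b => ?_
  rw [mul_neg_one, Int.negOnePow_neg]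
  exact contractLeft_mul δ ha b

lemma contraction_hasDegree (g : E →L[ℝ] E →L[ℝ] ℝ) {k : ℤ} {a : CxExt E}
    (ha : a ∈ extDegree k) : HasDegree (extDegree (E := E)) (-k) (contraction g a) := by
  induction ha using extDegree_induction with
  | h0 c =>
    intro j b hb
    rw [contraction_algebraMap, neg_zero, add_zero]
    exact Submodule.smul_mem _ _ hb
  | h1 k a b _ _ ha hb => rw [map_add]; exact ha.add hb
  | hz k => rw [map_zero]; exact HasDegree.zero _
  | h2 k a ε _ ha =>
    rw [map_mul]
    refine HasDegree.congr (HasDegree.mul (j := -1) ?_ ha) (by ring)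
    intro j b hb
    rw [contraction_ι]
    exact contractLeft_mem _ hb

/-- A new first covector must pass k others, and k (k - 1) / 2 + k = (k + 1) k / 2. -/
lemma reverse_of_mem {k : ℤ} {a : CxExt E} (ha : a ∈ extDegree k) :
    CliffordAlgebra.reverse a = (k * (k - 1) / 2).negOnePow • a := by
  induction ha using extDegree_induction with
  | h0 c => simp
  | h1 k a b _ _ ha hb => rw [map_add, ha, hb, smul_add]
  | hz k => simp
  | h2 k a ε hk ha =>
    have h : (k + 1) * (k + 1 - 1) / 2 = k * (k - 1) / 2 + k := by
      rw [show (k + 1) * (k + 1 - 1) = k * (k - 1) + k * 2 by ring,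
        Int.add_mul_ediv_right _ _ two_ne_zero]
    rw [CliffordAlgebra.reverse.map_mul, reverse_ι', ha, smul_mul_assoc, mul_ι_of_mem hk, h,
      Int.negOnePow_add, smul_smul]

lemma scaleExt_neg_one_of_mem {k : ℤ} {a : CxExt E} (ha : a ∈ extDegree k) :
    scaleExt (-1) a = k.negOnePow • a := by
  induction ha using extDegree_induction with
  | h0 c => simp
  | h1 k a b _ _ ha hb => rw [map_add, ha, hb, smul_add]
  | hz k => simp
  | h2 k a ε _ ha =>
    have h : scaleCovector (-1) ε = -ε := by
      ext v; rw [scaleCovector_apply, neg_one_smul, map_neg]; rfl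
    rw [map_mul, ha, scaleExt_ι, h, map_neg, Int.negOnePow_succ, neg_mul, mul_smul_comm,
      Units.neg_smul]

lemma pullExt_mem (T : E →L[ℂ] E) {k : ℤ} {a : CxExt E} (ha : a ∈ extDegree k) :
    pullExt T a ∈ extDegree (E := E) k := by
  induction ha using extDegree_induction with
  | h0 c => rw [AlgHom.commutes]; exact algebraMap_mem_extDegree c
  | h1 k a b _ _ ha hb => rw [map_add]; exact add_mem ha hb
  | hz k => rw [map_zero]; exact zero_mem _
  | h2 k a ε _ ha =>
    rw [map_mul, pullExt_ι]
    exact ι_mul_mem_extDegree _ ha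

/-- The projection onto the forms of degree `k`. -/
def degreeProj : ℤ → CxExt E →ₗ[ℂ] CxExt E
  | Int.ofNat m => GradedAlgebra.proj (fun i : ℕ => ⋀[ℂ]^i (CxCovector E)) m
  | Int.negSucc _ => 0

lemma degreeProj_of_mem {j k : ℤ} {a : CxExt E} (ha : a ∈ extDegree j) :
    degreeProj k a = if j = k then a else 0 := by
  rcases lt_or_ge j 0 with hj | hj
  · rw [extDegree_eq_bot_of_neg hj, Submodule.mem_bot] at ha
    simp [ha]
  obtain ⟨m, rfl⟩ := Int.eq_ofNat_of_zero_le hj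
  rcases lt_or_ge k 0 with hk | hk
  · obtain ⟨l, rfl⟩ := Int.eq_negSucc_of_lt_zero hk
    rw [if_neg (by simp)]
    rfl
  obtain ⟨l, rfl⟩ := Int.eq_ofNat_of_zero_le hk
  change ((DirectSum.decompose (fun i : ℕ => ⋀[ℂ]^i (CxCovector E)) a) l : CxExt E) = _
  by_cases h : m = l
  · subst h
    rw [if_pos rfl]
    exact DirectSum.decompose_of_mem_same _ ha
  · rw [if_neg (by exact_mod_cast h)]
    exact DirectSum.decompose_of_mem_ne _ ha h

lemma degreeProj_mem (k : ℤ) (a : CxExt E) : degreeProj k a ∈ extDegree (E := E) k := by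
  rcases k with m | m
  · exact SetLike.coe_mem _
  · exact zero_mem _

/-- Induction on the homogeneous components of exterior forms. -/
lemma CxExt.homogeneous_induction {P : CxExt E → Prop} (h : ∀ k, ∀ a ∈ extDegree k, P a)
    (hadd : ∀ a b, P a → P b → P (a + b)) (a : CxExt E) : P a := by
  induction a using DirectSum.Decomposition.inductionOn
    (ℳ := fun i : ℕ => ⋀[ℂ]^i (CxCovector E)) with
  | zero => exact h 0 0 (zero_mem _)
  | @homogeneous i a => exact h i a a.2
  | add a b ha hb => exact hadd a b ha hb

lemma degreeProj_pull (T : E →L[ℂ] E) (k : ℤ) (a : CxExt E) :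
    degreeProj k (pullExt T a) = pullExt T (degreeProj k a) := by
  induction a using CxExt.homogeneous_induction with
  | h j a ha =>
    rw [degreeProj_of_mem ha, degreeProj_of_mem (pullExt_mem T ha), apply_ite (pullExt T), map_zero]
  | hadd a b ha hb => simp only [map_add, ha, hb]

variable [FiniteDimensional ℂ E]

lemma sum_degreeProj (a : CxExt E) :
    ∑ k ∈ Finset.Icc (0 : ℤ) (2 * Module.finrank ℂ E), degreeProj k a = a := by
  induction a using CxExt.homogeneous_induction with
  | h j a ha =>
    simp only [degreeProj_of_mem ha]
    rw [Finset.sum_ite_eq]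
    split_ifs with h
    · rfl
    · symm
      rw [Finset.mem_Icc, not_and_or, not_le, not_le] at h
      rcases h with h | h
      · rwa [extDegree_eq_bot_of_neg h, Submodule.mem_bot] at ha
      · obtain ⟨m, rfl⟩ := Int.eq_ofNat_of_zero_le (by omega : 0 ≤ j)
        rwa [extDegree_natCast, exteriorPower_eq_bot (by omega), Submodule.mem_bot] at ha
  | hadd a b ha hb =>
    simp only [map_add, Finset.sum_add_distrib, ha, hb]

/-- Up to scalars, Λ is a sum of products of two contractions with vectors, and these are graded
derivations, hence of order 1. -/
lemma hasOrderLE_wedgeAdjoint_fundamentalElt (g : E →L[ℝ] E →L[ℝ] ℝ) :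
    HasOrderLE (extDegree (E := E)) 2 (-2) (wedgeAdjoint g (fundamentalElt g)) := by
  have h : ∀ ε : CxCovector E, HasOrderLE (extDegree (E := E)) 1 (-1)
      (contraction g (ExteriorAlgebra.ι ℂ ε)) := fun ε => by
    rw [show contraction g (ExteriorAlgebra.ι ℂ ε) = CliffordAlgebra.contractLeft (cometric g ε)
      from LinearMap.ext (contraction_ι g ε)]
    exact hasOrderLE_contractLeft _
  rw [wedgeAdjoint_fundamentalElt, fundamentalElt_eq, ← smul_neg, ← Finset.sum_neg_distrib,
    map_smul, map_sum]
  refine (HasOrderLE.sum _ fun i _ => ?_).smul _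
  rw [← neg_mul, ← map_neg (ExteriorAlgebra.ι ℂ), map_mul (contraction g)]
  exact HasOrderLE.mul (r := 1) (s := 1) (j := -1) (k := -1) rfl (h _) (h _)

end ExtDegree

end


/-! ### The type decomposition of exterior forms -/

noncomputable section

section ExtType

variable {E : Type*} [NormedAddCommGroup E] [NormedSpace ℂ E]

lemma covector10_apply (ε : CxCovector E) (v : E) :
    covector10 ε v = 2⁻¹ * (ε v - Complex.I * ε (Complex.I • v)) := rfl

lemma covector01_apply (ε : CxCovector E) (v : E) :
    covector01 ε v = 2⁻¹ * (ε v + Complex.I * ε (Complex.I • v)) := rfl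

lemma covector10_add_covector01 (ε : CxCovector E) : covector10 ε + covector01 ε = ε := by
  ext v
  rw [add_apply, covector10_apply, covector01_apply]
  ring

lemma apply_I_smul_I_smul (ε : CxCovector E) (v : E) :
    ε (Complex.I • Complex.I • v) = -ε v := by
  rw [smul_smul, Complex.I_mul_I, neg_one_smul, map_neg]

lemma covectorJ_covector10 (ε : CxCovector E) :
    covectorJ (covector10 ε) = Complex.I • covector10 ε := by
  ext v
  rw [covectorJ_apply, smul_apply, smul_eq_mul, covector10_apply, covector10_apply,
    apply_I_smul_I_smul]
  linear_combination (2⁻¹ * ε (Complex.I • v)) * Complex.I_mul_I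

lemma covectorJ_covector01 (ε : CxCovector E) :
    covectorJ (covector01 ε) = (-Complex.I) • covector01 ε := by
  ext v
  rw [covectorJ_apply, smul_apply, smul_eq_mul, covector01_apply, covector01_apply,
    apply_I_smul_I_smul]
  linear_combination (2⁻¹ * ε (Complex.I • v)) * Complex.I_mul_I

lemma covector10_of_J {ε : CxCovector E} (h : covectorJ ε = Complex.I • ε) :
    covector10 ε = ε ∧ covector01 ε = 0 := by
  have h' : ∀ v, ε (Complex.I • v) = Complex.I * ε v := fun v =>
    congrArg (fun η : CxCovector E => η v) h
  constructor <;> ext v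
  · rw [covector10_apply, h']
    linear_combination (-2⁻¹ * ε v) * Complex.I_mul_I
  · rw [covector01_apply, h', zero_apply]
    linear_combination (2⁻¹ * ε v) * Complex.I_mul_I

lemma covector01_of_J {ε : CxCovector E} (h : covectorJ ε = (-Complex.I) • ε) :
    covector10 ε = 0 ∧ covector01 ε = ε := by
  have h' : ∀ v, ε (Complex.I • v) = -Complex.I * ε v := fun v =>
    congrArg (fun η : CxCovector E => η v) h
  constructor <;> ext v
  · rw [covector10_apply, h', zero_apply]
    linear_combination (2⁻¹ * ε v) * Complex.I_mul_I
  · rw [covector01_apply, h']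
    linear_combination (-2⁻¹ * ε v) * Complex.I_mul_I

/-- The eigenvalues κ = i and κ = -i give complex linear and conjugate linear covectors; keeping κ
general treats both types at once. -/
lemma apply_smul_of_J {ε : CxCovector E} {κ : ℂ} (h : covectorJ ε = κ • ε) (c : ℂ) (v : E) :
    ε (c • v) = (c.re + c.im * κ) * ε v := by
  have h' : ε (Complex.I • v) = κ * ε v := congrArg (fun η : CxCovector E => η v) h
  conv_lhs => rw [← Complex.re_add_im c]
  rw [add_smul, mul_smul, map_add, Complex.coe_smul, Complex.coe_smul, map_smul, map_smul, h',
    Complex.real_smul, Complex.real_smul]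
  ring

lemma scaleCovector_covector10 (s : ℂ) (ε : CxCovector E) :
    scaleCovector s (covector10 ε) = s • covector10 ε := by
  ext v
  rw [scaleCovector_apply, apply_smul_of_J (covectorJ_covector10 ε), Complex.re_add_im]
  rfl

lemma scaleCovector_covector01 (s : ℂ) (ε : CxCovector E) :
    scaleCovector s (covector01 ε) = conj s • covector01 ε := by
  ext v
  have h : (s.re + s.im * -Complex.I : ℂ) = conj s := by
    apply Complex.ext <;> simp
  rw [scaleCovector_apply, apply_smul_of_J (covectorJ_covector01 ε), h]
  rfl

lemma conjCovector_covector10 (ε : CxCovector E) :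
    conjCovector (covector10 ε) = covector01 (conjCovector ε) := by
  ext v
  change conj (covector10 ε v) = _
  rw [covector10_apply, covector01_apply]
  change _ = 2⁻¹ * (conj (ε v) + Complex.I * conj (ε (Complex.I • v)))
  simp only [map_mul, map_sub, map_inv₀, map_ofNat, Complex.conj_I]
  ring

/-- The forms of type `(p, q)`. -/
def typeSubmodule (p q : ℕ) : Submodule ℂ (CxExt E) where
  carrier := {a | typeHom a = Polynomial.monomial q (Polynomial.monomial p a)}
  add_mem' := fun {a b} (ha : _ = _) (hb : _ = _) => by
    change _ = _
    rw [map_add, ha, hb, map_add, map_add]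
  zero_mem' := by simp
  smul_mem' := fun c a (ha : _ = _) => by
    change _ = _
    rw [map_smul, ha, Polynomial.smul_monomial, Polynomial.smul_monomial]

lemma mem_typeSubmodule {p q : ℕ} {a : CxExt E} : a ∈ typeSubmodule p q ↔
    typeHom a = Polynomial.monomial q (Polynomial.monomial p a) := Iff.rfl

lemma typeProj_of_mem {p q : ℕ} {a : CxExt E} (ha : a ∈ typeSubmodule p q) (p' q' : ℕ) :
    typeProj p' q' a = if p = p' ∧ q = q' then a else 0 := by
  change ((typeHom a).coeff q').coeff p' = _
  rw [mem_typeSubmodule.mp ha, Polynomial.coeff_monomial]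
  by_cases hq : q = q'
  · rw [if_pos hq, Polynomial.coeff_monomial]
    by_cases hp : p = p'
    · rw [if_pos hp, if_pos ⟨hp, hq⟩]
    · rw [if_neg hp, if_neg fun h => hp h.1]
  · rw [if_neg hq, if_neg fun h => hq h.2, Polynomial.coeff_zero]

lemma mul_mem_typeSubmodule {p q p' q' : ℕ} {a b : CxExt E} (ha : a ∈ typeSubmodule p q)
    (hb : b ∈ typeSubmodule p' q') : a * b ∈ typeSubmodule (E := E) (p + p') (q + q') := by
  rw [mem_typeSubmodule] at *
  rw [map_mul, ha, hb, Polynomial.monomial_mul_monomial, Polynomial.monomial_mul_monomial]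

lemma ι_covector10_mem (ε : CxCovector E) :
    ExteriorAlgebra.ι ℂ (covector10 ε) ∈ typeSubmodule (E := E) 1 0 := by
  obtain ⟨h1, h2⟩ := covector10_of_J (covectorJ_covector10 ε)
  rw [mem_typeSubmodule, typeHom_ι, h1, h2]
  simp [Polynomial.monomial_zero_left]

lemma ι_covector01_mem (ε : CxCovector E) :
    ExteriorAlgebra.ι ℂ (covector01 ε) ∈ typeSubmodule (E := E) 0 1 := by
  obtain ⟨h1, h2⟩ := covector01_of_J (covectorJ_covector01 ε)
  rw [mem_typeSubmodule, typeHom_ι, h1, h2]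
  simp [Polynomial.monomial_zero_left]

lemma one_mem_typeSubmodule : (1 : CxExt E) ∈ typeSubmodule (E := E) 0 0 := by
  rw [mem_typeSubmodule, map_one, Polynomial.monomial_zero_left, Polynomial.monomial_zero_left,
    map_one, map_one]

/-- The span of the covectors of type `(1, 0)` in the exterior algebra. -/
def span10 : Submodule ℂ (CxExt E) :=
  (LinearMap.range (covector10 (E := E))).map (ExteriorAlgebra.ι ℂ)

/-- The span of the covectors of type `(0, 1)` in the exterior algebra. -/
def span01 : Submodule ℂ (CxExt E) :=
  (LinearMap.range (covector01 (E := E))).map (ExteriorAlgebra.ι ℂ)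

lemma span10_pow_le (p : ℕ) : span10 (E := E) ^ p ≤ typeSubmodule p 0 := by
  induction p with
  | zero =>
    rw [pow_zero, Submodule.one_le]
    exact one_mem_typeSubmodule
  | succ p ih =>
    rw [pow_succ, Submodule.mul_le]
    rintro a ha _ ⟨_, ⟨ε, rfl⟩, rfl⟩
    exact mul_mem_typeSubmodule (ih ha) (ι_covector10_mem ε)

lemma span01_pow_le (q : ℕ) : span01 (E := E) ^ q ≤ typeSubmodule 0 q := by
  induction q with
  | zero =>
    rw [pow_zero, Submodule.one_le]
    exact one_mem_typeSubmodule
  | succ q ih =>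
    rw [pow_succ, Submodule.mul_le]
    rintro a ha _ ⟨_, ⟨ε, rfl⟩, rfl⟩
    exact mul_mem_typeSubmodule (ih ha) (ι_covector01_mem ε)

/-- Every covector is split into its two types, and the factors of type (0, 1) are moved to the
right of those of type (1, 0) at the cost of a sign. -/
lemma mem_iSup_span (a : CxExt E) :
    a ∈ ⨆ pq : ℕ × ℕ, span10 (E := E) ^ pq.1 * span01 (E := E) ^ pq.2 := by
  induction a using CxExt.induction with
  | h0 c =>
    refine Submodule.mem_iSup_of_mem (0, 0) ?_
    rw [pow_zero, pow_zero, one_mul]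
    exact Submodule.mem_one.mpr ⟨c, rfl⟩
  | h1 a b ha hb => exact add_mem ha hb
  | h2 a ε ha =>
    induction ha using Submodule.iSup_induction' with
    | zero => rw [mul_zero]; exact zero_mem _
    | add a b _ _ ha hb => rw [mul_add]; exact add_mem ha hb
    | mem pq a ha =>
      obtain ⟨p, q⟩ := pq
      rw [← covector10_add_covector01 ε, map_add, add_mul]
      refine add_mem (Submodule.mem_iSup_of_mem (p + 1, q) ?_)
        (Submodule.mem_iSup_of_mem (p, q + 1) ?_)
      · rw [pow_succ', mul_assoc]
        exact Submodule.mul_mem_mul ⟨_, ⟨ε, rfl⟩, rfl⟩ ha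
      · refine Submodule.mul_induction_on ha ?_ ?_
        · intro x hx y hy
          have hx' : x ∈ extDegree (E := E) p := by
            have hle : span10 (E := E) ≤ LinearMap.range (ExteriorAlgebra.ι ℂ) :=
              LinearMap.map_le_range
            exact pow_le_pow_left' hle p hx
          have h := mul_ι_of_mem hx' (covector01 ε)
          have h' : ExteriorAlgebra.ι ℂ (covector01 ε) * (x * y) =
              (p : ℤ).negOnePow • (x * (ExteriorAlgebra.ι ℂ (covector01 ε) * y)) := by
            rw [← mul_assoc x, h, smul_mul_assoc, smul_smul, Int.units_mul_self, one_smul,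
              mul_assoc]
          have hm : x * (ExteriorAlgebra.ι ℂ (covector01 ε) * y) ∈
              span10 (E := E) ^ p * span01 (E := E) ^ (q + 1) := by
            rw [pow_succ']
            exact Submodule.mul_mem_mul hx (Submodule.mul_mem_mul ⟨_, ⟨ε, rfl⟩, rfl⟩ hy)
          rw [h']
          rcases Int.units_eq_one_or (p : ℤ).negOnePow with e | e <;> rw [e]
          · rwa [one_smul]
          · rw [Units.neg_smul, one_smul]
            exact neg_mem hm
        · intro x y hx hy
          rw [mul_add]
          exact add_mem hx hy

/-- Evaluates the double sums in the definitions of ∂ and ∂̄, which run over p, q ≤ n; hence the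
bounds. -/
lemma sum_typeProj_of_mem {p q : ℕ} (hp : p ≤ Module.finrank ℂ E) (hq : q ≤ Module.finrank ℂ E)
    {a : CxExt E} (ha : a ∈ typeSubmodule p q) (f : ℕ → ℕ → CxExt E →ₗ[ℂ] CxExt E) :
    ∑ p' ∈ Finset.range (Module.finrank ℂ E + 1), ∑ q' ∈ Finset.range (Module.finrank ℂ E + 1),
      f p' q' (typeProj p' q' a) = f p q a := by
  rw [Finset.sum_eq_single p, Finset.sum_eq_single q]
  · rw [typeProj_of_mem ha, if_pos ⟨rfl, rfl⟩]
  · intro q' _ hq'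
    rw [typeProj_of_mem ha, if_neg fun h => hq' h.2.symm, map_zero]
  · exact fun h => absurd (Finset.mem_range.mpr (Nat.lt_succ_iff.mpr hq)) h
  · intro p' _ hp'
    refine Finset.sum_eq_zero fun q' _ => ?_
    rw [typeProj_of_mem ha, if_neg fun h => hp' h.1.symm, map_zero]
  · exact fun h => absurd (Finset.mem_range.mpr (Nat.lt_succ_iff.mpr hp)) h

lemma range_ι_comp_pow_eq_bot {n p : ℕ} (f : (Fin n → ℂ) →ₗ[ℂ] CxCovector E) (hp : n < p) :
    (LinearMap.range (ExteriorAlgebra.ι ℂ ∘ₗ f) : Submodule ℂ (CxExt E)) ^ p = ⊥ := by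
  have h2 : (LinearMap.range (ExteriorAlgebra.ι ℂ (M := Fin n → ℂ))) ^ p = ⊥ := by
    change (⋀[ℂ]^p (Fin n → ℂ) : Submodule ℂ (ExteriorAlgebra ℂ (Fin n → ℂ))) = ⊥
    rw [← Submodule.finrank_eq_zero, exteriorPower.finrank_eq, Module.finrank_fin_fun]
    exact Nat.choose_eq_zero_of_lt hp
  rw [← ExteriorAlgebra.map_comp_ι, LinearMap.range_comp, ← Submodule.map_pow, h2,
    Submodule.map_bot]

variable [FiniteDimensional ℂ E]

/-- An eigencovector of J is determined by its values on a complex basis of E, so U lies in the span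
of the n covectors θ_i. Thus forms with p > n or q > n vanish, and truncating the sums over types at
n loses nothing. -/
lemma map_ι_pow_eq_bot (U : Submodule ℂ (CxCovector E)) (κ : ℂ)
    (hU : ∀ ε ∈ U, covectorJ ε = κ • ε) {p : ℕ} (hp : Module.finrank ℂ E < p) :
    (U.map (ExteriorAlgebra.ι ℂ) : Submodule ℂ (CxExt E)) ^ p = ⊥ := by
  set b := Module.finBasis ℂ E
  let θ : Fin (Module.finrank ℂ E) → CxCovector E := fun i => LinearMap.toContinuousLinearMap
    { toFun := fun v => ((b.coord i v).re + (b.coord i v).im * κ : ℂ)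
      map_add' := fun v w => by simp only [map_add, Complex.add_re, Complex.add_im]; push_cast; ring
      map_smul' := fun c v => by
        rw [← Complex.coe_smul, map_smul, smul_eq_mul, Complex.re_ofReal_mul,
          Complex.im_ofReal_mul, RingHom.id_apply, Complex.real_smul]
        push_cast
        ring }
  have hθ : ∀ i v, θ i v = ((b.coord i v).re + (b.coord i v).im * κ : ℂ) := fun _ _ => rfl
  refine le_bot_iff.mp ((pow_le_pow_left' ?_ p).trans
    (range_ι_comp_pow_eq_bot (Fintype.linearCombination ℂ θ) hp).le)
  rintro _ ⟨ε, hε, rfl⟩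
  refine ⟨fun i => ε (b i), congrArg (ExteriorAlgebra.ι ℂ) (ContinuousLinearMap.ext fun v => ?_)⟩
  rw [Fintype.linearCombination_apply, sum_apply]
  conv_rhs => rw [← b.sum_repr v, map_sum]
  refine Finset.sum_congr rfl fun i _ => ?_
  rw [apply_smul_of_J (hU ε hε), smul_apply, smul_eq_mul, hθ, mul_comm]
  rfl

/-- Induction on the type of forms. -/
lemma CxExt.type_induction {P : CxExt E → Prop}
    (h : ∀ p q, p ≤ Module.finrank ℂ E → q ≤ Module.finrank ℂ E → ∀ a ∈ typeSubmodule p q, P a)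
    (hadd : ∀ a b, P a → P b → P (a + b)) (a : CxExt E) : P a := by
  have h0 : P 0 := h 0 0 (Nat.zero_le _) (Nat.zero_le _) 0 (zero_mem _)
  have ha := mem_iSup_span a
  induction ha using Submodule.iSup_induction' with
  | zero => exact h0
  | add a b _ _ ha hb => exact hadd a b ha hb
  | mem pq a ha =>
    obtain ⟨p, q⟩ := pq
    by_cases hp : p ≤ Module.finrank ℂ E
    · by_cases hq : q ≤ Module.finrank ℂ E
      · refine h p q hp hq a ?_
        have hle : span10 (E := E) ^ p * span01 (E := E) ^ q ≤ typeSubmodule p q := by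
          rw [Submodule.mul_le]
          intro x hx y hy
          simpa using mul_mem_typeSubmodule (span10_pow_le p hx) (span01_pow_le q hy)
        exact hle ha
      · have hbot : span01 (E := E) ^ q = ⊥ := by
          refine map_ι_pow_eq_bot _ (-Complex.I) ?_ (not_le.mp hq)
          rintro _ ⟨ε, rfl⟩
          exact covectorJ_covector01 ε
        simp only [hbot, Submodule.mul_bot, Submodule.mem_bot] at ha
        exact ha ▸ h0
    · have hbot : span10 (E := E) ^ p = ⊥ := by
        refine map_ι_pow_eq_bot _ Complex.I ?_ (not_le.mp hp)
        rintro _ ⟨ε, rfl⟩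
        exact covectorJ_covector10 ε
      simp only [hbot, Submodule.bot_mul, Submodule.mem_bot] at ha
      exact ha ▸ h0

/-- The symbol of ∂̄: the part of type (0, 1) of the multiplication by ε is the multiplication by
ε^{0,1}. -/
lemma sum_typeProj_ι_mul_01 (ε : CxCovector E) (a : CxExt E) :
    ∑ p ∈ Finset.range (Module.finrank ℂ E + 1), ∑ q ∈ Finset.range (Module.finrank ℂ E + 1),
      typeProj p (q + 1) (ExteriorAlgebra.ι ℂ ε * typeProj p q a) =
        ExteriorAlgebra.ι ℂ (covector01 ε) * a := by
  induction a using CxExt.type_induction with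
  | h p q hp hq a ha =>
    refine (sum_typeProj_of_mem hp hq ha fun p q =>
      typeProj p (q + 1) ∘ₗ LinearMap.mulLeft ℂ (ExteriorAlgebra.ι ℂ ε)).trans ?_
    change typeProj p (q + 1) (ExteriorAlgebra.ι ℂ ε * a) = _
    conv_lhs => rw [← covector10_add_covector01 ε, map_add, add_mul, map_add]
    rw [typeProj_of_mem (mul_mem_typeSubmodule (ι_covector10_mem ε) ha),
      typeProj_of_mem (mul_mem_typeSubmodule (ι_covector01_mem ε) ha), if_neg (by omega),
      if_pos (by omega), zero_add]
  | hadd a b ha hb => simp only [map_add, mul_add, Finset.sum_add_distrib, ha, hb]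

lemma sum_typeProj_ι_mul_10 (ε : CxCovector E) (a : CxExt E) :
    ∑ p ∈ Finset.range (Module.finrank ℂ E + 1), ∑ q ∈ Finset.range (Module.finrank ℂ E + 1),
      typeProj (p + 1) q (ExteriorAlgebra.ι ℂ ε * typeProj p q a) =
        ExteriorAlgebra.ι ℂ (covector10 ε) * a := by
  induction a using CxExt.type_induction with
  | h p q hp hq a ha =>
    refine (sum_typeProj_of_mem hp hq ha fun p q =>
      typeProj (p + 1) q ∘ₗ LinearMap.mulLeft ℂ (ExteriorAlgebra.ι ℂ ε)).trans ?_
    change typeProj (p + 1) q (ExteriorAlgebra.ι ℂ ε * a) = _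
    conv_lhs => rw [← covector10_add_covector01 ε, map_add, add_mul, map_add]
    rw [typeProj_of_mem (mul_mem_typeSubmodule (ι_covector10_mem ε) ha),
      typeProj_of_mem (mul_mem_typeSubmodule (ι_covector01_mem ε) ha), if_pos (by omega),
      if_neg (by omega), add_zero]
  | hadd a b ha hb => simp only [map_add, mul_add, Finset.sum_add_distrib, ha, hb]

end ExtType

end


/-! ## The Dolbeault operators on smooth forms -/

noncomputable section

section DirectionalDerivative

variable {E : Type*} [NormedAddCommGroup E] [NormedSpace ℂ E] [FiniteDimensional ℂ E]

/-- The componentwise derivative of a form on `E` in the direction `v`. -/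
def dirDeriv (β : E → CxExt E) (y v : E) : CxExt E :=
  ∑ J, fderiv ℝ (fun z => (Module.finBasis ℂ (CxExt E)).coord J (β z)) y v •
    Module.finBasis ℂ (CxExt E) J

lemma CxExt.ext_dual {a b : CxExt E} (h : ∀ l : CxExt E →ₗ[ℂ] ℂ, l a = l b) : a = b :=
  (Module.finBasis ℂ (CxExt E)).ext_elem fun J => h ((Module.finBasis ℂ (CxExt E)).coord J)

lemma apply_dirDeriv {β : E → CxExt E} {y : E} (hβ : CompDiffAt β y) (l : CxExt E →ₗ[ℂ] ℂ)
    (v : E) : l (dirDeriv β y v) = fderiv ℝ (fun z => l (β z)) y v := by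
  set b := Module.finBasis ℂ (CxExt E) with hb
  have h : (fun z => l (β z)) = fun z => ∑ J, b.coord J (β z) * l (b J) := by
    ext z
    conv_lhs => rw [← b.sum_repr (β z), map_sum]
    exact Finset.sum_congr rfl fun J _ => by rw [map_smul]; rfl
  rw [h, fderiv_fun_sum fun J _ => (hβ (b.coord J)).mul_const _, dirDeriv, map_sum, sum_apply]
  refine Finset.sum_congr rfl fun J _ => ?_
  rw [fderiv_mul_const (hβ (b.coord J)), map_smul, smul_apply, smul_eq_mul, smul_eq_mul, mul_comm]

lemma dirDeriv_map {β : E → CxExt E} {y : E} (hβ : CompDiffAt β y) (P : CxExt E →ₗ[ℂ] CxExt E)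
    (v : E) : dirDeriv (fun z => P (β z)) y v = P (dirDeriv β y v) :=
  CxExt.ext_dual fun l => by
    rw [apply_dirDeriv fun l' => hβ (l' ∘ₗ P)]
    exact (apply_dirDeriv hβ (l ∘ₗ P) v).symm

lemma dirDeriv_conjForm {β : E → CxExt E} {y : E} (hβ : CompDiffAt β y)
    (hβ' : CompDiffAt (fun z => conjForm (β z)) y) (v : E) :
    dirDeriv (fun z => conjForm (β z)) y v = conjForm (dirDeriv β y v) :=
  CxExt.ext_dual fun l => by
    let l' : CxExt E →ₗ[ℂ] ℂ :=
      { toFun := fun a => conj (l (conjForm a))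
        map_add' := fun a b => by simp [conjForm_add]
        map_smul' := fun c a => by simp [conjForm_smul] }
    have h1 : ∀ a, l (conjForm a) = (Complex.conjCLE : ℂ →L[ℝ] ℂ) (l' a) := fun a => by simp [l']
    rw [apply_dirDeriv hβ', h1, apply_dirDeriv hβ]
    simp only [h1]
    exact congrArg (fun f : E →L[ℝ] ℂ => f v)
      ((Complex.conjCLE : ℂ →L[ℝ] ℂ).hasFDerivAt.comp y (hβ l').hasFDerivAt).fderiv

lemma dirDeriv_mul {β γ : E → CxExt E} {y : E} (hβ : CompDiffAt β y) (hγ : CompDiffAt γ y)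
    (v : E) : dirDeriv (fun z => β z * γ z) y v =
      dirDeriv β y v * γ y + β y * dirDeriv γ y v :=
  CxExt.ext_dual fun l => by
    set b := Module.finBasis ℂ (CxExt E) with hb
    have h : ∀ a c : CxExt E, l (a * c) = ∑ J, b.coord J a * l (b J * c) := fun a c => by
      conv_lhs => rw [← b.sum_repr a, Finset.sum_mul, map_sum]
      exact Finset.sum_congr rfl fun J _ => by rw [smul_mul_assoc, map_smul]; rfl
    rw [apply_dirDeriv (hβ.mul hγ), map_add, h, h,
      show (fun z => l (β z * γ z)) = fun z => ∑ J, b.coord J (β z) * l (b J * γ z) from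
        funext fun z => h _ _]
    have hl : ∀ J, DifferentiableAt ℝ (fun z => l (b J * γ z)) y := fun J =>
      hγ (l ∘ₗ LinearMap.mulLeft ℂ (b J))
    rw [fderiv_fun_sum fun J _ => (hβ (b.coord J)).fun_mul (hl J), sum_apply,
      ← Finset.sum_add_distrib]
    refine Finset.sum_congr rfl fun J _ => ?_
    have e : l (b J * dirDeriv γ y v) = fderiv ℝ (fun z => l (b J * γ z)) y v :=
      apply_dirDeriv hγ (l ∘ₗ LinearMap.mulLeft ℂ (b J)) v
    rw [fderiv_fun_mul (hβ (b.coord J)) (hl J), e, apply_dirDeriv hβ, add_apply, smul_apply,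
      smul_apply, smul_eq_mul, smul_eq_mul]
    ring

variable (E) in
/-- The covectors dual to the standard real basis of `E`. -/
def coordCovector (k : Fin (Module.finrank ℝ E)) : CxCovector E :=
  realCovector (LinearMap.toContinuousLinearMap ((Module.finBasis ℝ E).coord k))

lemma sum_coordCovector (h : CxCovector E) :
    ∑ k, h (Module.finBasis ℝ E k) • coordCovector E k = h := by
  ext w
  conv_rhs => rw [← (Module.finBasis ℝ E).sum_repr w, map_sum]
  rw [sum_apply]
  exact Finset.sum_congr rfl fun k _ => by
    rw [map_smul, Complex.real_smul]; exact mul_comm _ _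

/-- The component `∑ ρ(e^k) ∧ ∂_k β` of the exterior derivative in the directions in the image of
a projection `ρ` of covectors. -/
def extDWith (ρ : CxCovector E →ₗ[ℂ] CxCovector E) (β : E → CxExt E) (y : E) : CxExt E :=
  ∑ k, ExteriorAlgebra.ι ℂ (ρ (coordCovector E k)) * dirDeriv β y (Module.finBasis ℝ E k)

lemma extDWith_eq (ρ : CxCovector E →ₗ[ℂ] CxCovector E) (β : E → CxExt E) (y : E) :
    extDWith ρ β y = ∑ J, ExteriorAlgebra.ι ℂ
      (ρ (fderiv ℝ (fun z => (Module.finBasis ℂ (CxExt E)).coord J (β z)) y)) *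
        Module.finBasis ℂ (CxExt E) J := by
  simp only [extDWith, dirDeriv, Finset.mul_sum]
  rw [Finset.sum_comm]
  refine Finset.sum_congr rfl fun J _ => ?_
  conv_rhs => rw [← sum_coordCovector (fderiv ℝ (fun z =>
    (Module.finBasis ℂ (CxExt E)).coord J (β z)) y)]
  rw [map_sum, map_sum, Finset.sum_mul]
  exact Finset.sum_congr rfl fun k _ => by rw [map_smul, map_smul, smul_mul_assoc, mul_smul_comm]

lemma extDWith_id (β : E → CxExt E) (y : E) : extDWith LinearMap.id β y = extD β y :=
  extDWith_eq _ _ _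

/-- The product rule holds in each direction; the sign comes from moving the covector past the value
of β. Only this value needs to be homogeneous. -/
lemma extDWith_leibniz (ρ : CxCovector E →ₗ[ℂ] CxCovector E) {β γ : E → CxExt E} {y : E}
    (hβ : CompDiffAt β y) (hγ : CompDiffAt γ y) {i : ℤ} (hi : β y ∈ extDegree i) :
    extDWith ρ (fun z => β z * γ z) y =
      extDWith ρ β y * γ y + i.negOnePow • (β y * extDWith ρ γ y) := by
  simp only [extDWith, dirDeriv_mul hβ hγ, mul_add, Finset.sum_add_distrib, Finset.sum_mul,
    Finset.mul_sum, Finset.smul_sum, mul_assoc]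
  congr 1
  refine Finset.sum_congr rfl fun k _ => ?_
  rw [← mul_assoc (β y), mul_ι_of_mem hi, smul_mul_assoc, smul_smul, Int.units_mul_self, one_smul,
    mul_assoc]

lemma extDWith_mem (ρ : CxCovector E →ₗ[ℂ] CxCovector E) {β : E → CxExt E} {y : E}
    (hβ : CompDiffAt β y) {i : ℤ} (hi : ∀ z, β z ∈ extDegree i) :
    extDWith ρ β y ∈ extDegree (E := E) (i + 1) := by
  refine Submodule.sum_mem _ fun k _ => ι_mul_mem_extDegree _ ?_
  -- A directional derivative commutes with the linear projection onto degree i, so it stays in that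
  -- degree.
  have h : β = fun z => degreeProj i (β z) := by
    ext z
    rw [degreeProj_of_mem (hi z), if_pos rfl]
  rw [h, dirDeriv_map hβ]
  exact degreeProj_mem _ _

/-- The form dβ is a sum of products df_J ∧ B_J, where df_J is closed by the symmetry of second
derivatives and B_J is constant. -/
lemma extD_extD {β : E → CxExt E} {s : Set E} (hs : IsOpen s) (hβ : SmoothOn β s) {y : E}
    (hy : y ∈ s) : extD (extD β) y = 0 := by
  have h : ∀ J, ContDiffAt ℝ 2 (fun z => (Module.finBasis ℂ (CxExt E)).coord J (β z)) y := fun J =>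
    ((hβ _).contDiffAt (hs.mem_nhds hy)).of_le (WithTop.coe_le_coe.mpr (le_top : (2 : ℕ∞) ≤ ⊤))
  have hc : ∀ J, CompDiffAt (fun _ : E => Module.finBasis ℂ (CxExt E) J) y := fun J l =>
    differentiableAt_const _
  change extD (fun z => ∑ J, ExteriorAlgebra.ι ℂ
    (fderiv ℝ (fun z => (Module.finBasis ℂ (CxExt E)).coord J (β z)) z) *
      Module.finBasis ℂ (CxExt E) J) y = 0
  rw [extD_sum _ fun J _ => (extD_ι_fderiv (h J)).1.mul (hc J)]
  exact Finset.sum_eq_zero fun J _ =>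
    extD_ι_mul (extD_ι_fderiv (h J)).1 (hc J) (extD_ι_fderiv (h J)).2 (extD_const _ _)

end DirectionalDerivative

/-! ### The operators ∂ and ∂̄ in the chart at each point, and ∂̄² = 0. -/

section Manifold

variable {E : Type*} [NormedAddCommGroup E] [NormedSpace ℂ E]
  {M : Type*} [TopologicalSpace M] [ChartedSpace E M] [IsManifold 𝓘(ℂ, E) ω M]

/-- At x itself the frame of the chart at x is the identity, so pointwise identities can be read off
in that chart without any change of frame. -/
lemma chartRep_self (x : M) (α : M → CxExt E) :
    chartRep x α (extChartAt 𝓘(ℂ, E) x x) = α x := by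
  have h : chartFrame x (extChartAt 𝓘(ℂ, E) x x) = ContinuousLinearMap.id ℂ E := by
    ext v
    have h2 := (extChartAt 𝓘(ℂ, E) x).left_inv (mem_extChartAt_source x)
    rw [chartFrame, h2]
    exact tangentCoordChange_self (mem_extChartAt_source x)
  rw [chartRep, h, pullExt_id, (extChartAt 𝓘(ℂ, E) x).left_inv (mem_extChartAt_source x)]

variable [FiniteDimensional ℂ E]

/-- The operator on forms that applies to all values a linear map commuting with pull-backs. -/
def naturalOp (P : CxExt E →ₗ[ℂ] CxExt E) (hP : ∀ T a, P (pullExt T a) = pullExt T (P a)) :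
    Module.End ℂ (smoothForms E M) where
  toFun α := ⟨fun x => P (α.1 x), fun x₀ => ((α.2 x₀).map P).congr fun _ _ => (hP _ _).symm⟩
  map_add' _ _ := Subtype.ext <| funext fun _ => map_add P _ _
  map_smul' c α := Subtype.ext <| funext fun x => map_smul P c (α.1 x)

lemma extD_typeProj {β : E → CxExt E} {y : E} (hβ : CompDiffAt β y) (p q : ℕ) :
    extD (fun z => typeProj p q (β z)) y = ∑ k, ExteriorAlgebra.ι ℂ (coordCovector E k) *
      typeProj p q (dirDeriv β y (Module.finBasis ℝ E k)) := by
  rw [← extDWith_id, extDWith]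
  exact Finset.sum_congr rfl fun k _ => by rw [dirDeriv_map hβ]; rfl

lemma chartRep_formTypeProj (p q : ℕ) (α : smoothForms E M) (x : M) :
    chartRep x (formTypeProj p q α).1 = fun z => typeProj p q (chartRep x α.1 z) :=
  funext fun _ => (typeProj_pull _ p q _).symm

lemma exteriorDerivative_apply (α : smoothForms E M) (x : M) :
    (exteriorDerivative E M α).1 x =
      extDWith LinearMap.id (chartRep x α.1) (extChartAt 𝓘(ℂ, E) x x) :=
  (extDWith_id _ _).symm

lemma coe_sum_apply {κ : Type*} (t : Finset κ) (f : κ → Module.End ℂ (smoothForms E M))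
    (α : smoothForms E M) (x : M) : ((∑ i ∈ t, f i) α).1 x = ∑ i ∈ t, (f i α).1 x := by
  classical
  induction t using Finset.induction_on with
  | empty => rfl
  | insert i t hi ih => rw [Finset.sum_insert hi, Finset.sum_insert hi, ← ih]; rfl

lemma typeProj_exteriorDerivative_formTypeProj (p q p' q' : ℕ) (α : smoothForms E M) (x : M) :
    ((formTypeProj p' q' * exteriorDerivative E M * formTypeProj p q :
      Module.End ℂ (smoothForms E M)) α).1 x =
      ∑ k, typeProj p' q' (ExteriorAlgebra.ι ℂ (coordCovector E k) * typeProj p q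
        (dirDeriv (chartRep x α.1) (extChartAt 𝓘(ℂ, E) x x) (Module.finBasis ℝ E k))) := by
  change typeProj p' q' (extD (chartRep x (formTypeProj p q α).1) _) = _
  rw [chartRep_formTypeProj, extD_typeProj (chartRep_compDiffAt α.2 x), map_sum]

/-- Type projections have constant coefficients and commute with directional derivatives, so the sum
over types collapses to ∑ (e^k)^{0,1} ∧ ∂_k by `sum_typeProj_ι_mul_01`. -/
lemma dbarOp_apply (α : smoothForms E M) (x : M) : (dbarOp E M α).1 x =
    extDWith covector01 (chartRep x α.1) (extChartAt 𝓘(ℂ, E) x x) := by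
  rw [dbarOp, coe_sum_apply]
  simp only [coe_sum_apply, typeProj_exteriorDerivative_formTypeProj]
  simp only [extDWith, ← sum_typeProj_ι_mul_01]
  rw [Finset.sum_comm (s := Finset.univ)]
  exact Finset.sum_congr rfl fun p _ => Finset.sum_comm

lemma partialOp_apply (α : smoothForms E M) (x : M) : (partialOp E M α).1 x =
    extDWith covector10 (chartRep x α.1) (extChartAt 𝓘(ℂ, E) x x) := by
  rw [partialOp, coe_sum_apply]
  simp only [coe_sum_apply, typeProj_exteriorDerivative_formTypeProj]
  simp only [extDWith, ← sum_typeProj_ι_mul_10]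
  rw [Finset.sum_comm (s := Finset.univ)]
  exact Finset.sum_congr rfl fun p _ => Finset.sum_comm

lemma partialOp_add_dbarOp : partialOp E M + dbarOp E M = exteriorDerivative E M :=
  LinearMap.ext fun α => Subtype.ext <| funext fun x => by
    change (partialOp E M α).1 x + (dbarOp E M α).1 x = _
    rw [partialOp_apply, dbarOp_apply, exteriorDerivative_apply]
    simp only [extDWith, ← Finset.sum_add_distrib, ← add_mul, ← map_add,
      covector10_add_covector01, LinearMap.id_apply]

lemma exteriorDerivative_mul_self : exteriorDerivative E M * exteriorDerivative E M = 0 :=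
  LinearMap.ext fun α => Subtype.ext <| funext fun x => by
    change extD (chartRep x (extDFun α.1)) (extChartAt 𝓘(ℂ, E) x x) = 0
    have hev : chartRep x (extDFun α.1) =ᶠ[nhds (extChartAt 𝓘(ℂ, E) x x)]
        extD (chartRep x α.1) := by
      filter_upwards [(isOpen_extChartAt_target (I := 𝓘(ℂ, E)) x).mem_nhds
        (mem_extChartAt_target x)] with y hy
      exact chartRep_extDFun α.2 x hy
    rw [extD_congr hev]
    exact extD_extD (isOpen_extChartAt_target x) (α.2 x) (mem_extChartAt_target x)

/-- The operator that multiplies the forms of type `(p, q)` by `s ^ p * (conj s) ^ q`. -/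
def formScale (s : ℂ) : Module.End ℂ (smoothForms E M) :=
  naturalOp (scaleExt s).toLinearMap fun T a => scaleExt_pull s T a

lemma chartRep_formScale (s : ℂ) (α : smoothForms E M) (x : M) :
    chartRep x (formScale s α).1 = fun z => scaleExt s (chartRep x α.1 z) :=
  funext fun _ => (scaleExt_pull s _ _).symm

lemma extDWith_scaleExt {ρ : CxCovector E →ₗ[ℂ] CxCovector E} {s c : ℂ}
    (hρ : ∀ ε, scaleCovector s (ρ ε) = c • ρ ε) {β : E → CxExt E} {y : E} (hβ : CompDiffAt β y) :
    scaleExt s (extDWith ρ β y) = c • extDWith ρ (fun z => scaleExt s (β z)) y := by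
  simp only [extDWith, map_sum, map_mul, scaleExt_ι, hρ, Finset.smul_sum, map_smul, smul_mul_assoc]
  exact Finset.sum_congr rfl fun k _ => by
    rw [← AlgHom.toLinearMap_apply, ← dirDeriv_map hβ]; rfl

/-- The operator ∂̄ adds one covector of type (0, 1), which scales by the conjugate of s. -/
lemma formScale_mul_dbarOp (s : ℂ) :
    formScale s * dbarOp E M = conj s • (dbarOp E M * formScale s) :=
  LinearMap.ext fun α => Subtype.ext <| funext fun x => by
    change scaleExt s ((dbarOp E M α).1 x) = conj s • (dbarOp E M (formScale s α)).1 x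
    rw [dbarOp_apply, dbarOp_apply, chartRep_formScale,
      extDWith_scaleExt (scaleCovector_covector01 s) (chartRep_compDiffAt α.2 x)]

lemma formScale_mul_partialOp (s : ℂ) :
    formScale s * partialOp E M = s • (partialOp E M * formScale s) :=
  LinearMap.ext fun α => Subtype.ext <| funext fun x => by
    change scaleExt s ((partialOp E M α).1 x) = s • (partialOp E M (formScale s α)).1 x
    rw [partialOp_apply, partialOp_apply, chartRep_formScale,
      extDWith_scaleExt (scaleCovector_covector10 s) (chartRep_compDiffAt α.2 x)]

lemma formScale_mul_formScale (s t : ℂ) :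
    formScale s * formScale t = formScale (E := E) (M := M) (s * t) :=
  LinearMap.ext fun α => Subtype.ext <| funext fun x => scaleExt_scaleExt s t (α.1 x)

lemma formScale_one : formScale (E := E) (M := M) 1 = 1 :=
  LinearMap.ext fun α => Subtype.ext <| funext fun x => scaleExt_one (α.1 x)

lemma conj_add_mul_add {B : Type*} [Ring B] [Algebra ℂ B] {s r : ℂ} (t t' p q : B)
    (ht : t * t' = 1) (hp : t * p = s • (p * t)) (hq : t * q = r • (q * t)) :
    t * ((p + q) * (p + q)) * t' = (s * s) • (p * p) + (s * r) • (p * q + q * p) +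
      (r * r) • (q * q) := by
  have e : ∀ {c c' : ℂ} {a b : B}, t * a = c • (a * t) → t * b = c' • (b * t) →
      t * (a * b) * t' = (c * c') • (a * b) := fun {c c' a b} ha hb => by
    rw [← mul_assoc t, ha, smul_mul_assoc, mul_assoc a, hb, mul_smul_comm, smul_smul,
      smul_mul_assoc, mul_assoc, mul_assoc, ht, mul_one]
  simp only [add_mul, mul_add, e hp hp, e hp hq, e hq hp, e hq hq, smul_add, mul_comm r s]
  abel

/-- The hypotheses are the weight equations for s = 1, i and 1 + i. The combination with
coefficients 1 + i, 1 - i and -1 eliminates P and Q and leaves 4 i R. -/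
lemma eq_zero_of_weights {V : Type*} [AddCommGroup V] [Module ℂ V] {P Q R : V}
    (h1 : (1 : ℂ) • P + (1 : ℂ) • Q + (1 : ℂ) • R = 0)
    (h2 : (-1 : ℂ) • P + (1 : ℂ) • Q + (-1 : ℂ) • R = 0)
    (h3 : (2 * Complex.I) • P + (2 : ℂ) • Q + (-(2 * Complex.I)) • R = 0) : R = 0 := by
  have h : (4 * Complex.I) • R = 0 := by
    have e : (4 * Complex.I) • R = (1 + Complex.I) • ((1 : ℂ) • P + (1 : ℂ) • Q + (1 : ℂ) • R) +
        (1 - Complex.I) • ((-1 : ℂ) • P + (1 : ℂ) • Q + (-1 : ℂ) • R) -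
        ((2 * Complex.I) • P + (2 : ℂ) • Q + (-(2 * Complex.I)) • R) := by module
    rw [e, h1, h2, h3, smul_zero, smul_zero, add_zero, sub_zero]
  exact (smul_eq_zero.mp h).resolve_left (by simp)

/-- Conjugation of d² = (∂ + ∂̄)² = 0 with `formScale s` multiplies the three parts of d² by their
weights. -/
lemma sq_smul_partialOp_add (s : ℂ) (hs : s ≠ 0) :
    (s * s) • (partialOp E M * partialOp E M) +
      (s * conj s) • (partialOp E M * dbarOp E M + dbarOp E M * partialOp E M) +
        (conj s * conj s) • (dbarOp E M * dbarOp E M) = 0 := by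
  have h0 : (partialOp E M + dbarOp E M) * (partialOp E M + dbarOp E M) = 0 := by
    rw [partialOp_add_dbarOp, exteriorDerivative_mul_self]
  have h1 : formScale s * ((partialOp E M + dbarOp E M) * (partialOp E M + dbarOp E M)) *
      formScale s⁻¹ = 0 := by rw [h0, mul_zero, zero_mul]
  have ht : formScale (E := E) (M := M) s * formScale s⁻¹ = 1 := by
    rw [formScale_mul_formScale, mul_inv_cancel₀ hs, formScale_one]
  have h2 := conj_add_mul_add (formScale s) (formScale s⁻¹) (partialOp E M) (dbarOp E M) ht
    (formScale_mul_partialOp s) (formScale_mul_dbarOp s)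
  exact h2.symm.trans h1

lemma dbarOp_mul_self : dbarOp E M * dbarOp E M = 0 := by
  have h1 := sq_smul_partialOp_add (E := E) (M := M) 1 one_ne_zero
  have h2 := sq_smul_partialOp_add (E := E) (M := M) Complex.I Complex.I_ne_zero
  have h3 := sq_smul_partialOp_add (E := E) (M := M) (1 + Complex.I) (by
    intro h; simpa using congrArg Complex.re h)
  have c3 : (1 + Complex.I) * (1 + Complex.I) = 2 * Complex.I := by
    linear_combination Complex.I_mul_I
  have c3' : (1 + Complex.I) * conj (1 + Complex.I) = 2 := by
    simp only [map_add, map_one, Complex.conj_I]; linear_combination -Complex.I_mul_I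
  have c3'' : conj (1 + Complex.I) * conj (1 + Complex.I) = -(2 * Complex.I) := by
    simp only [map_add, map_one, Complex.conj_I]; linear_combination Complex.I_mul_I
  have c2 : Complex.I * conj Complex.I = 1 := by
    rw [Complex.conj_I]; linear_combination -Complex.I_mul_I
  have c2' : conj Complex.I * conj Complex.I = -1 := by
    rw [Complex.conj_I]; linear_combination Complex.I_mul_I
  rw [c3, c3', c3''] at h3
  rw [Complex.I_mul_I, c2, c2'] at h2
  rw [map_one, mul_one] at h1
  refine LinearMap.ext fun α => Subtype.ext <| funext fun x => ?_
  exact eq_zero_of_weights (congrArg (fun f : Module.End ℂ (smoothForms E M) => (f α).1 x) h1)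
    (congrArg (fun f : Module.End ℂ (smoothForms E M) => (f α).1 x) h2)
    (congrArg (fun f : Module.End ℂ (smoothForms E M) => (f α).1 x) h3)

end Manifold

end


/-! ## The graded algebra of smooth forms and its pointwise operators -/

noncomputable section

section FormAlgebra

variable {E : Type*} [NormedAddCommGroup E] [NormedSpace ℂ E] [FiniteDimensional ℂ E]
  {M : Type*} [TopologicalSpace M] [ChartedSpace E M] [IsManifold 𝓘(ℂ, E) ω M]

lemma coe_finset_sum_apply {κ : Type*} (t : Finset κ) (f : κ → smoothForms E M) (x : M) :
    (∑ i ∈ t, f i).1 x = ∑ i ∈ t, (f i).1 x := by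
  classical
  induction t using Finset.induction_on with
  | empty => rfl
  | insert i t hi ih => rw [Finset.sum_insert hi, Finset.sum_insert hi, ← ih]; rfl

/-- The fibrewise degree projections commute with pull-backs and hence act on smooth forms; finitely
many of them, in degrees 0 to 2 n, add up to the identity. -/
lemma formDegree_isInternal : DirectSum.IsInternal (formDegree E M) := by
  refine isInternal_of_proj (fun k => naturalOp (degreeProj k) fun T a => degreeProj_pull T k a)
    (fun j k a ha => Subtype.ext <| funext fun x => ?_) (fun k a x => degreeProj_mem k (a.1 x))
    (Finset.Icc (0 : ℤ) (2 * Module.finrank ℂ E)) fun a => Subtype.ext <| funext fun x => ?_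
  · change degreeProj k (a.1 x) = _
    rw [degreeProj_of_mem (ha x)]
    split_ifs <;> rfl
  · rw [coe_finset_sum_apply]
    exact sum_degreeProj (a.1 x)

instance formDegree_gradedMonoid : SetLike.GradedMonoid (formDegree E M) where
  one_mem := fun _ => SetLike.GradedOne.one_mem (A := extDegree (E := E))
  mul_mem := fun _ _ _ _ ha hb x => SetLike.mul_mem_graded (ha x) (hb x)

lemma units_smul_apply (u : ℤˣ) (α : smoothForms E M) (x : M) : (u • α).1 x = u • α.1 x := by
  rcases Int.units_eq_one_or u with rfl | rfl
  · rw [one_smul, one_smul]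
  · rw [Units.neg_smul, Units.neg_smul, one_smul, one_smul]; rfl

lemma formDegree_graded_comm (i j : ℤ) (α : smoothForms E M) (hα : α ∈ formDegree E M i)
    (β : smoothForms E M) (hβ : β ∈ formDegree E M j) :
    α * β = (i * j).negOnePow • (β * α) :=
  Subtype.ext <| funext fun x => by
    rw [units_smul_apply]
    exact extDegree_graded_comm i j _ (hα x) _ (hβ x)

lemma chartRep_mul (x : M) (α β : smoothForms E M) :
    chartRep x (α * β).1 = fun z => chartRep x α.1 z * chartRep x β.1 z :=
  funext fun _ => map_mul _ _ _

lemma dbarOp_hasDegree : HasDegree (formDegree E M) 1 (dbarOp E M) := fun k α hα x => by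
  rw [dbarOp_apply]
  exact extDWith_mem _ (chartRep_compDiffAt α.2 x) fun z => pullExt_mem _ (hα _)

lemma dbarOp_leibniz (i : ℤ) (α : smoothForms E M) (hα : α ∈ formDegree E M i)
    (β : smoothForms E M) :
    dbarOp E M (α * β) = dbarOp E M α * β + i.negOnePow • (α * dbarOp E M β) :=
  Subtype.ext <| funext fun x => by
    change _ = (dbarOp E M α).1 x * β.1 x + (i.negOnePow • (α * dbarOp E M β)).1 x
    rw [units_smul_apply]
    change _ = (dbarOp E M α).1 x * β.1 x + i.negOnePow • (α.1 x * (dbarOp E M β).1 x)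
    rw [dbarOp_apply, dbarOp_apply, dbarOp_apply, chartRep_mul,
      extDWith_leibniz _ (chartRep_compDiffAt α.2 x) (chartRep_compDiffAt β.2 x)
        (i := i) (pullExt_mem _ (hα _)), chartRep_self, chartRep_self]

lemma hasOrderLE_dbarOp : HasOrderLE (formDegree E M) 1 1 (dbarOp E M) :=
  HasOrderLE.of_derivation (𝒜 := formDegree E M) (d := dbarOp E M) formDegree_graded_comm
    dbarOp_hasDegree fun i α hα β => (mul_one i).symm ▸ dbarOp_leibniz i α hα β

lemma conjForm_extDWith {β : E → CxExt E} {y : E} (hβ : CompDiffAt β y)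
    (hβ' : CompDiffAt (fun z => conjForm (β z)) y) :
    conjForm (extDWith covector10 β y) = extDWith covector01 (fun z => conjForm (β z)) y := by
  rw [extDWith, conjForm_sum]
  refine Finset.sum_congr rfl fun k _ => ?_
  rw [conjForm_mul, conjForm_ι, conjCovector_covector10, dirDeriv_conjForm hβ hβ', coordCovector,
    conjCovector_realCovector]

/-- Conjugation exchanges the two types of covectors and commutes with real directional derivatives.
For the real form ω it gives that ∂̄ω is the conjugate of ∂ω. -/
lemma conjForm_partialOp {α β : smoothForms E M} (h : ∀ x, β.1 x = conjForm (α.1 x)) (x : M) :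
    conjForm ((partialOp E M α).1 x) = (dbarOp E M β).1 x := by
  have e : chartRep x β.1 = fun z => conjForm (chartRep x α.1 z) := funext fun z => by
    rw [chartRep, h, ← conjForm_pull]
    rfl
  have hβ := chartRep_compDiffAt β.2 x
  rw [e] at hβ
  rw [partialOp_apply, dbarOp_apply, e, conjForm_extDWith (chartRep_compDiffAt α.2 x) hβ]

/-- The reversal `ε₁ ∧ ⋯ ∧ ε_k ↦ ε_k ∧ ⋯ ∧ ε₁` of forms. -/
def formReverse : Module.End ℂ (smoothForms E M) :=
  naturalOp CliffordAlgebra.reverse fun T a => reverse_pull T a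

lemma formReverse_of_mem {k : ℤ} {α : smoothForms E M} (hα : α ∈ formDegree E M k) :
    formReverse α = (k * (k - 1) / 2).negOnePow • α :=
  Subtype.ext <| funext fun x => by
    rw [units_smul_apply]
    exact reverse_of_mem (hα x)

lemma formScale_neg_one_of_mem {k : ℤ} {α : smoothForms E M} (hα : α ∈ formDegree E M k) :
    formScale (-1) α = k.negOnePow • α :=
  Subtype.ext <| funext fun x => by
    rw [units_smul_apply]
    exact scaleExt_neg_one_of_mem (hα x)

lemma negOnePow_triangle_succ (k : ℤ) :
    ((k + 1) * (k + 1 - 1) / 2).negOnePow = k.negOnePow * (k * (k - 1) / 2).negOnePow := by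
  obtain ⟨m, hm⟩ := Int.even_mul_pred_self k
  have h1 : k * (k - 1) / 2 = m := by omega
  have h2 : (k + 1) * (k + 1 - 1) = 2 * (k + m) := by linear_combination hm
  rw [h1, h2, Int.mul_ediv_cancel_left _ two_ne_zero, Int.negOnePow_add]

lemma negOnePow_triangle_add_two (k : ℤ) :
    ((k + 2) * (k + 2 - 1) / 2).negOnePow = -(k * (k - 1) / 2).negOnePow := by
  rw [show k + 2 = k + 1 + 1 by ring, negOnePow_triangle_succ, negOnePow_triangle_succ,
    Int.negOnePow_succ, ← mul_assoc, neg_mul, Int.units_mul_self, neg_mul, one_mul]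

lemma map_units_smul (f : Module.End ℂ (smoothForms E M)) (u : ℤˣ) (α : smoothForms E M) :
    f (u • α) = u • f α := by
  rcases Int.units_eq_one_or u with rfl | rfl
  · rw [one_smul, one_smul]
  · rw [Units.neg_smul, Units.neg_smul, one_smul, one_smul, map_neg]

/-- The sign (-1)^{k(k-1)/2} of the reversal changes by (-1)^k from degree k to k + 1, and
`formScale (-1)` is the operator with this sign. -/
lemma formReverse_mul_of_degree_one {f : Module.End ℂ (smoothForms E M)}
    (hf : HasDegree (formDegree E M) 1 f) :
    formReverse * f = f * formScale (-1) * formReverse :=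
  End.ext_homogeneous formDegree_isInternal fun j α hα => by
    change formReverse (f α) = f (formScale (-1) (formReverse α))
    rw [formReverse_of_mem (hf j α hα), formReverse_of_mem hα, map_units_smul,
      formScale_neg_one_of_mem hα, map_units_smul, map_units_smul, smul_smul,
      negOnePow_triangle_succ, mul_comm]

lemma formReverse_mul_of_degree_two {f : Module.End ℂ (smoothForms E M)}
    (hf : HasDegree (formDegree E M) 2 f) : formReverse * f = -f * formReverse :=
  End.ext_homogeneous formDegree_isInternal fun j α hα => by
    change formReverse (f α) = -f (formReverse α)
    rw [formReverse_of_mem (hf j α hα), formReverse_of_mem hα, map_units_smul,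
      negOnePow_triangle_add_two, Units.neg_smul]

lemma formReverse_mul_of_degree_neg_two {f : Module.End ℂ (smoothForms E M)}
    (hf : HasDegree (formDegree E M) (-2) f) : formReverse * f = -f * formReverse :=
  End.ext_homogeneous formDegree_isInternal fun j α hα => by
    change formReverse (f α) = -f (formReverse α)
    have h := negOnePow_triangle_add_two (j + -2)
    rw [show j + -2 + 2 = j by ring] at h
    rw [formReverse_of_mem (hf j α hα), formReverse_of_mem hα, map_units_smul,
      h, Units.neg_smul, neg_neg]

lemma formReverse_mul_self : formReverse * formReverse = (1 : Module.End ℂ (smoothForms E M)) :=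
  LinearMap.ext fun α => Subtype.ext <| funext fun x => CliffordAlgebra.reverse_reverse (α.1 x)

lemma formReverse_mul_formScale (s : ℂ) : formReverse * formScale s =
    (formScale s * formReverse : Module.End ℂ (smoothForms E M)) :=
  LinearMap.ext fun α => Subtype.ext <| funext fun x => reverse_pull _ (α.1 x)

/-- The operator `F` on forms acts on the values at each point `x` by `f x`. -/
def IsPointwise (F : Module.End ℂ (smoothForms E M)) (f : M → Module.End ℂ (CxExt E)) : Prop :=
  ∀ α x, (F α).1 x = f x (α.1 x)

namespace IsPointwise

variable {F G : Module.End ℂ (smoothForms E M)} {f h : M → Module.End ℂ (CxExt E)}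

lemma mul (hF : IsPointwise F f) (hG : IsPointwise G h) :
    IsPointwise (F * G) fun x => f x * h x := fun α x => by
  change (F (G α)).1 x = f x (h x (α.1 x))
  rw [hF, hG]

lemma smul (hF : IsPointwise F f) (c : ℂ) : IsPointwise (c • F) fun x => c • f x := fun α x =>
  congrArg (c • ·) (hF α x)

lemma neg (hF : IsPointwise F f) : IsPointwise (-F) fun x => -f x := fun α x =>
  congrArg Neg.neg (hF α x)

lemma pow (hF : IsPointwise F f) (n : ℕ) : IsPointwise (F ^ n) fun x => f x ^ n := by
  induction n with
  | zero => exact fun _ _ => rfl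
  | succ n ih =>
    simp only [pow_succ]
    exact ih.mul hF

lemma sum {κ : Type*} (t : Finset κ) {F : κ → Module.End ℂ (smoothForms E M)}
    {f : κ → M → Module.End ℂ (CxExt E)} (hF : ∀ i, IsPointwise (F i) (f i)) :
    IsPointwise (∑ i ∈ t, F i) fun x => ∑ i ∈ t, f i x := fun α x => by
  rw [coe_sum_apply, LinearMap.sum_apply]
  exact Finset.sum_congr rfl fun i _ => hF i α x

lemma ext (hF : IsPointwise F f) (hG : IsPointwise G h) (e : ∀ x, f x = h x) : F = G :=
  LinearMap.ext fun α => Subtype.ext <| funext fun x => by rw [hF, hG, e]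

lemma mulLeft (β : smoothForms E M) :
    IsPointwise (LinearMap.mulLeft ℂ β) fun x => LinearMap.mulLeft ℂ (β.1 x) := fun _ _ => rfl

lemma gradedComm (hF : IsPointwise F f) (hG : IsPointwise G h) (j k : ℤ) :
    IsPointwise (gradedComm j k F G) fun x => _root_.gradedComm j k (f x) (h x) := fun α x => by
  change ((F * G) α).1 x - ((j * k).negOnePow • (G * F) α).1 x =
    (f x * h x) (α.1 x) - (j * k).negOnePow • (h x * f x) (α.1 x)
  rw [units_smul_apply, hF.mul hG, hG.mul hF]

/-- The exponent n is common to all points, so all the exponentials are given by the same finite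
sum. -/
lemma nilExp (hF : IsPointwise F f) {n : ℕ} (hn : ∀ x, f x ^ n = 0) :
    F ^ n = 0 ∧ IsPointwise (nilExp ℂ F) fun x => _root_.nilExp ℂ (f x) := by
  have h0 : F ^ n = 0 :=
    LinearMap.ext fun α => Subtype.ext <| funext fun x => 
      (hF.pow n α x).trans (congrArg (fun a : Module.End ℂ (CxExt E) => a (α.1 x)) (hn x))
  refine ⟨h0, ?_⟩
  have e := nilExp_eq_sum (K := ℂ) (B := Module.End ℂ (smoothForms E M)) (a := F) h0
  rw [e]
  simp only [nilExp_eq_sum (hn _)]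
  exact IsPointwise.sum _ fun i => (hF.pow i).smul _

lemma hasDegree (hF : IsPointwise F f) {k : ℤ} (hf : ∀ x, HasDegree extDegree k (f x)) :
    HasDegree (formDegree E M) k F := fun j α hα x => by
  rw [hF]
  exact hf x j _ (hα x)

/-- The order of a pointwise operator is at most that of its values. -/
lemma hasOrderLE (hF : IsPointwise F f) {r : ℕ} {k : ℤ}
    (hf : ∀ x, HasOrderLE extDegree r k (f x)) : HasOrderLE (formDegree E M) r k F := by
  induction r generalizing k F f with
  | zero =>
    refine ⟨hF.hasDegree fun x => (hf x).1, fun j α hα => ?_⟩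
    refine ((mulLeft α).gradedComm hF j k).ext (h := fun _ => 0) (fun _ _ => rfl) fun x => ?_
    exact (hf x).2 j _ (hα x)
  | succ r ih =>
    refine ⟨hF.hasDegree fun x => (hf x).1, fun j α hα => ?_⟩
    exact ih ((mulLeft α).gradedComm hF j k) fun x => (hf x).2 j _ (hα x)

end IsPointwise

end FormAlgebra

end


/-! ## The Hodge star and the Weyl element -/

section WeylStar

variable {K B : Type*} [Field K] [CharZero K] [Ring B] [Algebra K B]

lemma mul_nilExp_of_mul_eq {r a b : B} (h : r * a = b * r) (ha : IsNilpotent a)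
    (hb : IsNilpotent b) : r * nilExp K a = nilExp K b * r := by
  obtain ⟨k, hk⟩ := ha
  obtain ⟨m, hm⟩ := hb
  rw [nilExp_eq_sum (pow_eq_zero_of_le (le_max_left k m) hk),
    nilExp_eq_sum (pow_eq_zero_of_le (le_max_right k m) hm), Finset.mul_sum, Finset.sum_mul]
  refine Finset.sum_congr rfl fun i _ => ?_
  have hi : r * a ^ i = b ^ i * r := (SemiconjBy.pow_right h i).eq
  rw [mul_smul_comm, hi, smul_mul_assoc]

lemma mul_weylOp_of_comm {r L Λ : B} (hL : IsNilpotent L) (hΛ : IsNilpotent Λ)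
    (hrL : r * L = L * r) (hrΛ : r * Λ = Λ * r) : r * weylOp K L Λ = weylOp K L Λ * r := by
  have h1 := mul_nilExp_of_mul_eq (K := K) (r := r) (a := -L) (b := -L)
    (by rw [mul_neg, neg_mul, hrL]) hL.neg hL.neg
  have h2 := mul_nilExp_of_mul_eq (K := K) hrΛ hΛ hΛ
  rw [weylOp, ← mul_assoc, ← mul_assoc, h1, mul_assoc _ r, h2, mul_assoc, mul_assoc, h1]
  simp only [mul_assoc]

/-- Moving r past an exponential inverts it. Since W is a palindrome in its factors, r W = W⁻¹ r. -/
lemma mul_weylOp_of_anticomm {r L Λ : B} (hL : IsNilpotent L) (hΛ : IsNilpotent Λ)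
    (hrL : r * L = -L * r) (hrΛ : r * Λ = -Λ * r) :
    weylOp K L Λ * r * weylOp K L Λ = r := by
  have h1 := mul_nilExp_of_mul_eq (K := K) (r := r) (a := -L) (b := L)
    (by rw [mul_neg, hrL, neg_mul, neg_neg]) hL.neg hL
  have h2 := mul_nilExp_of_mul_eq (K := K) hrΛ hΛ hΛ.neg
  have e1 : nilExp K (-L) * (r * nilExp K (-L)) = r := by
    rw [h1, ← mul_assoc, nilExp_neg_mul_nilExp hL, one_mul]
  have e2 : nilExp K Λ * (r * nilExp K Λ) = r := by
    rw [h2, ← mul_assoc, nilExp_mul_nilExp_neg hΛ, one_mul]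
  calc weylOp K L Λ * r * weylOp K L Λ
      = nilExp K (-L) * (nilExp K Λ * (nilExp K (-L) * (r * nilExp K (-L))) * nilExp K Λ) *
          nilExp K (-L) := by simp only [weylOp, mul_assoc]
    _ = r := by rw [e1, mul_assoc (nilExp K Λ), e2, mul_assoc, e1]

end WeylStar

section ComplexWeylStar

variable {B : Type*} [Ring B] [Algebra ℂ B]

/-- The Weyl element conjugates `d` into `i ⋆ d ⋆` for `⋆ = ± W j r`. -/
lemma weylOp_mul_eq_star_conj {L Λ j r d σ s : B} {c : ℂ} (hL : IsNilpotent L)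
    (hΛ : IsNilpotent Λ) (hjL : j * L = L * j) (hjΛ : j * Λ = Λ * j) (hrL : r * L = -L * r)
    (hrΛ : r * Λ = -Λ * r) (hrj : r * j = j * r) (hrr : r * r = 1) (hjj : j * j = σ)
    (hσσ : σ * σ = 1) (hjd : j * d = (-Complex.I) • (d * j)) (hσd : σ * d = -(d * σ))
    (hrd : r * d = d * σ * r) (hc : c * c = 1) (hs : s = c • (weylOp ℂ L Λ * (j * r))) :
    weylOp ℂ L Λ * d = ((-Complex.I) • (-(s * d * s))) * weylOp ℂ L Λ := by
  have hjW := mul_weylOp_of_comm (K := ℂ) hL hΛ hjL hjΛ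
  have hrW := mul_weylOp_of_anticomm (K := ℂ) hL hΛ hrL hrΛ
  set W := weylOp ℂ L Λ
  have e1 : W * (j * r) * W = j * r := by
    -- As j commutes with W and W r W = r, the two Weyl elements in ⋆ d ⋆ W on either side of j r
    -- cancel.
    rw [← mul_assoc W, ← hjW, mul_assoc, mul_assoc, ← mul_assoc W, hrW]
  have hdj : d * j = Complex.I • (j * d) := by
    rw [hjd, smul_smul, mul_neg, Complex.I_mul_I, neg_neg, one_smul]
  -- The factor i comes from moving j past d. What remains is σ d σ with σ = j², and it equals -d
  -- because σ anticommutes with d.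
  have e2 : j * r * d * (j * r) = (-Complex.I) • d := by
    calc j * r * d * (j * r) = j * r * (d * j) * r := by simp only [mul_assoc]
      _ = Complex.I • (j * (r * j) * d * r) := by
        rw [hdj, mul_smul_comm, smul_mul_assoc]; simp only [mul_assoc]
      _ = Complex.I • (j * j * (r * d) * r) := by rw [hrj]; simp only [mul_assoc]
      _ = Complex.I • (σ * d * σ * (r * r)) := by rw [hrd, hjj]; simp only [mul_assoc]
      _ = (-Complex.I) • d := by
        rw [hrr, mul_one, hσd, neg_mul, mul_assoc, hσσ, mul_one, smul_neg, neg_smul]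
  have e3 : s * d * s * W = W * ((-Complex.I) • d) := by
    calc s * d * s * W = (c * c) • (W * (j * r) * d * (W * (j * r) * W)) := by
          rw [hs, smul_mul_assoc, smul_mul_assoc, mul_smul_comm, smul_mul_assoc, smul_mul_assoc,
            smul_smul]
          simp only [mul_assoc]
      _ = W * (j * r * d * (j * r)) := by rw [hc, one_smul, e1]; simp only [mul_assoc]
      _ = W * ((-Complex.I) • d) := by rw [e2]
  rw [smul_mul_assoc, neg_mul, e3, mul_smul_comm, smul_neg, smul_smul, mul_neg, neg_mul, neg_neg,
    Complex.I_mul_I, neg_smul, neg_neg, one_smul]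

end ComplexWeylStar

noncomputable section

section Fibre

variable {E : Type*} [NormedAddCommGroup E] [NormedSpace ℂ E] {g : E →L[ℝ] E →L[ℝ] ℝ}

lemma pullMetric_I (hJ : ∀ v w, g (Complex.I • v) (Complex.I • w) = g v w) :
    pullMetric (Complex.I • ContinuousLinearMap.id ℂ E) g = g := by
  ext v w
  rw [pullMetric_apply]
  exact hJ v w

lemma scaleExt_fundamentalElt [FiniteDimensional ℂ E]
    (hJ : ∀ v w, g (Complex.I • v) (Complex.I • w) = g v w) :
    scaleExt Complex.I (fundamentalElt g) = fundamentalElt g := by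
  rw [scaleExt, fundamentalElt_pull, pullMetric_I hJ]

/-- J is a complex linear isometry, so this is the naturality of contractions for T = J, with
inverse -J. -/
lemma scaleExt_contraction (hg : g.IsInvertible)
    (hJ : ∀ v w, g (Complex.I • v) (Complex.I • w) = g v w) (a b : CxExt E) :
    scaleExt Complex.I (contraction g a b) =
      contraction g (scaleExt Complex.I a) (scaleExt Complex.I b) := by
  have hp := pullMetric_I hJ
  have h := contraction_pull (g := g) (T := Complex.I • ContinuousLinearMap.id ℂ E)
    (S := (-Complex.I) • ContinuousLinearMap.id ℂ E) hg
    (fun v => by simp [smul_smul]) (hp.symm ▸ hg) a b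
  rw [hp] at h
  exact h.symm

end Fibre

/-! ### The Lefschetz operators of a Hermitian manifold and the Weyl conjugates of ∂̄ and ∂̄ω ∧ _.
-/

namespace HermitianMetric

variable {E : Type*} [NormedAddCommGroup E] [NormedSpace ℂ E] [FiniteDimensional ℂ E]
  {M : Type*} [TopologicalSpace M] [ChartedSpace E M] [IsManifold 𝓘(ℂ, E) ω M]
  (g : HermitianMetric E M)

lemma isPointwise_lefschetz : IsPointwise g.lefschetz fun x =>
    LinearMap.mulLeft ℂ (fundamentalElt (g.at x)) := fun _ _ => rfl

lemma isPointwise_lefschetzAdj : IsPointwise g.lefschetzAdj fun x =>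
    wedgeAdjoint (g.at x) (fundamentalElt (g.at x)) := fun _ _ => rfl

lemma lefschetz_pow_eq_zero : g.lefschetz ^ (Module.finrank ℂ E + 1) = 0 :=
  (g.isPointwise_lefschetz.nilExp fun x => mulLeft_fundamentalElt_pow_eq_zero (g.at x)).1

lemma lefschetzAdj_pow_eq_zero : g.lefschetzAdj ^ (Module.finrank ℂ E + 1) = 0 :=
  (g.isPointwise_lefschetzAdj.nilExp fun x => wedgeAdjoint_fundamentalElt_pow_eq_zero (g.at x)).1

lemma isPointwise_weylOp : IsPointwise (weylOp ℂ g.lefschetz g.lefschetzAdj) fun x =>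
    weylExt (g.at x) := by
  have h1 := (g.isPointwise_lefschetz.neg.nilExp (n := Module.finrank ℂ E + 1) fun x => by
    rw [neg_mulLeft, LinearMap.pow_mulLeft, neg_fundamentalElt_pow_eq_zero,
      LinearMap.mulLeft_zero_eq_zero]).2
  have h2 := (g.isPointwise_lefschetzAdj.nilExp fun x =>
    wedgeAdjoint_fundamentalElt_pow_eq_zero (g.at x)).2
  exact (h1.mul h2).mul h1

lemma fundamentalForm_mem : g.fundamentalForm ∈ formDegree E M 2 := fun x =>
  fundamentalElt_mem (g.at x)

lemma lefschetz_hasDegree : HasDegree (formDegree E M) 2 g.lefschetz := fun j α hα => by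
  rw [add_comm]
  exact SetLike.mul_mem_graded g.fundamentalForm_mem hα

lemma hasOrderLE_lefschetzAdj : HasOrderLE (formDegree E M) 2 (-2) g.lefschetzAdj :=
  g.isPointwise_lefschetzAdj.hasOrderLE fun x => hasOrderLE_wedgeAdjoint_fundamentalElt (g.at x)

lemma lefschetzAdj_hasDegree : HasDegree (formDegree E M) (-2) g.lefschetzAdj :=
  g.hasOrderLE_lefschetzAdj.1

lemma volumeForm_apply (x : M) : g.volumeForm.1 x = volElt (g.at x) := rfl

/-- The fibrewise formula `hodgeStar_eq`, globalised: it turns conjugation with the star into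
conjugation with W in the algebra of operators on smooth forms. -/
lemma star_eq : g.star = ((-1) ^ Module.finrank ℂ E : ℂ) •
    (weylOp ℂ g.lefschetz g.lefschetzAdj * (formScale Complex.I * formReverse)) :=
  LinearMap.ext fun α => Subtype.ext <| funext fun x => by
    change hodgeStar (g.at x) (g.volumeForm.1 x) (α.1 x) = ((-1) ^ Module.finrank ℂ E : ℂ) •
      (weylOp ℂ g.lefschetz g.lefschetzAdj (formScale Complex.I (formReverse α))).1 x
    rw [g.isPointwise_weylOp, volumeForm_apply,
      hodgeStar_eq (g.isInvertible x) (g.symm x) (g.inner_J x)]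
    rfl

lemma star_mem {j : ℤ} {α : smoothForms E M} (hα : α ∈ formDegree E M j) :
    g.star α ∈ formDegree E M (2 * Module.finrank ℂ E + -j) := fun x => by
  have hr : CliffordAlgebra.reverse (α.1 x) ∈ extDegree (E := E) j := by
    rw [reverse_of_mem (hα x)]
    rcases Int.units_eq_one_or (j * (j - 1) / 2).negOnePow with e | e <;> rw [e]
    · rw [one_smul]; exact hα x
    · rw [Units.neg_smul, one_smul]; exact neg_mem (hα x)
  refine contraction_hasDegree (g.at x) hr _ _ ?_
  rw [volumeForm_apply]
  refine Submodule.smul_mem _ _ ?_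
  have h := SetLike.pow_mem_graded (A := extDegree (E := E)) (Module.finrank ℂ E)
    (g.fundamentalForm_mem x)
  rwa [nsmul_eq_mul, mul_comm] at h

lemma partialAdj_hasDegree : HasDegree (formDegree E M) (-1) g.partialAdj := fun j α hα => by
  have h := g.star_mem (dbarOp_hasDegree _ _ (g.star_mem hα))
  rw [show 2 * (Module.finrank ℂ E : ℤ) + -(2 * Module.finrank ℂ E + -j + 1) = j + -1 by ring] at h
  exact neg_mem h

lemma formScale_mul_lefschetz :
    formScale Complex.I * g.lefschetz = g.lefschetz * formScale Complex.I :=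
  LinearMap.ext fun α => Subtype.ext <| funext fun x => by
    change scaleExt Complex.I (fundamentalElt (g.at x) * α.1 x) =
      fundamentalElt (g.at x) * scaleExt Complex.I (α.1 x)
    rw [map_mul, scaleExt_fundamentalElt (g := g.at x) (g.inner_J x)]

lemma formScale_mul_lefschetzAdj :
    formScale Complex.I * g.lefschetzAdj = g.lefschetzAdj * formScale Complex.I :=
  LinearMap.ext fun α => Subtype.ext <| funext fun x => by
    change scaleExt Complex.I (wedgeAdjoint (g.at x) (fundamentalElt (g.at x)) (α.1 x)) =
      wedgeAdjoint (g.at x) (fundamentalElt (g.at x)) (scaleExt Complex.I (α.1 x))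
    rw [wedgeAdjoint_fundamentalElt, scaleExt_contraction (g.isInvertible x) (g.inner_J x), map_neg,
      scaleExt_fundamentalElt (g := g.at x) (g.inner_J x)]

/-- Here j is the action of J, which is i^{p-q} on type (p, q), r is the reversal and σ = j² is the
sign of the degree. The definition of ∂* through the star enters only here and in the count of its
degree. -/
lemma weylOp_mul_dbarOp : weylOp ℂ g.lefschetz g.lefschetzAdj * dbarOp E M =
    ((-Complex.I) • g.partialAdj) * weylOp ℂ g.lefschetz g.lefschetzAdj := by
  refine weylOp_mul_eq_star_conj (B := Module.End ℂ (smoothForms E M)) (j := formScale Complex.I)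
    (r := formReverse) (σ := formScale (-1)) ⟨_, g.lefschetz_pow_eq_zero⟩
    ⟨_, g.lefschetzAdj_pow_eq_zero⟩ g.formScale_mul_lefschetz g.formScale_mul_lefschetzAdj
    (formReverse_mul_of_degree_two g.lefschetz_hasDegree)
    (formReverse_mul_of_degree_neg_two g.lefschetzAdj_hasDegree)
    (formReverse_mul_formScale _) formReverse_mul_self ?_ ?_ ?_ ?_
    (formReverse_mul_of_degree_one dbarOp_hasDegree) ?_ g.star_eq
  · rw [formScale_mul_formScale, Complex.I_mul_I]
  · rw [formScale_mul_formScale, neg_mul_neg, one_mul, formScale_one]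
  · rw [formScale_mul_dbarOp, Complex.conj_I]
  · rw [formScale_mul_dbarOp, map_neg, map_one]
    exact LinearMap.ext fun α =>
      neg_one_smul ℂ ((dbarOp E M * formScale (-1) : Module.End ℂ (smoothForms E M)) α)
  · rw [← mul_pow]; norm_num

/-- The operator `∂̄ω ∧ _`. -/
def lambdaBar : Module.End ℂ (smoothForms E M) :=
  LinearMap.mulLeft ℂ (dbarOp E M g.fundamentalForm)

lemma dbarOp_fundamentalForm_mem : dbarOp E M g.fundamentalForm ∈ formDegree E M 3 :=
  dbarOp_hasDegree 2 _ g.fundamentalForm_mem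

/-- The conjugate of ∂ω is ∂̄ω because ω is real, and the reversal of a 3-form is its negative. -/
lemma isPointwise_lambdaAdj : IsPointwise g.lambdaAdj fun x =>
    contraction (g.at x) (-(dbarOp E M g.fundamentalForm).1 x) := fun α x => by
  change contraction (g.at x) (CliffordAlgebra.reverse
    (conjForm ((partialOp E M g.fundamentalForm).1 x))) (α.1 x) = _
  rw [conjForm_partialOp (α := g.fundamentalForm) (β := g.fundamentalForm) fun x =>
       (conjForm_fundamentalElt (g.at x)).symm,
    reverse_of_mem (g.dbarOp_fundamentalForm_mem x), show (3 * (3 - 1) / 2 : ℤ) = 3 by norm_num,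
    Int.negOnePow_odd 3 (by decide), Units.neg_smul, one_smul]

lemma lambdaAdj_hasDegree : HasDegree (formDegree E M) (-3) g.lambdaAdj :=
  g.isPointwise_lambdaAdj.hasDegree fun x =>
    contraction_hasDegree (g.at x) (neg_mem (g.dbarOp_fundamentalForm_mem x))

/-- J preserves ω, and ∂̄ adds a covector of type (0, 1), of weight -i. -/
lemma scaleExt_dbarOp_fundamentalForm (x : M) :
    scaleExt Complex.I ((dbarOp E M g.fundamentalForm).1 x) =
      (-Complex.I) • (dbarOp E M g.fundamentalForm).1 x := by
  have h := congrArg (fun f : Module.End ℂ (smoothForms E M) => (f g.fundamentalForm).1 x)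
    (formScale_mul_dbarOp (E := E) (M := M) Complex.I)
  have hw : formScale Complex.I g.fundamentalForm = g.fundamentalForm :=
    Subtype.ext <| funext fun x => scaleExt_fundamentalElt (g.inner_J x)
  rw [Complex.conj_I] at h
  have h' : scaleExt Complex.I ((dbarOp E M g.fundamentalForm).1 x) =
    (-Complex.I) • (dbarOp E M (formScale Complex.I g.fundamentalForm)).1 x := h
  rw [h', hw]

/-- The form i ∂̄ω is carried to ∂̄ω by J, so W conjugates ∂̄ω ∧ _ into the contraction with i ∂̄ω;
as λ* is the contraction with -∂̄ω, this is -i λ*. -/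
lemma weylOp_mul_lambdaBar : weylOp ℂ g.lefschetz g.lefschetzAdj * g.lambdaBar =
    ((-Complex.I) • g.lambdaAdj) * weylOp ℂ g.lefschetz g.lefschetzAdj := by
  refine (g.isPointwise_weylOp.mul (IsPointwise.mulLeft _)).ext
    ((g.isPointwise_lambdaAdj.smul _).mul g.isPointwise_weylOp) fun x => ?_
  have h := weylExt_mul_mulLeft (g.isInvertible x) (g.symm x) (g.inner_J x)
    (Complex.I • (dbarOp E M g.fundamentalForm).1 x)
  rw [map_smul, scaleExt_dbarOp_fundamentalForm, smul_smul, mul_neg, Complex.I_mul_I, neg_neg,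
    one_smul] at h
  rw [h, map_smul, map_neg, smul_neg, neg_smul, neg_neg]

lemma dbarOp_mul_lefschetz_sub :
    dbarOp E M * g.lefschetz - g.lefschetz * dbarOp E M = g.lambdaBar :=
  LinearMap.ext fun α => by
    change dbarOp E M (g.fundamentalForm * α) - g.fundamentalForm * dbarOp E M α =
      dbarOp E M g.fundamentalForm * α
    rw [dbarOp_leibniz 2 _ g.fundamentalForm_mem, Int.negOnePow_even 2 even_two, one_smul,
      add_sub_cancel_right]

lemma lefschetz_mul_lambdaBar : g.lefschetz * g.lambdaBar = g.lambdaBar * g.lefschetz :=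
  LinearMap.ext fun α => by
    change g.fundamentalForm * (dbarOp E M g.fundamentalForm * α) =
      dbarOp E M g.fundamentalForm * (g.fundamentalForm * α)
    rw [← mul_assoc, ← mul_assoc, formDegree_graded_comm 2 3 _ g.fundamentalForm_mem _
      g.dbarOp_fundamentalForm_mem, Int.negOnePow_even _ (by decide), one_smul]

/-- Both are contractions with forms, and contraction is an algebra homomorphism; ω has even degree
and so commutes with ∂̄ω. This is why 𝔻 stops at ξ². -/
lemma lefschetzAdj_mul_lambdaAdj :
    g.lefschetzAdj * g.lambdaAdj = g.lambdaAdj * g.lefschetzAdj := by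
  refine (g.isPointwise_lefschetzAdj.mul g.isPointwise_lambdaAdj).ext
    (g.isPointwise_lambdaAdj.mul g.isPointwise_lefschetzAdj) fun x => ?_
  rw [wedgeAdjoint_fundamentalElt, ← map_mul, ← map_mul, neg_mul_neg, neg_mul_neg,
    extDegree_graded_comm 2 3 (fundamentalElt (g.at x)) (g.fundamentalForm_mem x) _ (g.dbarOp_fundamentalForm_mem x),
    Int.negOnePow_even _ (by decide), one_smul]

end HermitianMetric

end


/-! ## The commutative BV-infinity algebra of a Hermitian manifold -/

section Gauge

variable {K A : Type*} [Field K] [Ring A] [Algebra K A]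

/-- The coefficients of a conjugate of a differential form a multicomplex. -/
lemma sum_antidiagonal_mul_eq_zero [CharZero K] {a : Module.End K A} {Δ : ℕ → Module.End K A}
    (hΔ : PowerSeries.mk Δ = opExp (PowerSeries.C a * PowerSeries.X) * PowerSeries.C (Δ 0) *
      opExp (-(PowerSeries.C a * PowerSeries.X))) (h0 : Δ 0 * Δ 0 = 0) (n : ℕ) :
    ∑ ij ∈ Finset.HasAntidiagonal.antidiagonal n, Δ ij.1 * Δ ij.2 = 0 := by
  have key : ∀ {B : Type _} [Ring B] (u v d : B), v * u = 1 → d * d = 0 →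
      (u * d * v) * (u * d * v) = 0 := fun u v d huv hd => by
    rw [mul_assoc (u * d), ← mul_assoc v, ← mul_assoc v, huv, one_mul, mul_assoc u, ← mul_assoc d,
      hd, zero_mul, mul_zero]
  have h : PowerSeries.mk Δ * PowerSeries.mk Δ = 0 := by
    rw [hΔ]
    -- The relations are the coefficients of the square of a conjugate of `Δ 0`, which vanishes with
    -- the square of `Δ 0`.
    exact key _ _ _ (opExp_neg_mul_opExp a) (by rw [← map_mul, h0, map_zero])
  have h' := congrArg (PowerSeries.coeff n) h
  rw [PowerSeries.coeff_mul, map_zero] at h'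
  simpa only [PowerSeries.coeff_mk] using h'

lemma factorial_inv_smul_adOp_pow [CharZero K] {a : Module.End K A} {Δ : ℕ → Module.End K A}
    (h1 : adOp K a (Δ 0) = Δ 1) (h2 : ((adOp K a) ^ 2) (Δ 0) = (2 : K) • Δ 2)
    (h3 : a * Δ 2 = Δ 2 * a) (h4 : ∀ n, Δ (n + 3) = 0) (n : ℕ) :
    ((n.factorial : K)⁻¹) • ((adOp K a) ^ n) (Δ 0) = Δ n := by
  match n with
  | 0 => rw [Nat.factorial_zero, Nat.cast_one, inv_one, one_smul, pow_zero, Module.End.one_apply]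
  | 1 => rw [Nat.factorial_one, Nat.cast_one, inv_one, one_smul, pow_one, h1]
  | 2 =>
    rw [h2, Nat.factorial_two, smul_smul, Nat.cast_ofNat, inv_mul_cancel₀ two_ne_zero, one_smul]
  | n + 3 =>
    rw [h4, show n + 3 = n + 1 + 2 by ring, pow_add, Module.End.mul_apply, h2, map_smul, pow_succ,
      Module.End.mul_apply, adOp_apply, h3, sub_self, map_zero, smul_zero, smul_zero]

lemma smul_add_commutator (c : K) (p l L : Module.End K A) :
    c • p + ((c • l) * L - L * (c • l)) = c • (p + (l * L - L * l)) := by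
  rw [smul_add, smul_sub, smul_mul_assoc, mul_smul_comm]

lemma neg_two_smul_neg_smul (c : K) (l : Module.End K A) :
    -((2 : K) • (-c) • l) = (2 : K) • c • l :=
  LinearMap.ext fun a => by
    change -((2 : K) • (-c) • l a) = (2 : K) • c • l a
    rw [neg_smul, smul_neg, neg_neg]

variable {𝒜 : ℤ → Submodule K A}

lemma HasOrderLE.adOp [SetLike.GradedMonoid 𝒜] (hI : DirectSum.IsInternal 𝒜)
    (hcomm : ∀ i j : ℤ, ∀ a ∈ 𝒜 i, ∀ b ∈ 𝒜 j, a * b = (i * j).negOnePow • (b * a))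
    {n r s : ℕ} {j k : ℤ} {f g : Module.End K A} (hn : r + s = n + 1)
    (hf : HasOrderLE 𝒜 r j f) (hg : HasOrderLE 𝒜 s k g) (hj : Even (j * k)) :
    HasOrderLE 𝒜 n (j + k) (adOp K f g) := by
  rw [adOp_apply, ← gradedComm_of_even hj]
  exact HasOrderLE.gradedComm hI hcomm hn hf hg

lemma HasOrderLE.of_two_smul [CharZero K] {r : ℕ} {k : ℤ} {f : Module.End K A}
    (h : HasOrderLE 𝒜 r k ((2 : K) • f)) : HasOrderLE 𝒜 r k f := by
  have h' := h.smul (2⁻¹ : K)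
  rwa [smul_smul, inv_mul_cancel₀ two_ne_zero, one_smul] at h'

lemma HasDegree.coeff_C_mul_X {a : Module.End K A} (ha : HasDegree 𝒜 (-2) a) (i : ℕ) :
    HasDegree 𝒜 (-2 * (i : ℤ))
      (PowerSeries.coeff i (PowerSeries.C a * (PowerSeries.X : PowerSeries (Module.End K A)))) := by
  rw [PowerSeries.coeff_C_mul, PowerSeries.coeff_X]
  split_ifs with hi
  · subst hi
    rwa [mul_one]
  · rw [mul_zero]
    exact HasDegree.zero _

end Gauge

noncomputable section

/-! ### The commutators of Λ with ∂̄ and the conclusions. -/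

namespace HermitianMetric

variable {E : Type*} [NormedAddCommGroup E] [NormedSpace ℂ E] [FiniteDimensional ℂ E]
  {M : Type*} [TopologicalSpace M] [ChartedSpace E M] [IsManifold 𝓘(ℂ, E) ω M]
  (g : HermitianMetric E M)

/-- The Kähler identities with torsion: `ad_of_weylOp_conj` is applied with y = -i ∂* and z = -i λ*,
so that y + [z, L] = -i (∂* + τ*) and -2 z = 2 i λ*. -/
lemma adOp_lefschetzAdj_dbarOp : adOp ℂ g.lefschetzAdj (dbarOp E M) = g.Delta 1 ∧
    ((adOp ℂ g.lefschetzAdj) ^ 2) (dbarOp E M) = (2 : ℂ) • g.Delta 2 := by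
  obtain ⟨h1, h2⟩ := ad_of_weylOp_conj formDegree_isInternal ⟨_, g.lefschetz_pow_eq_zero⟩
    ⟨_, g.lefschetzAdj_pow_eq_zero⟩ g.lefschetz_hasDegree g.lefschetzAdj_hasDegree
    dbarOp_hasDegree (g.partialAdj_hasDegree.smul (-Complex.I))
    (g.lambdaAdj_hasDegree.smul (-Complex.I)) g.dbarOp_mul_lefschetz_sub
    g.lefschetz_mul_lambdaBar g.weylOp_mul_dbarOp g.weylOp_mul_lambdaBar
  refine ⟨h1.trans ?_, h2.trans ?_⟩
  · rw [Delta, torsionAdj, gradedComm_of_even ⟨-3, by norm_num⟩]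
    exact smul_add_commutator _ _ _ _
  · exact neg_two_smul_neg_smul _ _

lemma lefschetzAdj_mul_Delta_two : g.lefschetzAdj * g.Delta 2 = g.Delta 2 * g.lefschetzAdj := by
  rw [Delta, mul_smul_comm, smul_mul_assoc, lefschetzAdj_mul_lambdaAdj]

/-- `Δ_n` is the `n`-fold commutator of `∂̄` with `Λ`, divided by `n!`. -/
lemma Delta_eq (n : ℕ) :
    ((n.factorial : ℂ)⁻¹) • ((adOp ℂ g.lefschetzAdj) ^ n) (dbarOp E M) = g.Delta n :=
  factorial_inv_smul_adOp_pow (Δ := g.Delta) g.adOp_lefschetzAdj_dbarOp.1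
    g.adOp_lefschetzAdj_dbarOp.2 g.lefschetzAdj_mul_Delta_two (fun _ => rfl) n

lemma mk_Delta_eq : PowerSeries.mk g.Delta =
    opExp (PowerSeries.C g.lefschetzAdj * PowerSeries.X) * PowerSeries.C (dbarOp E M) *
      opExp (-(PowerSeries.C g.lefschetzAdj * PowerSeries.X)) :=
  PowerSeries.ext fun n => by
    rw [coeff_opExp_conj, PowerSeries.coeff_mk, Delta_eq]

lemma totalDifferential_eq_mk : g.totalDifferential = PowerSeries.mk g.Delta :=
  PowerSeries.ext fun n => by
    rw [totalDifferential, PowerSeries.coeff_mk, map_add, map_add, PowerSeries.coeff_C_mul,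
      PowerSeries.coeff_C_mul, PowerSeries.coeff_C, PowerSeries.coeff_X, PowerSeries.coeff_X_pow]
    match n with
    | 0 => simp
    | 1 => simp
    | 2 => simp
    | n + 3 => simp [Delta]

lemma Delta_hasDegree (n : ℕ) : HasDegree (formDegree E M) (1 - 2 * (n : ℤ)) (g.Delta n) := by
  rw [← Delta_eq]
  exact ((g.lefschetzAdj_hasDegree.adOp_pow dbarOp_hasDegree n).smul _).congr (by ring)

/-- The commutator of Λ and ∂̄ has order at most 2 + 1 - 1, although the definition of ∂* through
the star shows no bound. -/
lemma hasOrderLE_Delta_one : HasOrderLE (formDegree E M) 2 (-1) (g.Delta 1) := by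
  rw [← g.adOp_lefschetzAdj_dbarOp.1]
  exact HasOrderLE.adOp (𝒜 := formDegree E M) (n := 2) (r := 2) (s := 1) (j := -2) (k := 1)
    formDegree_isInternal formDegree_graded_comm rfl g.hasOrderLE_lefschetzAdj hasOrderLE_dbarOp
    (by decide)

/-- The operator 2 Δ₂ = [Λ, Δ₁] has order at most 2 + 2 - 1. -/
lemma hasOrderLE_Delta_two : HasOrderLE (formDegree E M) 3 (-3) (g.Delta 2) := by
  have h := HasOrderLE.adOp (𝒜 := formDegree E M) (n := 3) (r := 2) (s := 2) (j := -2) (k := -1)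
    formDegree_isInternal formDegree_graded_comm rfl g.hasOrderLE_lefschetzAdj
    g.hasOrderLE_Delta_one (by decide)
  have e : adOp ℂ g.lefschetzAdj (g.Delta 1) = (2 : ℂ) • g.Delta 2 := by
    rw [← g.adOp_lefschetzAdj_dbarOp.1, ← g.adOp_lefschetzAdj_dbarOp.2, pow_two,
      Module.End.mul_apply]
  rw [e] at h
  exact HasOrderLE.of_two_smul h

lemma hasOrderLE_Delta (n : ℕ) (hn : 1 ≤ n) :
    HasOrderLE (formDegree E M) (n + 1) (1 - 2 * (n : ℤ)) (g.Delta n) :=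
  match n, hn with
  | 1, _ => g.hasOrderLE_Delta_one
  | 2, _ => g.hasOrderLE_Delta_two
  | _ + 3, _ => HasOrderLE.zero _ _

lemma isCommBVInfty : IsCommBVInfty (formDegree E M) g.Delta where
  cdga :=
    { isInternal := formDegree_isInternal
      gradedMonoid := formDegree_gradedMonoid
      graded_comm := formDegree_graded_comm
      degree := dbarOp_hasDegree
      leibniz := dbarOp_leibniz
      sq_zero := dbarOp_mul_self }
  multicomplex :=
    { isInternal := formDegree_isInternal
      degree := g.Delta_hasDegree
      relation := sum_antidiagonal_mul_eq_zero g.mk_Delta_eq dbarOp_mul_self }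
  order := g.hasOrderLE_Delta

/-- The gauge is φ = Λξ, with no terms of higher order in ξ. -/
lemma hasDegenerationProperty : HasDegenerationProperty (formDegree E M) g.Delta := by
  refine ⟨PowerSeries.C g.lefschetzAdj * PowerSeries.X, ?_,
    HasDegree.coeff_C_mul_X g.lefschetzAdj_hasDegree, g.mk_Delta_eq.symm⟩
  rw [PowerSeries.coeff_C_mul, PowerSeries.coeff_zero_X, mul_zero]

end HermitianMetric

end

theorem mainTheorem1 {E : Type*} [NormedAddCommGroup E] [NormedSpace ℂ E] [FiniteDimensional ℂ E]
    {M : Type*} [TopologicalSpace M] [ChartedSpace E M] [IsManifold 𝓘(ℂ, E) ω M]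
    (g : HermitianMetric E M) :
    IsCommBVInfty (formDegree E M) g.Delta ∧
    g.totalDifferential =
      opExp (PowerSeries.C g.lefschetzAdj * PowerSeries.X) * PowerSeries.C (dbarOp E M) *
        opExp (-(PowerSeries.C g.lefschetzAdj * PowerSeries.X)) ∧
    HasDegenerationProperty (formDegree E M) g.Delta :=
  ⟨g.isCommBVInfty, g.totalDifferential_eq_mk.trans g.mk_Delta_eq, g.hasDegenerationProperty⟩
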